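/- Let $M$ be a compact surface, possibly with boundary, with a triangulation (a finite simplicial complex) with sets $F$, $E$, $V$ of triangles, edges and vertices. Let $E_\partial$ be the edges lying in exactly one triangle, $V_\partial$ their endpoints, and $V_{\rm int}=V\setminus V_\partial$. Let $d_v$ be the degree of $v$ and $L_v$ the set of its neighbours; the link of $v$ is a cycle on $L_v$ if $v\in V_{\rm int}$ and a path if $v\in V_\partial$. Assume that * any three pairwise adjacent vertices, at least one of them interior, span a triangle of $F$; * the triangulation is a triangular lattice along the boundary, in the sense that every $v\in V_\partial$ has exactly four neighbours, two of which are interior, and every interior vertex has at most two neighbours in $V_\partial$. Each vertex $v$ carries a finite-dimensional Hilbert space $\mathcal H_v$. Let $\rho$ be a density matrix on $\mathcal H=\bigotimes_v\mathcal H_v$. For $A\subseteq V$ let $\rho_A$ be the reduced density matrix, $S_A=-\operatorname{Tr}\rho_A\log\rho_A$, and $K_A=-\log\rho_A$, acting on $\mathcal H$ as $K_A\otimes 1$, where the logarithm is taken on the support of $\rho_A$ and $K_A$ is set to $0$ on its kernel. Put $$\hat\Delta(B,C,D)=K_{BC}+K_{CD}-K_B-K_D,$$ $$\hat\gamma_{f}=K_{ab}+K_{bc}+K_{ac}-K_{abc}-K_a-K_b-K_c\quad(f=\langle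 abc\rangle),\qquad \overline{\hat\gamma_v}=\frac1{d_v}\sum_{f\ni v}\hat\gamma_f .$$ For $v\in V_{\rm int}$ let $\overline{\hat\Delta_v}$ be the average of $\hat\Delta(B,\{v\},D)$ over all partitions of the link of $v$ into two nonempty arcs $B,D$ with $(|B|,|D|)=(m,n)$, where $m+n=d_v$ runs over the partitions of the integer $d_v$ into two positive integers $m\le n$, and for each of them over its $d_v$ orientations (rotations). For $v\in V_\partial$ let $\overline{\hat\Delta^\partial_v}$ be the average of $\hat\Delta(B,\{v\},D)$ over the three partitions of the link of $v$ (a path with four vertices) into two nonempty arcs $B,D$. Define $$H_{\rm rec}^{\Delta}=\sum_{v\in V_{\rm int}}\tfrac12\overline{\hat\Delta_v}+\sum_{v\in V_\partial}\tfrac12\overline{\hat\Delta_v^\partial},\qquad H_{\rm rec}^{\rm Euler}=\sum_{f\in F}K_f-\sum_{e\in E\setminus E_\partial}K_e+\sum_{v\in V_{\rm int}}K_v .$$ Assume that $\rho$ satisfies A1 in the bulk: for every $v\in V_{\rm int}$ and every partition of the link of $v$ into two nonempty arcs $B,D$, $$S_{BC}+S_{CD}-S_B-S_D=0\qquad\text{with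 } C=\{v\}.$$ No condition on $\rho$ is imposed at the boundary. Let $W\subseteq\mathcal H$ be the subspace of vectors orthogonal to the kernels of $\rho_A\otimes 1$ for all regions $A$ that occur in these definitions (triangles, edges, vertices, and, for every vertex, the arcs $B$, $D$ above, with and without the vertex itself). Then $W$ contains the support of $\rho$, and $$H_{\rm rec}^{\Delta}-\sum_{v\in V_{\rm int}}\frac{6-d_v}{6}\,\overline{\hat\gamma_v}=H_{\rm rec}^{\rm Euler}\qquad\text{on } W,$$ that is, both sides agree when applied to any vector of $W$. In particular, if the boundary is empty, then on $W$ the left-hand side equals $\sum_{f\in F}K_f-\sum_{e\in E}K_e+\sum_{v\in V}K_v$. -/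

import Mathlib

open scoped Matrix Kronecker ComplexOrder

noncomputable section

/-! ### Triangulated surfaces -/

/-- The link of a vertex `v` in a family `F` of triangles: `a` and `b` are joined when
`v`, `a`, `b` span a triangle. -/
def linkGraph {V : Type*} [DecidableEq V] (F : Finset (Finset V)) (v : V) : SimpleGraph V where
  Adj a b := a ≠ b ∧ ({v, a, b} : Finset V) ∈ F
  symm := ⟨fun a b h => ⟨h.1.symm, by rw [Finset.pair_comm b a]; exact h.2⟩⟩
  loopless := ⟨fun _ h => h.1 rfl⟩

/-- A triangulation of a compact surface, possibly with boundary and possibly disconnected, with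
vertex set `V`: a family of triangles such that every edge lies in at most two triangles and the
link of every vertex is non-empty and connected. As the link of `v` has maximal degree at most
two, it is a cycle (`v` is an interior vertex) or a path (`v` is a boundary vertex). -/
structure TriangulatedSurface (V : Type*) [DecidableEq V] where
  /-- the triangles -/
  faces : Finset (Finset V)
  card_face : ∀ f ∈ faces, f.card = 3
  card_faces_le_two : ∀ a b : V, a ≠ b → (faces.filter fun f => {a, b} ⊆ f).card ≤ 2
  link_connected : ∀ v : V,
    ((linkGraph faces v).induce {u | u ≠ v ∧ ∃ f ∈ faces, v ∈ f ∧ u ∈ f}).Connected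

namespace TriangulatedSurface

variable {V : Type*} [Fintype V] [DecidableEq V] (T : TriangulatedSurface V)

/-- Two distinct vertices are adjacent when they lie in a common triangle. -/
def Adj (u v : V) : Prop := u ≠ v ∧ ∃ f ∈ T.faces, v ∈ f ∧ u ∈ f

/-- The edges: two-element subsets of triangles. -/
def edges : Finset (Finset V) := T.faces.biUnion fun f => f.powersetCard 2

/-- The boundary edges: those that lie in exactly one triangle. -/
def boundaryEdges : Finset (Finset V) :=
  T.edges.filter fun e => (T.faces.filter fun f => e ⊆ f).card = 1

open Classical in
/-- The boundary vertices: the endpoints of boundary edges. -/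
def boundaryVerts : Finset V := Finset.univ.filter fun v => ∃ e ∈ T.boundaryEdges, v ∈ e

/-- The interior vertices. -/
def interiorVerts : Finset V := Finset.univ \ T.boundaryVerts

open Classical in
/-- The neighbours of `v`, that is, the vertices of its link. -/
def nbrs (v : V) : Finset V := Finset.univ.filter fun u => T.Adj u v

/-- The degree of a vertex. -/
def deg (v : V) : ℕ := (T.nbrs v).card

open Classical in
/-- The sets `B` such that `B` and `D = nbrs v \ B` are the two parts of a partition of the link
of `v` into two (non-empty) arcs. -/
def arcs (v : V) : Finset (Finset V) :=
  (T.nbrs v).powerset.filter fun B =>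
    ((linkGraph T.faces v).induce (B : Set V)).Connected ∧
      ((linkGraph T.faces v).induce ((T.nbrs v \ B : Finset V) : Set V)).Connected

/-- Three pairwise adjacent vertices, not all on the boundary, span a triangle. -/
def NoEmptyTriangle : Prop :=
  ∀ a b c : V, T.Adj a b → T.Adj b c → T.Adj a c → a ∈ T.interiorVerts → {a, b, c} ∈ T.faces

/-- The triangulation looks like a triangular lattice along the boundary: every boundary vertex
has four neighbours, exactly two of them interior, and an interior vertex has at most two
neighbours on the boundary. -/
def LatticeBoundary : Prop :=
  (∀ v ∈ T.boundaryVerts, T.deg v = 4 ∧ (T.nbrs v ∩ T.interiorVerts).card = 2) ∧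
    ∀ v ∈ T.interiorVerts, (T.nbrs v ∩ T.boundaryVerts).card ≤ 2

end TriangulatedSurface

/-! ### States, entropies and entanglement Hamiltonians -/

section States

variable {V : Type*} [Fintype V] [DecidableEq V]
  {κ : V → Type*} [∀ v, Fintype (κ v)] [∀ v, DecidableEq (κ v)]

/-- Splitting of a configuration into its parts on the region `A` and on its complement. It
realizes `⨂ v, ℂ^(κ v)` as the tensor product of the space of `A` and that of its complement. -/
def splitConfig (κ : V → Type*) (A : Finset V) :
    (∀ v, κ v) ≃ (∀ v : {v // v ∈ A}, κ v) × (∀ v : {v // ¬ v ∈ A}, κ v) :=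
  Equiv.piEquivPiSubtypeProd (fun v => v ∈ A) κ

/-- The reduced density matrix `ρ_A`: the partial trace over the complement of `A`. -/
def reducedDensity (ρ : Matrix (∀ v, κ v) (∀ v, κ v) ℂ) (A : Finset V) :
    Matrix (∀ v : {v // v ∈ A}, κ v) (∀ v : {v // v ∈ A}, κ v) ℂ :=
  Matrix.of fun s t =>
    ∑ r, ρ ((splitConfig κ A).symm (s, r)) ((splitConfig κ A).symm (t, r))

/-- An operator on the region `A`, extended by the identity to the whole system. -/
def extendOp (A : Finset V)
    (M : Matrix (∀ v : {v // v ∈ A}, κ v) (∀ v : {v // v ∈ A}, κ v) ℂ) :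
    Matrix (∀ v, κ v) (∀ v, κ v) ℂ :=
  (M ⊗ₖ (1 : Matrix (∀ v : {v // ¬ v ∈ A}, κ v) (∀ v : {v // ¬ v ∈ A}, κ v) ℂ)).submatrix
    (splitConfig κ A) (splitConfig κ A)

/-- The von Neumann entropy `S(A) = - Tr ρ_A log ρ_A`. -/
def entropy (ρ : Matrix (∀ v, κ v) (∀ v, κ v) ℂ) (A : Finset V) : ℝ :=
  -(reducedDensity ρ A * cfc Real.log (reducedDensity ρ A)).trace.re

/-- The entanglement Hamiltonian `K_A = - log ρ_A` (tensored with the identity). The logarithm is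
taken on the support of `ρ_A`; as `Real.log 0 = 0`, the operator vanishes on the kernel. -/
def entHam (ρ : Matrix (∀ v, κ v) (∀ v, κ v) ℂ) (A : Finset V) :
    Matrix (∀ v, κ v) (∀ v, κ v) ℂ :=
  extendOp A (-cfc Real.log (reducedDensity ρ A))

/-- The support of `ρ_A` (tensored with the whole space of the complement of `A`). The range of a
Hermitian matrix is the orthogonal complement of its kernel. -/
def regionSupport (ρ : Matrix (∀ v, κ v) (∀ v, κ v) ℂ) (A : Finset V) :
    Submodule ℂ ((∀ v, κ v) → ℂ) :=
  LinearMap.range (extendOp A (reducedDensity ρ A)).mulVecLin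

/-- `Δ̂(B, C, D) = K_BC + K_CD - K_B - K_D`. -/
def hatDelta (ρ : Matrix (∀ v, κ v) (∀ v, κ v) ℂ) (B C D : Finset V) :
    Matrix (∀ v, κ v) (∀ v, κ v) ℂ :=
  entHam ρ (B ∪ C) + entHam ρ (C ∪ D) - entHam ρ B - entHam ρ D

/-- `γ̂_f = K_ab + K_bc + K_ac - K_abc - K_a - K_b - K_c` for a triangle `f = abc`. -/
def hatGamma (ρ : Matrix (∀ v, κ v) (∀ v, κ v) ℂ) (f : Finset V) :
    Matrix (∀ v, κ v) (∀ v, κ v) ℂ :=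
  (∑ e ∈ f.powersetCard 2, entHam ρ e) - entHam ρ f - ∑ v ∈ f, entHam ρ {v}

variable (T : TriangulatedSurface V)

/-- The condition A1 in the bulk, for discs that consist of one interior vertex `v` and its link:
`S_BC + S_CD - S_B - S_D = 0` for `C = {v}` and every partition of the link of `v` into two
arcs `B` and `D`. -/
def BulkA1 (ρ : Matrix (∀ v, κ v) (∀ v, κ v) ℂ) : Prop :=
  ∀ v ∈ T.interiorVerts, ∀ B ∈ T.arcs v,
    entropy ρ (B ∪ {v}) + entropy ρ ({v} ∪ (T.nbrs v \ B))
      - entropy ρ B - entropy ρ (T.nbrs v \ B) = 0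

/-- The average of `γ̂_f` over the triangles `f` at `v`. -/
def avgGamma (ρ : Matrix (∀ v, κ v) (∀ v, κ v) ℂ) (v : V) :
    Matrix (∀ v, κ v) (∀ v, κ v) ℂ :=
  (1 / (T.deg v : ℂ)) • ∑ f ∈ T.faces.filter (fun f => v ∈ f), hatGamma ρ f

/-- The partitions `B ∪ D` of the link of an interior vertex with `|B| ≤ |D|`. For each partition
`m + n` of the integer `deg v` with `1 ≤ m ≤ n` there are `deg v` of them, one for each
orientation; for `m = n` both `(B, D)` and `(D, B)` occur. -/
def bulkArcs (v : V) : Finset (Finset V) :=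
  (T.arcs v).filter fun B => 2 * B.card ≤ T.deg v

/-- The average of `Δ̂(B, v, D)` over all partitions and orientations, for an interior vertex. -/
def avgDelta (ρ : Matrix (∀ v, κ v) (∀ v, κ v) ℂ) (v : V) :
    Matrix (∀ v, κ v) (∀ v, κ v) ℂ :=
  (1 / ((bulkArcs T v).card : ℂ)) • ∑ B ∈ bulkArcs T v, hatDelta ρ B {v} (T.nbrs v \ B)

/-- The average of `Δ̂(B, v, D)` over all partitions of the link of a boundary vertex `v`, which is
a path, into two arcs. (The sum runs over ordered pairs, so it contains each of the partitions
twice, and `Δ̂` is symmetric: for a link with four vertices this is the average of three terms.) -/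
def avgDeltaBoundary (ρ : Matrix (∀ v, κ v) (∀ v, κ v) ℂ) (v : V) :
    Matrix (∀ v, κ v) (∀ v, κ v) ℂ :=
  (1 / ((T.arcs v).card : ℂ)) • ∑ B ∈ T.arcs v, hatDelta ρ B {v} (T.nbrs v \ B)

/-- `H_rec^Δ`. -/
def HrecDelta (ρ : Matrix (∀ v, κ v) (∀ v, κ v) ℂ) : Matrix (∀ v, κ v) (∀ v, κ v) ℂ :=
  (∑ v ∈ T.interiorVerts, (1 / 2 : ℂ) • avgDelta T ρ v)
    + ∑ v ∈ T.boundaryVerts, (1 / 2 : ℂ) • avgDeltaBoundary T ρ v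

/-- `H_rec^Euler`: the sum of `K_f` over all triangles, minus the sum of `K_e` over the edges that
are not boundary edges, plus the sum of `K_v` over the vertices that are not boundary vertices. -/
def HrecEuler (ρ : Matrix (∀ v, κ v) (∀ v, κ v) ℂ) : Matrix (∀ v, κ v) (∀ v, κ v) ℂ :=
  (∑ f ∈ T.faces, entHam ρ f) - (∑ e ∈ T.edges \ T.boundaryEdges, entHam ρ e)
    + ∑ v ∈ T.interiorVerts, entHam ρ {v}

/-- The regions `A` for which `K_A` occurs in `H_rec^Δ`, in the averages of `γ̂` or in
`H_rec^Euler`: triangles, edges, vertices, arcs of links, and arcs of links with their centre. -/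
def occurringRegions : Set (Finset V) :=
  {A | A ∈ T.faces ∨ A ∈ T.edges ∨ (∃ v, A = {v}) ∨
    ∃ v, ∃ B ∈ T.arcs v, A = B ∨ A = B ∪ {v}}

/-- The vectors that are orthogonal to the kernels of all the reduced density matrices involved,
that is, on which all the entanglement Hamiltonians involved are finite. -/
def commonSupport (ρ : Matrix (∀ v, κ v) (∀ v, κ v) ℂ) : Submodule ℂ ((∀ v, κ v) → ℂ) :=
  ⨅ A ∈ occurringRegions T, regionSupport ρ A

end States

end

/-! Let A be a region disjoint from BCD. Strong subadditivity S(B)+S(ABC) ≤ S(AB)+S(BC) and weak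
monotonicity S(D)+S(AB) ≤ S(CD)+S(ABC) add up to S(B)+S(D) ≤ S(BC)+S(CD). Condition A1 is equality
here, so both inequalities are tight. Equality in strong subadditivity gives K_ABC = K_AB + K_BC -
K_B on the support of ρ_ABC (`entHam_markov`). The inequality and its equality case come from
monotonicity of relative entropy (`relativeEntropy_restrict`), proved by comparing resolvents of two
relative modular operators (`log_transfer`); weak monotonicity is strong subadditivity for a
purification.

The rest is combinatorics of the numbers k(A) = (K_A ψ)(x), for ψ in W and a coordinate x. If an
interior vertex b is an end of an arc in the link of v, A1 at b splits b off from the arc and from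
the cone over it with apex v. `NoEmptyTriangle` keeps the rest of the arc away from the link of b,
and `LatticeBoundary` makes one of the two ends interior. Hence K of an arc is the sum over its
edges minus the sum over its inner vertices (`EndSplitting.apply_cyclicInterval`).

Let d be the degree of an interior v, and F, L, E, X the sums of k over the triangles at v, the link
edges, the edges at v and the neighbours of v. The sum of Δ̂ over rotations is (d-2)(F-L) -
(d-4)(E-X), whatever the sizes of the arcs. Subtracting (6-d)/6 times the average of γ̂ makes the
coefficients independent of d: what remains is (F-L)/3 - (E-X)/6 + (6-d)/6 k(v). A boundary vertex
gives the same expression without the last term, with the sign of E-X reversed at boundary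
neighbours. Summation over all vertices counts triangles once, inner edges -1 times, boundary edges
not at all, interior vertices d/6 + (6-d)/6 = 1 times, and boundary vertices not at all
(`sum_localTerm`). -/

set_option linter.unusedSectionVars false

/-! ### Comparison of logarithms through resolvents. -/

section LogTransfer
open Filter Topology
variable {I J : Type*} [Fintype I] [Fintype J]

theorem tendsto_log_add_sub_log (a : ℝ) :
    Tendsto (fun t : ℝ => Real.log (a + t) - Real.log t) atTop (𝓝 0) := by
  have h1 : Tendsto (fun t : ℝ => a / t + 1) atTop (𝓝 (0 + 1)) :=
    (tendsto_const_nhds.div_atTop tendsto_id).add_const 1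
  have h2 := (Real.continuousAt_log (by norm_num : (0 + 1 : ℝ) ≠ 0)).tendsto.comp h1
  simp only [zero_add, Real.log_one] at h2
  refine h2.congr' ?_
  filter_upwards [eventually_gt_atTop 0, eventually_gt_atTop (-a)] with t ht hta
  have : (a / t + 1) = (a + t) / t := by field_simp
  simp only [Function.comp]
  rw [this, Real.log_div (by linarith) ht.ne']

/-- Regard a and b as diagonal operators and put u = (b+t)⁻¹y. Expanding the square, the cross term
is 2⟨x, Vu⟩ = 2⟨y, u⟩ by `hV`, and ⟨Vu, (a+t)Vu⟩ ≤ ⟨u, (b+t)u⟩ = ⟨y, u⟩ by `hform` and `hcontr`. The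
square is kept as a lower bound because its vanishing yields the equality case. -/
theorem resolvent_gap {a : I → ℝ} {b : J → ℝ} (ha : ∀ i, 0 ≤ a i) (hb : ∀ j, 0 ≤ b j)
    {x : I → ℂ} {y : J → ℂ} (V : (J → ℂ) →ₗ[ℂ] (I → ℂ))
    (hV : ∀ u, star x ⬝ᵥ V u = star y ⬝ᵥ u)
    (hcontr : ∀ u, ∑ i, ‖V u i‖ ^ 2 ≤ ∑ j, ‖u j‖ ^ 2)
    (hform : ∀ u, ∑ i, a i * ‖V u i‖ ^ 2 ≤ ∑ j, b j * ‖u j‖ ^ 2) {t : ℝ} (ht : 0 < t) :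
    ∑ i, (a i + t) * ‖x i / (a i + t : ℝ) - V (fun j => y j / (b j + t : ℝ)) i‖ ^ 2 ≤
      ∑ i, ‖x i‖ ^ 2 / (a i + t) - ∑ j, ‖y j‖ ^ 2 / (b j + t) := by
  set u : J → ℂ := fun j => y j / (b j + t : ℝ) with hu
  have hat : ∀ i, 0 < a i + t := fun i => by linarith [ha i]
  have hbt : ∀ j, 0 < b j + t := fun j => by linarith [hb j]
  have e1 : ∀ i, (a i + t) * ‖x i / (a i + t : ℝ) - V u i‖ ^ 2 =
      ‖x i‖ ^ 2 / (a i + t) - 2 * (star (x i) * V u i).re + (a i + t) * ‖V u i‖ ^ 2 := by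
    intro i
    have h := (hat i).ne'
    simp only [← Complex.normSq_eq_norm_sq, Complex.normSq_apply, Complex.sub_re, Complex.sub_im,
      Complex.div_ofReal_re, Complex.div_ofReal_im, Complex.mul_re, Complex.star_def,
      Complex.conj_re, Complex.conj_im]
    field_simp
    ring
  have e2 : ∑ i, (star (x i) * V u i).re = ∑ j, ‖y j‖ ^ 2 / (b j + t) := by
    have := congrArg Complex.re (hV u)
    simp only [dotProduct, Complex.re_sum, Pi.star_apply] at this
    rw [this]
    refine Finset.sum_congr rfl fun j _ => ?_
    simp only [hu, ← Complex.normSq_eq_norm_sq, Complex.normSq_apply,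
      Complex.div_ofReal_re, Complex.div_ofReal_im, Complex.mul_re, Complex.star_def,
      Complex.conj_re, Complex.conj_im]
    ring
  have e3 : ∑ i, (a i + t) * ‖V u i‖ ^ 2 ≤ ∑ j, ‖y j‖ ^ 2 / (b j + t) := by
    calc ∑ i, (a i + t) * ‖V u i‖ ^ 2 = ∑ i, a i * ‖V u i‖ ^ 2 + t * ∑ i, ‖V u i‖ ^ 2 := by
          rw [Finset.mul_sum, ← Finset.sum_add_distrib]; simp only [add_mul]
      _ ≤ ∑ j, b j * ‖u j‖ ^ 2 + t * ∑ j, ‖u j‖ ^ 2 :=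
          add_le_add (hform u) (mul_le_mul_of_nonneg_left (hcontr u) ht.le)
      _ = _ := by
          rw [Finset.mul_sum, ← Finset.sum_add_distrib]
          refine Finset.sum_congr rfl fun j _ => ?_
          have h := (hbt j).ne'
          simp only [hu, norm_div, Complex.norm_real, Real.norm_eq_abs, abs_of_pos (hbt j)]
          field_simp
  simp only [e1, Finset.sum_add_distrib, Finset.sum_sub_distrib, ← Finset.mul_sum]
  rw [e2]
  linarith

theorem hasDerivAt_log_sum (a : I → ℝ) (ha : ∀ i, 0 ≤ a i) (w : I → ℂ) {t : ℝ} (ht : 0 < t) :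
    HasDerivAt (fun t : ℝ => ∑ i, (Real.log (a i + t) : ℂ) * w i)
      (∑ i, w i / (a i + t : ℝ)) t := by
  refine HasDerivAt.fun_sum fun i _ => ?_
  have h : a i + t ≠ 0 := by linarith [ha i]
  have h1 : HasDerivAt (fun t : ℝ => Real.log (a i + t)) (1 / (a i + t)) t :=
    ((hasDerivAt_id t).const_add (a i)).log h
  have := (h1.ofReal_comp).mul_const (w i)
  refine this.congr_deriv ?_
  push_cast
  rw [one_div, div_eq_inv_mul]

/-- The value `Real.log 0 = 0` is not a limit of log t as t tends to 0; the condition on `w` removes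
the terms where this matters. -/
theorem continuousWithinAt_log_sum (a : I → ℝ) (w : I → ℂ) (hw : ∀ i, a i = 0 → w i = 0) :
    Tendsto (fun t : ℝ => ∑ i, (Real.log (a i + t) : ℂ) * w i) (𝓝[>] 0)
      (𝓝 (∑ i, (Real.log (a i) : ℂ) * w i)) := by
  refine tendsto_finsetSum _ fun i _ => ?_
  by_cases h : a i = 0
  · simp [hw i h]
  · have h1 : ContinuousAt (fun t : ℝ => Real.log (a i + t)) 0 :=
      ContinuousAt.log (by fun_prop) (by simpa using h)
    have h2 := ((Complex.continuous_ofReal.tendsto _).comp h1.tendsto).mul_const (w i)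
    simp only [add_zero] at h2
    exact h2.mono_left nhdsWithin_le_nhds

/-- The sum diverges only like log t times the total weight, and this part cancels between two sums
of equal total weight. -/
theorem tendsto_log_sum_sub (a : I → ℝ) (w : I → ℂ) :
    Tendsto (fun t : ℝ => ∑ i, (Real.log (a i + t) : ℂ) * w i - Real.log t * ∑ i, w i) atTop
      (𝓝 0) := by
  have : Tendsto (fun t : ℝ => ∑ i, ((Real.log (a i + t) - Real.log t : ℝ) : ℂ) * w i) atTop
      (𝓝 (∑ i, ((0 : ℝ) : ℂ) * w i)) :=
    tendsto_finsetSum _ fun i _ =>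
      ((Complex.continuous_ofReal.tendsto _).comp (tendsto_log_add_sub_log (a i))).mul_const _
  simp only [Complex.ofReal_zero, zero_mul, Finset.sum_const_zero] at this
  refine this.congr fun t => ?_
  rw [Finset.mul_sum, ← Finset.sum_sub_distrib]
  refine Finset.sum_congr rfl fun i _ => ?_
  push_cast; ring

/-- The function g(t) = ⟨x, log(a+t)x⟩ - ⟨y, log(b+t)y⟩ has the resolvent gap as derivative, so it
increases, and it tends to 0 at infinity; hence g ≤ 0, down to the limit at t = 0. If that limit is
0 as well, g vanishes identically, so every gap vanishes and (a+t)⁻¹x = V(b+t)⁻¹y for all t > 0.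
Integrating this vector identity in t gives the one for logarithms. -/
theorem log_transfer {a : I → ℝ} {b : J → ℝ} (ha : ∀ i, 0 ≤ a i) (hb : ∀ j, 0 ≤ b j)
    {x : I → ℂ} {y : J → ℂ} (V : (J → ℂ) →ₗ[ℂ] (I → ℂ)) (hVy : V y = x)
    (hV : ∀ u, star x ⬝ᵥ V u = star y ⬝ᵥ u)
    (hcontr : ∀ u, ∑ i, ‖V u i‖ ^ 2 ≤ ∑ j, ‖u j‖ ^ 2)
    (hform : ∀ u, ∑ i, a i * ‖V u i‖ ^ 2 ≤ ∑ j, b j * ‖u j‖ ^ 2)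
    (hx : ∀ i, a i = 0 → x i = 0) (hy : ∀ j, b j = 0 → y j = 0) :
    ∑ i, Real.log (a i) * ‖x i‖ ^ 2 ≤ ∑ j, Real.log (b j) * ‖y j‖ ^ 2 ∧
    (∑ i, Real.log (a i) * ‖x i‖ ^ 2 = ∑ j, Real.log (b j) * ‖y j‖ ^ 2 →
      ∀ i, Real.log (a i) * x i = V (fun j => Real.log (b j) * y j) i) := by
  -- The case u = y of `hV`; equal norms are what cancels the divergence log t at infinity.
  have hn : ∑ i, ‖x i‖ ^ 2 = ∑ j, ‖y j‖ ^ 2 := by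
    have h := hV y
    simp only [hVy, dotProduct, Pi.star_apply, Complex.star_def, Complex.conj_mul'] at h
    exact_mod_cast h
  set g : ℝ → ℝ := fun t => ∑ i, Real.log (a i + t) * ‖x i‖ ^ 2
    - ∑ j, Real.log (b j + t) * ‖y j‖ ^ 2 with hg
  set g' : ℝ → ℝ := fun t => ∑ i, ‖x i‖ ^ 2 / (a i + t) - ∑ j, ‖y j‖ ^ 2 / (b j + t) with hg'
  have hgc : ∀ t, ((g t : ℝ) : ℂ) = ∑ i, (Real.log (a i + t) : ℂ) * ((‖x i‖ ^ 2 : ℝ) : ℂ)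
    - ∑ j, (Real.log (b j + t) : ℂ) * ((‖y j‖ ^ 2 : ℝ) : ℂ) := fun t => by
      simp only [hg]; push_cast; rfl
  have hderiv : ∀ t, 0 < t → HasDerivAt g (g' t) t := by
    intro t ht
    have h1 := (hasDerivAt_log_sum a ha (fun i => ((‖x i‖ ^ 2 : ℝ) : ℂ)) ht).sub
      (hasDerivAt_log_sum b hb (fun j => ((‖y j‖ ^ 2 : ℝ) : ℂ)) ht)
    have h2 := (Complex.reCLM.hasFDerivAt.comp_hasDerivAt t h1)
    have h3 : HasDerivAt g _ t := h2.congr_of_eventuallyEq (Eventually.of_forall fun s => by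
      simp only [Function.comp, Complex.reCLM_apply, Pi.sub_apply, ← hgc, Complex.ofReal_re])
    refine h3.congr_deriv ?_
    · simp only [Complex.reCLM_apply, Complex.sub_re, Complex.re_sum, hg', ← Complex.ofReal_div,
        Complex.ofReal_re]
  have hg'nn : ∀ t, 0 < t → 0 ≤ g' t := fun t ht =>
    le_trans (Finset.sum_nonneg fun i _ => mul_nonneg (by linarith [ha i]) (sq_nonneg _))
      (resolvent_gap ha hb V hV hcontr hform ht)
  have hlim : Tendsto g atTop (𝓝 0) := by
    have h1 := (tendsto_log_sum_sub a (fun i => ((‖x i‖ ^ 2 : ℝ) : ℂ))).sub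
      (tendsto_log_sum_sub b (fun j => ((‖y j‖ ^ 2 : ℝ) : ℂ)))
    have h2 := (Complex.continuous_re.tendsto _).comp h1
    simp only [sub_zero, Complex.zero_re] at h2
    refine h2.congr fun t => ?_
    have hn' : ∑ i, ((‖x i‖ ^ 2 : ℝ) : ℂ) = ∑ j, ((‖y j‖ ^ 2 : ℝ) : ℂ) := by exact_mod_cast hn
    simp only [Function.comp]
    rw [hn', sub_sub_sub_cancel_right, ← hgc, Complex.ofReal_re]
  have hzero : Tendsto g (𝓝[>] 0) (𝓝 (∑ i, Real.log (a i) * ‖x i‖ ^ 2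
      - ∑ j, Real.log (b j) * ‖y j‖ ^ 2)) := by
    have h1 := (continuousWithinAt_log_sum a (fun i => ((‖x i‖ ^ 2 : ℝ) : ℂ))
      (fun i hi => by simp [hx i hi])).sub
      (continuousWithinAt_log_sum b (fun j => ((‖y j‖ ^ 2 : ℝ) : ℂ))
      (fun i hi => by simp [hy i hi]))
    have h2 := (Complex.continuous_re.tendsto _).comp h1
    convert h2 using 1
    · funext t
      simp only [Function.comp, ← hgc, Complex.ofReal_re]
    · congr 1
      simp only [Complex.sub_re, Complex.re_sum, ← Complex.ofReal_mul, Complex.ofReal_re]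
  have hmono : MonotoneOn g (Set.Ioi 0) := by
    refine monotoneOn_of_deriv_nonneg (convex_Ioi 0)
      (fun t ht => (hderiv t ht).continuousAt.continuousWithinAt) ?_ ?_
    · rw [interior_Ioi]
      exact fun t ht => (hderiv t ht).differentiableAt.differentiableWithinAt
    · rw [interior_Ioi]
      exact fun t ht => by rw [(hderiv t ht).deriv]; exact hg'nn t ht
  have hle : ∀ t, 0 < t → g t ≤ 0 := by
    intro t ht
    refine ge_of_tendsto hlim ?_
    filter_upwards [eventually_ge_atTop t] with s hs
    exact hmono ht (lt_of_lt_of_le ht hs) hs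
  refine ⟨?_, fun heq => ?_⟩
  · refine sub_nonpos.1 (le_of_tendsto hzero ?_)
    filter_upwards [self_mem_nhdsWithin] with t ht using hle t ht
  · rw [heq, sub_self] at hzero
    have hge : ∀ t, 0 < t → 0 ≤ g t := by
      intro t ht
      refine le_of_tendsto hzero ?_
      filter_upwards [Ioo_mem_nhdsGT ht] with s hs
      exact hmono hs.1 ht hs.2.le
    have hg0 : ∀ t, 0 < t → g' t = 0 := by
      intro t ht
      have h1 : g =ᶠ[𝓝 t] fun _ => 0 := by
        filter_upwards [Ioi_mem_nhds ht] with s hs using le_antisymm (hle s hs) (hge s hs)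
      exact (hderiv t ht).unique ((hasDerivAt_const t (0 : ℝ)).congr_of_eventuallyEq h1)
    have hres : ∀ t, 0 < t → ∀ i, x i / (a i + t : ℝ) = V (fun j => y j / (b j + t : ℝ)) i := by
      intro t ht i
      have h1 := resolvent_gap ha hb V hV hcontr hform ht
      rw [show _ - _ = (0 : ℝ) from hg0 t ht] at h1
      have h2 := (Finset.sum_eq_zero_iff_of_nonneg (fun i _ => mul_nonneg
        (by linarith [ha i] : 0 ≤ a i + t) (sq_nonneg _))).1
        (le_antisymm h1 (Finset.sum_nonneg fun i _ => mul_nonneg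
        (by linarith [ha i] : 0 ≤ a i + t) (sq_nonneg _))) i (Finset.mem_univ i)
      have h3 : a i + t ≠ 0 := by linarith [ha i]
      have h4 := (mul_eq_zero.1 h2).resolve_left h3
      exact sub_eq_zero.1 (norm_eq_zero.1 (pow_eq_zero_iff (by norm_num) |>.1 h4))
    intro i
    classical
    -- Row i of the matrix of V: the i-th coordinate of V(log(b+t)y) is then a sum of logarithms
    -- with weights y_j M_j.
    set M : J → ℂ := fun j => V (Pi.single j 1) i with hM
    have hVM : ∀ u, V u i = ∑ j, u j * M j := by
      intro u
      conv_lhs => rw [pi_eq_sum_univ' u]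
      simp [hM, Finset.sum_apply]
    set h : ℝ → ℂ := fun t => (Real.log (a i + t) : ℂ) * x i
      - ∑ j, (Real.log (b j + t) : ℂ) * (y j * M j) with hh
    have hd : ∀ t, 0 < t → HasDerivAt h 0 t := by
      intro t ht
      have h1 := (hasDerivAt_log_sum (fun _ : Unit => a i) (fun _ => ha i) (fun _ => x i) ht).sub
        (hasDerivAt_log_sum b hb (fun j => y j * M j) ht)
      simp only [Finset.univ_unique, Finset.sum_singleton] at h1
      refine HasDerivAt.congr_deriv (f := h) h1 ?_
      rw [hres t ht i, hVM, sub_eq_zero]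
      exact Finset.sum_congr rfl fun j _ => by ring
    have hl : Tendsto h atTop (𝓝 0) := by
      have h1 := (tendsto_log_sum_sub (fun _ : Unit => a i) (fun _ => x i)).sub
        (tendsto_log_sum_sub b (fun j => y j * M j))
      simp only [Finset.univ_unique, Finset.sum_singleton, sub_zero] at h1
      refine h1.congr fun t => ?_
      rw [← hVM, hVy, sub_sub_sub_cancel_right]
    have hz : Tendsto h (𝓝[>] 0) (𝓝 (Real.log (a i) * x i - V (fun j => Real.log (b j) * y j) i)) := by
      have h1 := (continuousWithinAt_log_sum (fun _ : Unit => a i) (fun _ => x i)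
        (fun _ => hx i)).sub (continuousWithinAt_log_sum b (fun j => y j * M j)
        (fun j hj => by simp [hy j hj]))
      simp only [Finset.univ_unique, Finset.sum_singleton] at h1
      rw [hVM]
      simpa only [mul_assoc] using h1
    have hconst : ∀ s t, 0 < s → 0 < t → h s = h t := by
      intro s t hs ht
      exact (convex_Ioi (0 : ℝ)).is_const_of_fderivWithin_eq_zero (𝕜 := ℝ) (f := h)
        (fun r hr => (hd r hr).differentiableAt.differentiableWithinAt)
        (fun r hr => by
          rw [fderivWithin_of_isOpen isOpen_Ioi hr]
          have := (hd r hr).hasFDerivAt.fderiv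
          rw [this]; ext; simp) hs ht
    have h1 : h 1 = 0 := by
      refine tendsto_nhds_unique (tendsto_const_nhds.congr' ?_) hl
      filter_upwards [eventually_gt_atTop 0] with t ht using hconst 1 t one_pos ht
    refine sub_eq_zero.1 (tendsto_nhds_unique hz (tendsto_const_nhds.congr' ?_))
    filter_upwards [self_mem_nhdsWithin] with t ht
    rw [← h1]
    exact hconst 1 t one_pos ht

end LogTransfer

/-! ### Functional calculus of matrices and support projections. -/

section FunctionalCalculus
variable {n : Type*} [Fintype n] [DecidableEq n] {A : Matrix n n ℂ}

/-- The spectrum of a matrix is finite, so discontinuous functions such as `Real.log` and the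
inverse are admissible. -/
theorem continuousOn_spectrum (A : Matrix n n ℂ) (f : ℝ → ℝ) : ContinuousOn f (spectrum ℝ A) :=
  Matrix.finite_real_spectrum.continuousOn f

theorem cfc_mul_cfc (A : Matrix n n ℂ) (f g : ℝ → ℝ) :
    cfc f A * cfc g A = cfc (fun x => f x * g x) A :=
  (cfc_mul f g A (continuousOn_spectrum A f) (continuousOn_spectrum A g)).symm

theorem cfc_conjTranspose (A : Matrix n n ℂ) (f : ℝ → ℝ) : (cfc f A)ᴴ = cfc f A :=
  cfc_predicate f A

theorem Matrix.PosSemidef.spectrum_nonneg' (hA : A.PosSemidef) {x : ℝ} (hx : x ∈ spectrum ℝ A) :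
    0 ≤ x := by
  rw [hA.isHermitian.spectrum_real_eq_range_eigenvalues] at hx
  obtain ⟨i, rfl⟩ := hx
  exact hA.eigenvalues_nonneg i

theorem Matrix.PosSemidef.cfc_congr_nonneg (hA : A.PosSemidef) {f g : ℝ → ℝ}
    (h : ∀ x, 0 ≤ x → f x = g x) : cfc f A = cfc g A :=
  cfc_congr fun _ hx => h _ (hA.spectrum_nonneg' hx)

theorem Matrix.PosSemidef.cfc_id (hA : A.PosSemidef) : cfc (fun x : ℝ => x) A = A :=
  cfc_id' ℝ A hA.isHermitian

theorem Matrix.PosSemidef.sqrt_mul_sqrt (hA : A.PosSemidef) :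
    cfc Real.sqrt A * cfc Real.sqrt A = A := by
  rw [cfc_mul_cfc, hA.cfc_congr_nonneg (g := fun x => x) fun x hx => Real.mul_self_sqrt hx,
    hA.cfc_id]

/-- The projection onto the support of a Hermitian matrix. -/
noncomputable def supportProj (A : Matrix n n ℂ) : Matrix n n ℂ := cfc (fun x : ℝ => x * x⁻¹) A

theorem supportProj_mul_self (A : Matrix n n ℂ) : supportProj A * supportProj A = supportProj A := by
  rw [supportProj, cfc_mul_cfc]
  congr 1; funext x
  by_cases h : x = 0 <;> simp [h]

theorem supportProj_conjTranspose (A : Matrix n n ℂ) : (supportProj A)ᴴ = supportProj A :=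
  cfc_conjTranspose _ _

theorem Matrix.PosSemidef.supportProj_eq (hA : A.PosSemidef) :
    supportProj A = A * cfc (fun x : ℝ => x⁻¹) A := by
  nth_rw 2 [← hA.cfc_id]
  rw [cfc_mul_cfc, supportProj]

theorem cfc_mul_supportProj (A : Matrix n n ℂ) {f : ℝ → ℝ} (hf : f 0 = 0) :
    cfc f A * supportProj A = cfc f A := by
  rw [supportProj, cfc_mul_cfc]
  congr 1; funext x
  by_cases h : x = 0 <;> simp [h, hf]

theorem Matrix.PosSemidef.mul_supportProj (hA : A.PosSemidef) : A * supportProj A = A := by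
  conv_rhs => rw [← hA.cfc_id]
  nth_rw 1 [← hA.cfc_id]
  exact cfc_mul_supportProj A (f := fun x => x) rfl

/-- A projection that has zero expectation in `A` annihilates the square root of `A`. -/
theorem Matrix.PosSemidef.mul_sqrt_eq_zero (hA : A.PosSemidef) {e : Matrix n n ℂ} (he : eᴴ = e)
    (hee : e * e = e) (h : (A * e).trace = 0) : e * cfc Real.sqrt A = 0 := by
  rw [← Matrix.trace_conjTranspose_mul_self_eq_zero_iff, Matrix.conjTranspose_mul, he,
    cfc_conjTranspose]
  calc (cfc Real.sqrt A * e * (e * cfc Real.sqrt A)).trace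
      = (cfc Real.sqrt A * (e * e) * cfc Real.sqrt A).trace := by simp only [Matrix.mul_assoc]
    _ = (cfc Real.sqrt A * cfc Real.sqrt A * (e * e)).trace := by
        rw [Matrix.trace_mul_comm, ← Matrix.mul_assoc]
    _ = 0 := by rw [hee, hA.sqrt_mul_sqrt, h]

end FunctionalCalculus

/-! ### Coordinates that diagonalise X ↦ f(A) X g(B). -/

section EigenCoordinates
variable {n : Type*} [Fintype n] [DecidableEq n] {A B : Matrix n n ℂ}

/-- The coordinates of `X` with respect to eigenbases of `A` and `B`. -/
noncomputable def eigenCoord (hA : A.IsHermitian) (hB : B.IsHermitian) (X : Matrix n n ℂ) :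
    n × n → ℂ := fun p =>
  (star (hA.eigenvectorUnitary : Matrix n n ℂ) * X * (hB.eigenvectorUnitary : Matrix n n ℂ)) p.1 p.2

/-- The matrix with given coordinates with respect to eigenbases of `A` and `B`. -/
noncomputable def ofEigenCoord (hA : A.IsHermitian) (hB : B.IsHermitian) (u : n × n → ℂ) :
    Matrix n n ℂ :=
  (hA.eigenvectorUnitary : Matrix n n ℂ) * Matrix.of (fun i j => u (i, j)) *
    star (hB.eigenvectorUnitary : Matrix n n ℂ)

variable (hA : A.IsHermitian) (hB : B.IsHermitian)

theorem eigenCoord_ofEigenCoord (u : n × n → ℂ) : eigenCoord hA hB (ofEigenCoord hA hB u) = u := by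
  funext p
  have h1 : star (hA.eigenvectorUnitary : Matrix n n ℂ) * (hA.eigenvectorUnitary : Matrix n n ℂ) = 1 :=
    Unitary.coe_star_mul_self _
  have h2 : star (hB.eigenvectorUnitary : Matrix n n ℂ) * (hB.eigenvectorUnitary : Matrix n n ℂ) = 1 :=
    Unitary.coe_star_mul_self _
  simp only [eigenCoord, ofEigenCoord, Matrix.mul_assoc]
  rw [h2, Matrix.mul_one, ← Matrix.mul_assoc, h1, Matrix.one_mul]
  rfl

theorem ofEigenCoord_eigenCoord (X : Matrix n n ℂ) : ofEigenCoord hA hB (eigenCoord hA hB X) = X := by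
  have h1 : (hA.eigenvectorUnitary : Matrix n n ℂ) * star (hA.eigenvectorUnitary : Matrix n n ℂ) = 1 :=
    Unitary.coe_mul_star_self _
  have h2 : (hB.eigenvectorUnitary : Matrix n n ℂ) * star (hB.eigenvectorUnitary : Matrix n n ℂ) = 1 :=
    Unitary.coe_mul_star_self _
  change (hA.eigenvectorUnitary : Matrix n n ℂ) * (star (hA.eigenvectorUnitary : Matrix n n ℂ) * X *
    (hB.eigenvectorUnitary : Matrix n n ℂ)) * star (hB.eigenvectorUnitary : Matrix n n ℂ) = X
  simp only [Matrix.mul_assoc]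
  rw [h2, Matrix.mul_one, ← Matrix.mul_assoc, h1, Matrix.one_mul]

theorem eigenCoord_injective : Function.Injective (eigenCoord hA hB) :=
  Function.LeftInverse.injective (g := ofEigenCoord hA hB) (ofEigenCoord_eigenCoord hA hB)

theorem eigenCoord_cfc_mul (f : ℝ → ℝ) (X : Matrix n n ℂ) (p : n × n) :
    eigenCoord hA hB (cfc f A * X) p = (f (hA.eigenvalues p.1) : ℂ) * eigenCoord hA hB X p := by
  have h1 : star (hA.eigenvectorUnitary : Matrix n n ℂ) * (hA.eigenvectorUnitary : Matrix n n ℂ) = 1 :=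
    Unitary.coe_star_mul_self _
  rw [hA.cfc_eq, Matrix.IsHermitian.cfc, Unitary.conjStarAlgAut_apply]
  simp only [eigenCoord, Matrix.mul_assoc]
  rw [← Matrix.mul_assoc (star _) (hA.eigenvectorUnitary : Matrix n n ℂ), h1, Matrix.one_mul,
    Matrix.diagonal_mul]
  rfl

theorem eigenCoord_mul_cfc (f : ℝ → ℝ) (X : Matrix n n ℂ) (p : n × n) :
    eigenCoord hA hB (X * cfc f B) p = (f (hB.eigenvalues p.2) : ℂ) * eigenCoord hA hB X p := by
  have h1 : star (hB.eigenvectorUnitary : Matrix n n ℂ) * (hB.eigenvectorUnitary : Matrix n n ℂ) = 1 :=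
    Unitary.coe_star_mul_self _
  rw [hB.cfc_eq, Matrix.IsHermitian.cfc, Unitary.conjStarAlgAut_apply]
  simp only [eigenCoord, Matrix.mul_assoc]
  rw [h1, Matrix.mul_one]
  simp only [← Matrix.mul_assoc]
  rw [Matrix.mul_diagonal, mul_comm]
  rfl

theorem star_eigenCoord_dotProduct (X Y : Matrix n n ℂ) :
    star (eigenCoord hA hB X) ⬝ᵥ eigenCoord hA hB Y = (Xᴴ * Y).trace := by
  have h1 : (hA.eigenvectorUnitary : Matrix n n ℂ) * star (hA.eigenvectorUnitary : Matrix n n ℂ) = 1 :=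
    Unitary.coe_mul_star_self _
  have h2 : (hB.eigenvectorUnitary : Matrix n n ℂ) * star (hB.eigenvectorUnitary : Matrix n n ℂ) = 1 :=
    Unitary.coe_mul_star_self _
  have key : ∀ M N : Matrix n n ℂ, star (fun p : n × n => M p.1 p.2) ⬝ᵥ (fun p => N p.1 p.2)
      = (Mᴴ * N).trace := by
    intro M N
    simp only [dotProduct, Matrix.trace, Matrix.diag, Matrix.mul_apply, Fintype.sum_prod_type,
      Pi.star_apply, Matrix.conjTranspose_apply]
    exact Finset.sum_comm
  unfold eigenCoord
  rw [key]
  simp only [Matrix.conjTranspose_mul, Matrix.star_eq_conjTranspose, Matrix.conjTranspose_conjTranspose,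
    Matrix.mul_assoc] at *
  rw [Matrix.trace_mul_comm]
  simp only [Matrix.mul_assoc]
  rw [h2, Matrix.mul_one, ← Matrix.mul_assoc (hA.eigenvectorUnitary : Matrix n n ℂ), h1,
    Matrix.one_mul]

/-- In these coordinates X ↦ f(A) X g(B) is diagonal with entries f(λ)g(μ). For the identity and the
inverse it is the relative modular operator. -/
theorem sum_eigenCoord_sq (f g : ℝ → ℝ) (X : Matrix n n ℂ) :
    ∑ p, f (hA.eigenvalues p.1) * g (hB.eigenvalues p.2) * ‖eigenCoord hA hB X p‖ ^ 2 =
      (Xᴴ * (cfc f A * X * cfc g B)).trace.re := by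
  rw [← star_eigenCoord_dotProduct hA hB]
  simp only [dotProduct, Complex.re_sum]
  refine Finset.sum_congr rfl fun p _ => ?_
  rw [eigenCoord_mul_cfc, eigenCoord_cfc_mul, Pi.star_apply]
  have : star (eigenCoord hA hB X p) * ((g (hB.eigenvalues p.2) : ℂ) *
      ((f (hA.eigenvalues p.1) : ℂ) * eigenCoord hA hB X p)) =
      ((f (hA.eigenvalues p.1) * g (hB.eigenvalues p.2) * ‖eigenCoord hA hB X p‖ ^ 2 : ℝ) : ℂ) := by
    push_cast
    rw [← Complex.conj_mul', Complex.star_def]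
    ring
  rw [this, Complex.ofReal_re]

end EigenCoordinates

/-! ### Monotonicity of relative entropy and its equality case. -/

section DataProcessing

theorem sum_norm_eigenCoord_sq {k : Type*} [Fintype k] [DecidableEq k] {C D : Matrix k k ℂ}
    (hC : C.IsHermitian) (hD : D.IsHermitian) (X : Matrix k k ℂ) :
    ∑ p, ‖eigenCoord hC hD X p‖ ^ 2 = (Xᴴ * X).trace.re := by
  rw [← star_eigenCoord_dotProduct hC hD X X]
  simp only [dotProduct, Pi.star_apply, Complex.star_def, Complex.conj_mul', Complex.re_sum]
  exact Finset.sum_congr rfl fun p _ => by norm_cast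

variable {m n : Type*} [Fintype m] [DecidableEq m] [Fintype n] [DecidableEq n]

theorem map_conjTranspose_alg (π : Matrix m m ℂ →⋆ₐ[ℂ] Matrix n n ℂ) (X : Matrix m m ℂ) :
    (π X)ᴴ = π Xᴴ := (map_star π X).symm

variable (π : Matrix m m ℂ →⋆ₐ[ℂ] Matrix n n ℂ) {c : ℝ} {ρ₁ σ₁ : Matrix n n ℂ}
  {ρ₂ σ₂ : Matrix m m ℂ}

theorem supportProj_trace_compl (hρ₂ : ρ₂.PosSemidef) : (ρ₂ * (1 - supportProj ρ₂)).trace = 0 := by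
  rw [Matrix.mul_sub, Matrix.mul_one, hρ₂.mul_supportProj, sub_self, Matrix.trace_zero]

theorem one_sub_supportProj_conjTranspose (A : Matrix m m ℂ) :
    (1 - supportProj A)ᴴ = 1 - supportProj A := by
  rw [Matrix.conjTranspose_sub, supportProj_conjTranspose, Matrix.conjTranspose_one]

theorem one_sub_supportProj_mul_self (A : Matrix m m ℂ) :
    (1 - supportProj A) * (1 - supportProj A) = 1 - supportProj A := by
  rw [Matrix.mul_sub, Matrix.sub_mul, Matrix.sub_mul, supportProj_mul_self]
  simp

/-- The projection π(1 - supp ρ₂) has expectation c tr(ρ₂(1 - supp ρ₂)) = 0 in ρ₁, so it annihilates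
the square root of ρ₁. -/
theorem map_supportProj_mul_sqrt (hρ₁ : ρ₁.PosSemidef) (hρ₂ : ρ₂.PosSemidef)
    (hρ : ∀ Y, (ρ₁ * π Y).trace = c * (ρ₂ * Y).trace) :
    π (supportProj ρ₂) * cfc Real.sqrt ρ₁ = cfc Real.sqrt ρ₁ := by
  have h := hρ₁.mul_sqrt_eq_zero (e := π (1 - supportProj ρ₂))
    (by rw [map_conjTranspose_alg, one_sub_supportProj_conjTranspose])
    (by rw [← map_mul, one_sub_supportProj_mul_self])
    (by rw [hρ, supportProj_trace_compl hρ₂, mul_zero])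
  rw [map_sub, map_one, Matrix.sub_mul, Matrix.one_mul, sub_eq_zero] at h
  exact h.symm

theorem map_supportProj_mul (hρ₁ : ρ₁.PosSemidef) (hρ₂ : ρ₂.PosSemidef)
    (hρ : ∀ Y, (ρ₁ * π Y).trace = c * (ρ₂ * Y).trace) : π (supportProj ρ₂) * ρ₁ = ρ₁ := by
  rw [← hρ₁.sqrt_mul_sqrt, ← Matrix.mul_assoc, map_supportProj_mul_sqrt π hρ₁ hρ₂ hρ]

/-- Absolute continuity passes to restrictions. -/
theorem supportProj_mul_sqrt_of_restrict (hc : 0 < c) (hσ₁ : σ₁.PosSemidef)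
    (hρ₂ : ρ₂.PosSemidef) (hσ₂ : σ₂.PosSemidef)
    (hρ : ∀ Y, (ρ₁ * π Y).trace = c * (ρ₂ * Y).trace)
    (hσ : ∀ Y, (σ₁ * π Y).trace = c * (σ₂ * Y).trace)
    (hsupp : supportProj σ₁ * ρ₁ = ρ₁) :
    supportProj σ₂ * cfc Real.sqrt ρ₂ = cfc Real.sqrt ρ₂ := by
  have h1 := map_supportProj_mul π hσ₁ hσ₂ hσ
  -- The support projection of σ₁ is σ₁ times its inverse on the support, and σ₁ lies under π(supp
  -- σ₂).
  have h2 : π (supportProj σ₂) * ρ₁ = ρ₁ := by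
    rw [← hsupp, ← Matrix.mul_assoc, hσ₁.supportProj_eq, ← Matrix.mul_assoc, h1]
  have h3 : (ρ₂ * (1 - supportProj σ₂)).trace = 0 := by
    have h4 := hρ (1 - supportProj σ₂)
    rw [Matrix.trace_mul_comm, map_sub, map_one, Matrix.sub_mul, Matrix.one_mul, h2, sub_self,
      Matrix.trace_zero] at h4
    exact (mul_eq_zero.1 h4.symm).resolve_left (by exact_mod_cast hc.ne')
  have h := hρ₂.mul_sqrt_eq_zero (one_sub_supportProj_conjTranspose σ₂)
    (one_sub_supportProj_mul_self σ₂) h3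
  rw [Matrix.sub_mul, Matrix.one_mul, sub_eq_zero] at h
  exact h.symm

/-- The linear map `X ↦ s π(X ρ₂^(-1/2)) ρ₁^(1/2)`. -/
noncomputable def petzMap (s : ℂ) (ρ₁ : Matrix n n ℂ) (ρ₂ : Matrix m m ℂ) (X : Matrix m m ℂ) :
    Matrix n n ℂ :=
  s • (π (X * cfc (fun x : ℝ => (Real.sqrt x)⁻¹) ρ₂) * cfc Real.sqrt ρ₁)

theorem cfc_invSqrt_mul_sqrt (A : Matrix m m ℂ) (hA : A.PosSemidef) :
    cfc Real.sqrt A * cfc (fun x : ℝ => (Real.sqrt x)⁻¹) A = supportProj A := by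
  rw [cfc_mul_cfc, supportProj]
  refine hA.cfc_congr_nonneg fun x hx => ?_
  rcases hx.eq_or_lt with rfl | hx
  · simp
  · rw [mul_inv_cancel₀ hx.ne', mul_inv_cancel₀ (Real.sqrt_pos.2 hx).ne']

theorem cfc_invSqrt_mul (A : Matrix m m ℂ) (hA : A.PosSemidef) :
    cfc (fun x : ℝ => (Real.sqrt x)⁻¹) A * A = cfc Real.sqrt A := by
  nth_rw 2 [← hA.cfc_id]
  rw [cfc_mul_cfc]
  congr 1
  funext x
  rw [inv_mul_eq_div, Real.div_sqrt]

theorem cfc_invSqrt_mul_invSqrt (A : Matrix m m ℂ) (hA : A.PosSemidef) :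
    cfc (fun x : ℝ => (Real.sqrt x)⁻¹) A * cfc (fun x : ℝ => (Real.sqrt x)⁻¹) A
      = cfc (fun x : ℝ => x⁻¹) A := by
  rw [cfc_mul_cfc]
  refine hA.cfc_congr_nonneg fun x hx => ?_
  rw [← mul_inv, Real.mul_self_sqrt hx]

theorem petzMap_sqrt (s : ℂ) (hρ₁ : ρ₁.PosSemidef) (hρ₂ : ρ₂.PosSemidef)
    (hρ : ∀ Y, (ρ₁ * π Y).trace = c * (ρ₂ * Y).trace) :
    petzMap π s ρ₁ ρ₂ (cfc Real.sqrt ρ₂) = s • cfc Real.sqrt ρ₁ := by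
  rw [petzMap, cfc_invSqrt_mul_sqrt _ hρ₂, map_supportProj_mul_sqrt π hρ₁ hρ₂ hρ]

/-- The adjoint of the map sends s ρ₁^(1/2) to ρ₂^(1/2). The condition s²c = 1 absorbs the constant
c, which appears because states extended by the identity are not normalised. -/
theorem trace_sqrt_mul_petzMap {s : ℝ} (hs : s * s * c = 1) (hρ₁ : ρ₁.PosSemidef)
    (hρ₂ : ρ₂.PosSemidef) (hρ : ∀ Y, (ρ₁ * π Y).trace = c * (ρ₂ * Y).trace) (X : Matrix m m ℂ) :
    (((s : ℂ) • cfc Real.sqrt ρ₁)ᴴ * petzMap π s ρ₁ ρ₂ X).trace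
      = ((cfc Real.sqrt ρ₂)ᴴ * X).trace := by
  rw [petzMap, Matrix.conjTranspose_smul, cfc_conjTranspose, cfc_conjTranspose, Matrix.smul_mul,
    Matrix.mul_smul, Matrix.trace_smul, Matrix.trace_smul, ← Matrix.mul_assoc, Matrix.trace_mul_comm,
    ← Matrix.mul_assoc, hρ₁.sqrt_mul_sqrt, hρ, ← Matrix.mul_assoc, Matrix.trace_mul_comm,
    ← Matrix.mul_assoc, cfc_invSqrt_mul _ hρ₂]
  have : ((s : ℂ) * s * c) = 1 := by exact_mod_cast hs
  simp only [smul_eq_mul, Complex.star_def, Complex.conj_ofReal, ← mul_assoc, this, one_mul]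

/-- Cyclicity of the trace encloses T between the two square roots of ρ₁. The choice S = T = 1
serves for the contraction property, and S = σ₁, T = ρ₁⁻¹ for the bound on the modular form. -/
theorem petzMap_gram {s : ℝ} (X : Matrix m m ℂ) (S T : Matrix n n ℂ) :
    ((petzMap π s ρ₁ ρ₂ X)ᴴ * (S * petzMap π s ρ₁ ρ₂ X * T)).trace = (s : ℂ) * s *
      ((π (X * cfc (fun x : ℝ => (Real.sqrt x)⁻¹) ρ₂))ᴴ * S *
        π (X * cfc (fun x : ℝ => (Real.sqrt x)⁻¹) ρ₂) *
        (cfc Real.sqrt ρ₁ * T * cfc Real.sqrt ρ₁)).trace := by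
  rw [petzMap, Matrix.conjTranspose_smul, Matrix.conjTranspose_mul, cfc_conjTranspose]
  simp only [Matrix.smul_mul, Matrix.mul_smul, Matrix.trace_smul]
  rw [Matrix.mul_assoc, Matrix.trace_mul_comm]
  simp only [smul_eq_mul, Complex.star_def, Complex.conj_ofReal, mul_assoc]

theorem trace_mul_supportProj_le (T A : Matrix n n ℂ) (hA : A.IsHermitian) :
    (Tᴴ * T * supportProj A).trace.re ≤ (Tᴴ * T).trace.re := by
  have h1 := sum_eigenCoord_sq hA hA (fun _ => 1) (fun x => x * x⁻¹) T
  have h2 := sum_eigenCoord_sq hA hA (fun _ => 1) (fun _ => 1) T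
  have h3 : cfc (fun _ : ℝ => (1 : ℝ)) A = 1 := cfc_const_one ℝ A hA
  rw [h3] at h1 h2
  rw [Matrix.one_mul, ← Matrix.mul_assoc] at h1
  rw [Matrix.one_mul, Matrix.mul_one] at h2
  rw [supportProj, ← h1, ← h2]
  refine Finset.sum_le_sum fun p _ => mul_le_mul_of_nonneg_right ?_ (sq_nonneg _)
  rw [one_mul, one_mul]
  exact mul_inv_le_one

/-- The left-hand side equals tr(XᴴX supp ρ₂), so only a support projection is lost. -/
theorem petzMap_contraction {s : ℝ} (hs : s * s * c = 1) (hρ₁ : ρ₁.PosSemidef)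
    (hρ₂ : ρ₂.PosSemidef) (hρ : ∀ Y, (ρ₁ * π Y).trace = c * (ρ₂ * Y).trace) (X : Matrix m m ℂ) :
    ((petzMap π s ρ₁ ρ₂ X)ᴴ * petzMap π s ρ₁ ρ₂ X).trace.re ≤ (Xᴴ * X).trace.re := by
  have hgram := petzMap_gram π (ρ₁ := ρ₁) (ρ₂ := ρ₂) (s := s) X 1 1
  rw [Matrix.one_mul, Matrix.mul_one, Matrix.mul_one, Matrix.mul_one, hρ₁.sqrt_mul_sqrt,
    map_conjTranspose_alg, ← map_mul, Matrix.trace_mul_comm (π _), hρ, ← mul_assoc,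
    show (s : ℂ) * s * c = 1 by exact_mod_cast hs, one_mul, Matrix.conjTranspose_mul,
    cfc_conjTranspose] at hgram
  set R := cfc (fun x : ℝ => (Real.sqrt x)⁻¹) ρ₂ with hR
  have h1 : (ρ₂ * (R * Xᴴ * (X * R))).trace = (Xᴴ * X * (R * ρ₂ * R)).trace := by
    rw [show ρ₂ * (R * Xᴴ * (X * R)) = (ρ₂ * R) * (Xᴴ * X * R) by simp only [Matrix.mul_assoc],
      Matrix.trace_mul_comm]
    simp only [Matrix.mul_assoc]
  rw [hgram, h1, hR, cfc_invSqrt_mul _ hρ₂, cfc_invSqrt_mul_sqrt _ hρ₂]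
  exact trace_mul_supportProj_le _ _ hρ₂.isHermitian

/-- Only the projection ρ₁^(1/2) ρ₁⁻¹ ρ₁^(1/2) = supp ρ₁ is lost; without it the trace against σ₁
restricts exactly to the trace against σ₂. -/
theorem petzMap_form {s : ℝ} (hs : s * s * c = 1) (hρ₁ : ρ₁.PosSemidef) (hσ₁ : σ₁.PosSemidef)
    (hρ₂ : ρ₂.PosSemidef) (hσ : ∀ Y, (σ₁ * π Y).trace = c * (σ₂ * Y).trace) (X : Matrix m m ℂ) :
    ((petzMap π s ρ₁ ρ₂ X)ᴴ * (σ₁ * petzMap π s ρ₁ ρ₂ X * cfc (fun x : ℝ => x⁻¹) ρ₁)).trace.re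
      ≤ (Xᴴ * (σ₂ * X * cfc (fun x : ℝ => x⁻¹) ρ₂)).trace.re := by
  rw [petzMap_gram]
  have h1 : cfc Real.sqrt ρ₁ * cfc (fun x : ℝ => x⁻¹) ρ₁ * cfc Real.sqrt ρ₁ = supportProj ρ₁ := by
    rw [cfc_mul_cfc, cfc_mul_cfc, supportProj]
    refine hρ₁.cfc_congr_nonneg fun x hx => ?_
    rw [mul_right_comm, Real.mul_self_sqrt hx]
  set R := cfc (fun x : ℝ => (Real.sqrt x)⁻¹) ρ₂ with hR
  set T := cfc Real.sqrt σ₁ * π (X * R) with hT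
  have h2 : (π (X * R))ᴴ * σ₁ * π (X * R) = Tᴴ * T := by
    rw [hT, Matrix.conjTranspose_mul, cfc_conjTranspose]
    nth_rw 1 [← hσ₁.sqrt_mul_sqrt]
    simp only [Matrix.mul_assoc]
  have h3 : (s : ℂ) * s * (Tᴴ * T).trace = (Xᴴ * (σ₂ * X * cfc (fun x : ℝ => x⁻¹) ρ₂)).trace := by
    rw [← h2, Matrix.mul_assoc, Matrix.trace_mul_comm, map_conjTranspose_alg, Matrix.mul_assoc,
      ← map_mul, hσ, ← mul_assoc, show (s : ℂ) * s * c = 1 by exact_mod_cast hs, one_mul,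
      Matrix.conjTranspose_mul, cfc_conjTranspose, ← cfc_invSqrt_mul_invSqrt _ hρ₂, ← hR,
      Matrix.trace_mul_comm Xᴴ]
    simp only [Matrix.mul_assoc]
  have h4 := trace_mul_supportProj_le T ρ₁ hρ₁.isHermitian
  rw [h1, h2, ← h3, ← Complex.ofReal_mul, Complex.re_ofReal_mul, Complex.re_ofReal_mul]
  exact mul_le_mul_of_nonneg_left h4 (mul_self_nonneg s)

set_option maxHeartbeats 1000000 in
/-- Monotonicity of the relative entropy under restriction to a subalgebra, and Petz's description
of the case of equality. -/
theorem relativeEntropy_restrict (hc : 0 < c) (hρ₁ : ρ₁.PosSemidef) (hσ₁ : σ₁.PosSemidef)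
    (hρ₂ : ρ₂.PosSemidef) (hσ₂ : σ₂.PosSemidef)
    (hρ : ∀ Y, (ρ₁ * π Y).trace = c * (ρ₂ * Y).trace)
    (hσ : ∀ Y, (σ₁ * π Y).trace = c * (σ₂ * Y).trace)
    (hsupp : supportProj σ₁ * ρ₁ = ρ₁) :
    (ρ₁ * (cfc Real.log σ₁ - cfc Real.log ρ₁)).trace.re ≤
        c * (ρ₂ * (cfc Real.log σ₂ - cfc Real.log ρ₂)).trace.re ∧
      ((ρ₁ * (cfc Real.log σ₁ - cfc Real.log ρ₁)).trace.re =
        c * (ρ₂ * (cfc Real.log σ₂ - cfc Real.log ρ₂)).trace.re →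
        (cfc Real.log σ₁ - cfc Real.log ρ₁) * ρ₁ =
          π (cfc Real.log σ₂ - cfc Real.log ρ₂) * ρ₁) := by
  set s : ℝ := (Real.sqrt c)⁻¹ with hs_def
  have hs : s * s * c = 1 := by
    rw [hs_def, ← mul_inv, Real.mul_self_sqrt hc.le, inv_mul_cancel₀ hc.ne']
  have hs0 : s ≠ 0 := fun h => by simp [h] at hs
  set Q₁ := cfc Real.sqrt ρ₁ with hQ₁
  set Q₂ := cfc Real.sqrt ρ₂ with hQ₂
  set A := hσ₁.isHermitian
  set B := hρ₁.isHermitian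
  set A' := hσ₂.isHermitian
  set B' := hρ₂.isHermitian
  -- The identity homomorphism with c = 1 transfers `hsupp` from ρ₁ to its square root.
  have hsuppQ : supportProj σ₁ * Q₁ = Q₁ := by
    have h := supportProj_mul_sqrt_of_restrict (StarAlgHom.id ℂ _) one_pos hσ₁ hρ₁ hσ₁
      (by simp) (by simp) hsupp
    exact h
  have hsuppQ₂ : supportProj σ₂ * Q₂ = Q₂ :=
    supportProj_mul_sqrt_of_restrict π hc hσ₁ hρ₂ hσ₂ hρ hσ hsupp
  have hQP₁ : Q₁ * supportProj ρ₁ = Q₁ := cfc_mul_supportProj _ Real.sqrt_zero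
  have hQP₂ : Q₂ * supportProj ρ₂ = Q₂ := cfc_mul_supportProj _ Real.sqrt_zero
  -- The eigenvalues of the relative modular operators X ↦ σ X ρ⁻¹; a zero eigenvalue of ρ
  -- contributes 0 because 0⁻¹ = 0.
  set a : n × n → ℝ := fun p => A.eigenvalues p.1 * (B.eigenvalues p.2)⁻¹ with ha
  set b : m × m → ℝ := fun p => A'.eigenvalues p.1 * (B'.eigenvalues p.2)⁻¹ with hb
  set x := eigenCoord A B ((s : ℂ) • Q₁) with hx
  set y := eigenCoord A' B' Q₂ with hy
  have ha0 : ∀ p, 0 ≤ a p := fun p =>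
    mul_nonneg (hσ₁.eigenvalues_nonneg _) (inv_nonneg.2 (hρ₁.eigenvalues_nonneg _))
  have hb0 : ∀ p, 0 ≤ b p := fun p =>
    mul_nonneg (hσ₂.eigenvalues_nonneg _) (inv_nonneg.2 (hρ₂.eigenvalues_nonneg _))
  -- Coordinates vanish wherever an eigenvalue is zero; elsewhere log a splits into a difference of
  -- two logarithms.
  have hxA : ∀ p, A.eigenvalues p.1 = 0 → x p = 0 := by
    intro p hp
    rw [hx, ← hsuppQ, ← Matrix.mul_smul, supportProj, eigenCoord_cfc_mul, hp]
    simp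
  have hxB : ∀ p, B.eigenvalues p.2 = 0 → x p = 0 := by
    intro p hp
    rw [hx, ← hQP₁, ← Matrix.smul_mul, supportProj, eigenCoord_mul_cfc, hp]
    simp
  have hyA : ∀ p, A'.eigenvalues p.1 = 0 → y p = 0 := by
    intro p hp
    rw [hy, ← hsuppQ₂, supportProj, eigenCoord_cfc_mul, hp]
    simp
  have hyB : ∀ p, B'.eigenvalues p.2 = 0 → y p = 0 := by
    intro p hp
    rw [hy, ← hQP₂, supportProj, eigenCoord_mul_cfc, hp]
    simp
  have hlogx : ∀ p, (Real.log (a p) : ℂ) * x p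
      = eigenCoord A B (cfc Real.log σ₁ * ((s : ℂ) • Q₁) - (s : ℂ) • Q₁ * cfc Real.log ρ₁) p := by
    intro p
    have h1 : ∀ X Y, eigenCoord A B (X - Y) p = eigenCoord A B X p - eigenCoord A B Y p := by
      intro X Y
      simp only [eigenCoord, Matrix.mul_sub, Matrix.sub_mul, Matrix.sub_apply]
    rw [h1, eigenCoord_cfc_mul, eigenCoord_mul_cfc, ← hx]
    by_cases hpA : A.eigenvalues p.1 = 0
    · simp [hxA p hpA]
    by_cases hpB : B.eigenvalues p.2 = 0
    · simp [hxB p hpB]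
    rw [ha, Real.log_mul hpA (inv_ne_zero hpB), Real.log_inv]
    push_cast; ring
  have hlogy : ∀ p, (Real.log (b p) : ℂ) * y p
      = eigenCoord A' B' (cfc Real.log σ₂ * Q₂ - Q₂ * cfc Real.log ρ₂) p := by
    intro p
    have h1 : ∀ X Y, eigenCoord A' B' (X - Y) p = eigenCoord A' B' X p - eigenCoord A' B' Y p := by
      intro X Y
      simp only [eigenCoord, Matrix.mul_sub, Matrix.sub_mul, Matrix.sub_apply]
    rw [h1, eigenCoord_cfc_mul, eigenCoord_mul_cfc, ← hy]
    by_cases hpA : A'.eigenvalues p.1 = 0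
    · simp [hyA p hpA]
    by_cases hpB : B'.eigenvalues p.2 = 0
    · simp [hyB p hpB]
    rw [hb, Real.log_mul hpA (inv_ne_zero hpB), Real.log_inv]
    push_cast; ring
  let V : (m × m → ℂ) →ₗ[ℂ] (n × n → ℂ) :=
    { toFun := fun u => eigenCoord A B (petzMap π s ρ₁ ρ₂ (ofEigenCoord A' B' u))
      map_add' := by
        intro u v
        have : ofEigenCoord A' B' (u + v) = ofEigenCoord A' B' u + ofEigenCoord A' B' v := by
          simp only [ofEigenCoord, ← Matrix.add_mul, ← Matrix.mul_add]
          rfl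
        funext p
        simp only [this, petzMap, Matrix.add_mul, map_add, smul_add, eigenCoord, Matrix.mul_add,
          Matrix.add_apply, Pi.add_apply]
      map_smul' := by
        intro r u
        have : ofEigenCoord A' B' (r • u) = r • ofEigenCoord A' B' u := by
          rw [ofEigenCoord, ofEigenCoord, ← Matrix.smul_mul, ← Matrix.mul_smul]
          rfl
        funext p
        simp only [this, petzMap, Matrix.smul_mul, map_smul, eigenCoord, Matrix.mul_smul,
          Matrix.smul_apply, Pi.smul_apply, RingHom.id_apply, smul_comm r] }
  have hVdef : ∀ X, V (eigenCoord A' B' X) = eigenCoord A B (petzMap π s ρ₁ ρ₂ X) := fun X => by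
    change eigenCoord A B (petzMap π s ρ₁ ρ₂ (ofEigenCoord A' B' _)) = _
    rw [ofEigenCoord_eigenCoord]
  have hsurj : ∀ u, ∃ X, u = eigenCoord A' B' X := fun u =>
    ⟨_, (eigenCoord_ofEigenCoord A' B' u).symm⟩
  have hVy : V y = x := by rw [hy, hVdef, petzMap_sqrt π s hρ₁ hρ₂ hρ]
  have hV : ∀ u, star x ⬝ᵥ V u = star y ⬝ᵥ u := by
    intro u
    obtain ⟨X, rfl⟩ := hsurj u
    rw [hVdef, hx, hy, star_eigenCoord_dotProduct, star_eigenCoord_dotProduct,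
      trace_sqrt_mul_petzMap π hs hρ₁ hρ₂ hρ]
  have hcontr : ∀ u, ∑ i, ‖V u i‖ ^ 2 ≤ ∑ j, ‖u j‖ ^ 2 := by
    intro u
    obtain ⟨X, rfl⟩ := hsurj u
    rw [hVdef, sum_norm_eigenCoord_sq, sum_norm_eigenCoord_sq]
    exact petzMap_contraction π hs hρ₁ hρ₂ hρ X
  have hform : ∀ u, ∑ i, a i * ‖V u i‖ ^ 2 ≤ ∑ j, b j * ‖u j‖ ^ 2 := by
    intro u
    obtain ⟨X, rfl⟩ := hsurj u
    rw [hVdef, ha, hb, sum_eigenCoord_sq A B (fun x => x) (fun x => x⁻¹),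
      sum_eigenCoord_sq A' B' (fun x => x) (fun x => x⁻¹), hσ₁.cfc_id, hσ₂.cfc_id]
    exact petzMap_form π hs hρ₁ hσ₁ hρ₂ hσ X
  have hsumx : ∑ p, Real.log (a p) * ‖x p‖ ^ 2
      = s * s * (ρ₁ * (cfc Real.log σ₁ - cfc Real.log ρ₁)).trace.re := by
    have h1 : ∑ p, Real.log (a p) * ‖x p‖ ^ 2 = (star x ⬝ᵥ eigenCoord A B (cfc Real.log σ₁ *
        ((s : ℂ) • Q₁) - (s : ℂ) • Q₁ * cfc Real.log ρ₁)).re := by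
      rw [dotProduct, Complex.re_sum]
      refine Finset.sum_congr rfl fun p _ => ?_
      rw [← hlogx, Pi.star_apply, mul_left_comm, Complex.star_def, Complex.conj_mul',
        Complex.re_ofReal_mul]
      norm_cast
    rw [h1, star_eigenCoord_dotProduct, Matrix.conjTranspose_smul, hQ₁, cfc_conjTranspose, ← hQ₁]
    simp only [Matrix.smul_mul, Matrix.mul_smul, ← smul_sub, Matrix.trace_smul, Complex.star_def,
      Complex.conj_ofReal, smul_eq_mul, Complex.re_ofReal_mul]
    rw [Matrix.mul_sub, Matrix.mul_sub, Matrix.trace_sub, Matrix.trace_sub, Matrix.trace_mul_comm,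
      Matrix.mul_assoc, hρ₁.sqrt_mul_sqrt, ← Matrix.mul_assoc, hρ₁.sqrt_mul_sqrt,
      Matrix.trace_mul_comm (cfc Real.log σ₁), mul_assoc]
  have hsumy : ∑ p, Real.log (b p) * ‖y p‖ ^ 2
      = (ρ₂ * (cfc Real.log σ₂ - cfc Real.log ρ₂)).trace.re := by
    have h1 : ∑ p, Real.log (b p) * ‖y p‖ ^ 2 = (star y ⬝ᵥ eigenCoord A' B' (cfc Real.log σ₂ *
        Q₂ - Q₂ * cfc Real.log ρ₂)).re := by
      rw [dotProduct, Complex.re_sum]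
      refine Finset.sum_congr rfl fun p _ => ?_
      rw [← hlogy, Pi.star_apply, mul_left_comm, Complex.star_def, Complex.conj_mul',
        Complex.re_ofReal_mul]
      norm_cast
    rw [h1, star_eigenCoord_dotProduct, hQ₂, cfc_conjTranspose, ← hQ₂]
    rw [Matrix.mul_sub, Matrix.mul_sub, Matrix.trace_sub, Matrix.trace_sub, Matrix.trace_mul_comm,
      Matrix.mul_assoc, hρ₂.sqrt_mul_sqrt, ← Matrix.mul_assoc, hρ₂.sqrt_mul_sqrt,
      Matrix.trace_mul_comm (cfc Real.log σ₂)]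
  obtain ⟨hle, heq⟩ := log_transfer ha0 hb0 V hVy hV hcontr hform
    (fun p hp => by
      rcases mul_eq_zero.1 hp with h | h
      · exact hxA p h
      · exact hxB p (inv_eq_zero.1 h))
    (fun p hp => by
      rcases mul_eq_zero.1 hp with h | h
      · exact hyA p h
      · exact hyB p (inv_eq_zero.1 h))
  rw [hsumx, hsumy] at hle heq
  have hcs : ∀ z w : ℝ, s * s * z = w ↔ z = c * w := by
    intro z w
    constructor
    · rintro rfl
      linear_combination -z * hs
    · rintro rfl
      linear_combination w * hs
  refine ⟨?_, fun h => ?_⟩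
  · have := mul_le_mul_of_nonneg_left hle hc.le
    calc _ = c * (s * s * (ρ₁ * (cfc Real.log σ₁ - cfc Real.log ρ₁)).trace.re) := by
          linear_combination -(ρ₁ * (cfc Real.log σ₁ - cfc Real.log ρ₁)).trace.re * hs
      _ ≤ _ := this
  · have h1 := heq ((hcs _ _).2 h)
    rw [show (fun j => (Real.log (b j) : ℂ) * y j) = _ from funext hlogy, hVdef] at h1
    have h2 : eigenCoord A B (cfc Real.log σ₁ * ((s : ℂ) • Q₁) - (s : ℂ) • Q₁ * cfc Real.log ρ₁)
        = eigenCoord A B (petzMap π s ρ₁ ρ₂ (cfc Real.log σ₂ * Q₂ - Q₂ * cfc Real.log ρ₂)) :=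
      funext fun p => (hlogx p).symm.trans (h1 p)
    have h3 := eigenCoord_injective A B h2
    -- With the square root moved to the right, the factor ρ₂^(-1/2) in `petzMap` reduces it to the
    -- support projection.
    have hcomm : Q₂ * cfc Real.log ρ₂ = cfc Real.log ρ₂ * Q₂ := by
      rw [hQ₂, cfc_mul_cfc, cfc_mul_cfc]
      congr 1; funext x; ring
    have hcomm₁ : Q₁ * cfc Real.log ρ₁ = cfc Real.log ρ₁ * Q₁ := by
      rw [hQ₁, cfc_mul_cfc, cfc_mul_cfc]
      congr 1; funext x; ring
    rw [petzMap, hcomm, ← Matrix.sub_mul, Matrix.mul_assoc, hQ₂, cfc_invSqrt_mul_sqrt _ hρ₂,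
      map_mul, Matrix.mul_assoc, map_supportProj_mul_sqrt π hρ₁ hρ₂ hρ, Matrix.mul_smul,
      Matrix.smul_mul, hcomm₁, ← smul_sub, ← Matrix.sub_mul] at h3
    have h4 := smul_right_injective _ (show (s : ℂ) ≠ 0 by exact_mod_cast hs0) h3
    have h5 := congrArg (· * Q₁) h4
    simp only [Matrix.mul_assoc] at h5
    rwa [← hQ₁, hQ₁, hρ₁.sqrt_mul_sqrt] at h5

end DataProcessing

/-! ### Reduced densities, extension by the identity, and composition of marginals. -/

section Regions
variable {V : Type*} [Fintype V] [DecidableEq V]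
  {κ : V → Type*} [∀ v, Fintype (κ v)] [∀ v, DecidableEq (κ v)]

theorem splitConfig_snd_eq_iff {A : Finset V} {x y : ∀ v, κ v} :
    (splitConfig κ A x).2 = (splitConfig κ A y).2 ↔ ∀ v, v ∉ A → x v = y v := by
  simp [splitConfig, Equiv.piEquivPiSubtypeProd, funext_iff]

theorem splitConfig_symm_piecewise (A : Finset V) (x z : ∀ v, κ v) :
    (splitConfig κ A).symm ((splitConfig κ A x).1, (splitConfig κ A z).2) = A.piecewise x z := by
  funext v
  by_cases h : v ∈ A <;> simp [splitConfig, Equiv.piEquivPiSubtypeProd, Finset.piecewise, h]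

theorem extendOp_apply (A : Finset V)
    (M : Matrix (∀ v : {v // v ∈ A}, κ v) (∀ v : {v // v ∈ A}, κ v) ℂ) (x y : ∀ v, κ v) :
    extendOp A M x y = M (splitConfig κ A x).1 (splitConfig κ A y).1 *
      if (splitConfig κ A x).2 = (splitConfig κ A y).2 then 1 else 0 := by
  simp only [extendOp, Matrix.submatrix_apply, Matrix.kroneckerMap_apply, Matrix.one_apply]

/-- Extension by the identity as a homomorphism of star algebras. -/
noncomputable def extendHom (A : Finset V) :
    Matrix (∀ v : {v // v ∈ A}, κ v) (∀ v : {v // v ∈ A}, κ v) ℂ →⋆ₐ[ℂ]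
      Matrix (∀ v, κ v) (∀ v, κ v) ℂ where
  toFun := extendOp A
  map_one' := by
    simp only [extendOp, Matrix.one_kronecker_one, Matrix.submatrix_one_equiv]
  map_mul' M N := by
    simp only [extendOp, Matrix.submatrix_mul_equiv, ← Matrix.mul_kronecker_mul, Matrix.mul_one]
  map_zero' := by
    simp only [extendOp, Matrix.zero_kronecker, Matrix.submatrix_zero, Pi.zero_apply]
  map_add' M N := by
    simp only [extendOp, Matrix.add_kronecker, Matrix.submatrix_add, Pi.add_apply]
  commutes' r := by
    simp only [extendOp, Algebra.algebraMap_eq_smul_one, Matrix.smul_kronecker,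
      Matrix.one_kronecker_one, Matrix.submatrix_smul, Pi.smul_apply, Matrix.submatrix_one_equiv]
  map_star' M := by
    simp only [extendOp, Matrix.star_eq_conjTranspose, Matrix.conjTranspose_submatrix,
      Matrix.conjTranspose_kronecker, Matrix.conjTranspose_one]

theorem extendHom_apply (A : Finset V)
    (M : Matrix (∀ v : {v // v ∈ A}, κ v) (∀ v : {v // v ∈ A}, κ v) ℂ) :
    extendHom A M = extendOp A M := rfl

theorem extendOp_injective [Nonempty (∀ v, κ v)] (A : Finset V) :
    Function.Injective (extendOp (κ := κ) A) := by
  intro M N h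
  obtain ⟨z⟩ := ‹Nonempty (∀ v, κ v)›
  ext s t
  have := congrFun (congrFun h ((splitConfig κ A).symm (s, (splitConfig κ A z).2)))
    ((splitConfig κ A).symm (t, (splitConfig κ A z).2))
  simpa [extendOp_apply] using this

theorem continuous_extendHom (A : Finset V) : Continuous (extendHom (κ := κ) A) := by
  refine continuous_matrix fun x y => ?_
  simp only [extendHom_apply, extendOp_apply]
  fun_prop

theorem extendOp_cfc (A : Finset V)
    {M : Matrix (∀ v : {v // v ∈ A}, κ v) (∀ v : {v // v ∈ A}, κ v) ℂ} (hM : M.IsHermitian)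
    (f : ℝ → ℝ) : extendOp A (cfc f M) = cfc f (extendOp A M) := by
  have h := StarAlgHomClass.map_cfc (S := ℂ) (extendHom A) f M (continuousOn_spectrum M f)
    (continuous_extendHom A) hM 
    (IsSelfAdjoint.map (show IsSelfAdjoint M from hM) (extendHom A))
  exact h

theorem extendOp_posSemidef (A : Finset V)
    {M : Matrix (∀ v : {v // v ∈ A}, κ v) (∀ v : {v // v ∈ A}, κ v) ℂ} (hM : M.PosSemidef) :
    (extendOp A M).PosSemidef :=
  (hM.kronecker Matrix.PosSemidef.one).submatrix _

theorem reducedDensity_posSemidef {ρ : Matrix (∀ v, κ v) (∀ v, κ v) ℂ} (hρ : ρ.PosSemidef)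
    (A : Finset V) : (reducedDensity ρ A).PosSemidef := by
  have : reducedDensity ρ A = ∑ r, ρ.submatrix (fun s => (splitConfig κ A).symm (s, r))
      (fun s => (splitConfig κ A).symm (s, r)) := by
    ext s t
    simp [reducedDensity, Matrix.sum_apply]
  rw [this]
  exact Matrix.posSemidef_sum _ fun r _ => hρ.submatrix _

theorem reducedDensity_smul (c : ℂ) (ρ : Matrix (∀ v, κ v) (∀ v, κ v) ℂ) (A : Finset V) :
    reducedDensity (c • ρ) A = c • reducedDensity ρ A := by
  ext s t
  simp [reducedDensity, Finset.mul_sum]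

theorem extendOp_smul (A : Finset V) (c : ℂ)
    (M : Matrix (∀ v : {v // v ∈ A}, κ v) (∀ v : {v // v ∈ A}, κ v) ℂ) :
    extendOp A (c • M) = c • extendOp A M := map_smul (extendHom A) c M

/-- Partial trace is dual to extension by the identity; this is the shape of the restriction
hypotheses of `relativeEntropy_restrict`. -/
theorem trace_mul_extendOp (ρ : Matrix (∀ v, κ v) (∀ v, κ v) ℂ) (A : Finset V)
    (Y : Matrix (∀ v : {v // v ∈ A}, κ v) (∀ v : {v // v ∈ A}, κ v) ℂ) :
    (ρ * extendOp A Y).trace = (reducedDensity ρ A * Y).trace := by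
  simp only [Matrix.trace, Matrix.diag, Matrix.mul_apply, extendOp_apply, reducedDensity,
    Matrix.of_apply]
  rw [← (splitConfig κ A).symm.sum_comp]
  simp only [Equiv.apply_symm_apply, Fintype.sum_prod_type, mul_ite, mul_one, mul_zero,
    Finset.sum_mul]
  refine Finset.sum_congr rfl fun s _ => ?_
  rw [Finset.sum_comm, ← (splitConfig κ A).symm.sum_comp]
  simp only [Equiv.apply_symm_apply, Fintype.sum_prod_type, Finset.sum_ite_eq, Finset.mem_univ,
    if_true]

/-- The marginal of `ρ` on the region `A`, as an operator on the whole system. -/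
noncomputable def marginal (A : Finset V) (ρ : Matrix (∀ v, κ v) (∀ v, κ v) ℂ) :
    Matrix (∀ v, κ v) (∀ v, κ v) ℂ := extendOp A (reducedDensity ρ A)

theorem marginal_posSemidef {ρ : Matrix (∀ v, κ v) (∀ v, κ v) ℂ} (hρ : ρ.PosSemidef)
    (A : Finset V) : (marginal A ρ).PosSemidef :=
  extendOp_posSemidef A (reducedDensity_posSemidef hρ A)

/-- The average of `ρ` over all configurations outside of `A`, extended by the identity. -/
noncomputable def averageOutside (A : Finset V) (ρ : Matrix (∀ v, κ v) (∀ v, κ v) ℂ) :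
    Matrix (∀ v, κ v) (∀ v, κ v) ℂ :=
  Matrix.of fun x y => if ∀ v, v ∉ A → x v = y v then
    ∑ z, ρ (A.piecewise x z) (A.piecewise y z) else 0

/-- The dimension of the space of a region. -/
noncomputable def regionDim (κ : V → Type*) [∀ v, Fintype (κ v)] (A : Finset V) : ℕ := ∏ v ∈ A, Fintype.card (κ v)

theorem card_config_eq_regionDim (A : Finset V) :
    Fintype.card (∀ v : {v // v ∈ A}, κ v) = regionDim κ A := by
  rw [Fintype.card_pi, regionDim]
  exact Finset.prod_coe_sort A fun v => Fintype.card (κ v)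

theorem regionDim_pos [h : Nonempty (∀ v, κ v)] (A : Finset V) : 0 < regionDim κ A :=
  Finset.prod_pos fun v _ => Fintype.card_pos_iff.2 ⟨h.some v⟩

/-- `averageOutside` sums over configurations z of the whole system, although their part inside A is
irrelevant. This overcounts by the dimension of A, but it avoids subtypes and makes composition
easy. -/
theorem regionDim_smul_marginal (A : Finset V) (ρ : Matrix (∀ v, κ v) (∀ v, κ v) ℂ) :
    (regionDim κ A : ℂ) • marginal A ρ = averageOutside A ρ := by
  ext x y
  simp only [Matrix.smul_apply, marginal, extendOp_apply, reducedDensity, Matrix.of_apply,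
    averageOutside, splitConfig_snd_eq_iff, smul_eq_mul]
  split_ifs with h
  · rw [mul_one, ← card_config_eq_regionDim, ← (splitConfig κ A).symm.sum_comp,
      Fintype.sum_prod_type]
    have : ∀ (s : ∀ v : {v // v ∈ A}, κ v) (r : ∀ v : {v // ¬ v ∈ A}, κ v) (x : ∀ v, κ v),
        A.piecewise x ((splitConfig κ A).symm (s, r)) =
          (splitConfig κ A).symm ((splitConfig κ A x).1, r) := by
      intro s r x
      rw [← splitConfig_symm_piecewise, Equiv.apply_symm_apply]
    simp only [this, Finset.sum_const, Finset.card_univ, nsmul_eq_mul]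
  · simp

/-- Exchanging z and w outside T is an involution on pairs that makes the mixed configuration the
first component; the other component is then free. -/
theorem sum_sum_piecewise (T : Finset V) (f : (∀ v, κ v) → ℂ) :
    ∑ z, ∑ w, f (T.piecewise z w) = (regionDim κ (Finset.univ : Finset V) : ℂ) * ∑ z, f z := by
  let e : (∀ v, κ v) × (∀ v, κ v) ≃ (∀ v, κ v) × (∀ v, κ v) :=
    { toFun := fun p => (T.piecewise p.1 p.2, T.piecewise p.2 p.1)
      invFun := fun p => (T.piecewise p.1 p.2, T.piecewise p.2 p.1)
      left_inv := fun p => by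
        ext v <;> by_cases h : v ∈ T <;> simp [Finset.piecewise, h]
      right_inv := fun p => by
        ext v <;> by_cases h : v ∈ T <;> simp [Finset.piecewise, h] }
  have h1 : ∑ p : (∀ v, κ v) × (∀ v, κ v), f (e p).1 = ∑ p : (∀ v, κ v) × (∀ v, κ v), f p.1 :=
    e.sum_comp fun p => f p.1
  rw [Fintype.sum_prod_type, Fintype.sum_prod_type] at h1
  simp only [e, Equiv.coe_fn_mk, Finset.sum_const, Finset.card_univ, nsmul_eq_mul] at h1
  rw [h1, Finset.mul_sum, Fintype.card_pi, regionDim]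

/-- Agreement outside S, and on S outside T, is agreement outside S ∩ T. The double sum over mixed
configurations collapses by `sum_sum_piecewise`. -/
theorem averageOutside_averageOutside (S T : Finset V) (ρ : Matrix (∀ v, κ v) (∀ v, κ v) ℂ) :
    averageOutside S (averageOutside T ρ)
      = (regionDim κ (Finset.univ : Finset V) : ℂ) • averageOutside (S ∩ T) ρ := by
  ext x y
  have hpw : ∀ x z w : ∀ v, κ v, T.piecewise (S.piecewise x z) w =
      (S ∩ T).piecewise x (T.piecewise z w) := by
    intro x z w
    funext v
    by_cases h1 : v ∈ S <;> by_cases h2 : v ∈ T <;> simp [Finset.piecewise, h1, h2]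
  have hcond : ∀ z : ∀ v, κ v, (∀ v, v ∉ T → S.piecewise x z v = S.piecewise y z v) ↔
      ∀ v, v ∈ S → v ∉ T → x v = y v := by
    intro z
    refine forall_congr' fun v => ?_
    by_cases h1 : v ∈ S <;> simp [Finset.piecewise, h1]
  simp only [averageOutside, Matrix.of_apply, Matrix.smul_apply, smul_eq_mul, hcond]
  by_cases h : ∀ v, v ∉ S ∩ T → x v = y v
  · rw [if_pos h, if_pos fun v hv => h v fun h' => hv (Finset.mem_inter.1 h').1]
    simp only [if_pos (fun v (_ : v ∈ S) (hv : v ∉ T) => h v fun h' => hv (Finset.mem_inter.1 h').2),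
      hpw]
    exact sum_sum_piecewise T fun z => ρ ((S ∩ T).piecewise x z) ((S ∩ T).piecewise y z)
  · rw [if_neg h, mul_zero]
    split_ifs with h1 h2
    · exfalso
      refine h fun v hv => ?_
      by_cases hS : v ∈ S
      · exact h2 v hS fun hT => hv (Finset.mem_inter.2 ⟨hS, hT⟩)
      · exact h1 v hS
    · simp
    · rfl

theorem marginal_smul (A : Finset V) (c : ℂ) (ρ : Matrix (∀ v, κ v) (∀ v, κ v) ℂ) :
    marginal A (c • ρ) = c • marginal A ρ := by
  rw [marginal, reducedDensity_smul, extendOp_smul, marginal]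

theorem marginal_marginal (S T : Finset V) (ρ : Matrix (∀ v, κ v) (∀ v, κ v) ℂ) :
    ((regionDim κ S : ℂ) * regionDim κ T) • marginal S (marginal T ρ)
      = ((regionDim κ (Finset.univ : Finset V) : ℂ) * regionDim κ (S ∩ T)) •
        marginal (S ∩ T) ρ := by
  rw [mul_smul, ← marginal_smul, regionDim_smul_marginal, regionDim_smul_marginal,
    averageOutside_averageOutside, ← regionDim_smul_marginal, mul_smul]

end Regions

/-! ### Strong subadditivity with its equality case. -/

section StrongSubadditivity
variable {V : Type*} [Fintype V] [DecidableEq V]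
  {κ : V → Type*} [∀ v, Fintype (κ v)] [∀ v, DecidableEq (κ v)]
  {ρ : Matrix (∀ v, κ v) (∀ v, κ v) ℂ}

theorem regionDim_union {A B : Finset V} (h : Disjoint A B) :
    regionDim κ (A ∪ B) = regionDim κ A * regionDim κ B := Finset.prod_union h

/-- The dimension of the space of the complement of `T`, as a quotient. -/
noncomputable def codim (κ : V → Type*) [∀ v, Fintype (κ v)] (T : Finset V) : ℝ :=
  (regionDim κ (Finset.univ : Finset V) : ℝ) / regionDim κ T

theorem codim_pos [Nonempty (∀ v, κ v)] (T : Finset V) : 0 < codim κ T :=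
  div_pos (Nat.cast_pos.2 (regionDim_pos _)) (Nat.cast_pos.2 (regionDim_pos _))

theorem marginal_marginal_of_subset [Nonempty (∀ v, κ v)] {S T : Finset V} (h : S ⊆ T) :
    marginal S (marginal T ρ) = (codim κ T : ℂ) • marginal S ρ := by
  have hS : (regionDim κ S : ℂ) ≠ 0 := Nat.cast_ne_zero.2 (regionDim_pos S).ne'
  have hT : (regionDim κ T : ℂ) ≠ 0 := Nat.cast_ne_zero.2 (regionDim_pos T).ne'
  have h1 := marginal_marginal S T ρ
  rw [Finset.inter_eq_left.2 h] at h1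
  apply smul_right_injective _ (mul_ne_zero hS hT)
  simp only
  rw [h1, smul_smul, codim]
  congr 1
  push_cast
  field_simp

theorem reducedDensity_marginal_of_subset [Nonempty (∀ v, κ v)] {S T : Finset V} (h : S ⊆ T) :
    reducedDensity (marginal T ρ) S = (codim κ T : ℂ) • reducedDensity ρ S := by
  apply extendOp_injective S
  rw [extendOp_smul]
  exact marginal_marginal_of_subset h

theorem trace_marginal_mul_extendOp [Nonempty (∀ v, κ v)] {S T : Finset V} (h : S ⊆ T)
    (Y : Matrix (∀ v : {v // v ∈ S}, κ v) (∀ v : {v // v ∈ S}, κ v) ℂ) :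
    (marginal T ρ * extendOp S Y).trace = codim κ T * (reducedDensity ρ S * Y).trace := by
  rw [trace_mul_extendOp, reducedDensity_marginal_of_subset h, Matrix.smul_mul, Matrix.trace_smul,
    smul_eq_mul]

/-- Tracing C out of 1_A ⊗ ρ_BC leaves 1_A ⊗ ρ_B. The constant is the dimension of the complement of
ABC, the same as for restricting ρ_ABC to AB, so one c serves for both states. -/
theorem marginal_union_marginal_union [Nonempty (∀ v, κ v)] {A B C : Finset V}
    (hAB : Disjoint A B) (hAC : Disjoint A C) (hBC : Disjoint B C) :
    marginal (A ∪ B) (marginal (B ∪ C) ρ) = (codim κ (A ∪ B ∪ C) : ℂ) • marginal B ρ := by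
  have hA : (regionDim κ A : ℂ) ≠ 0 := Nat.cast_ne_zero.2 (regionDim_pos A).ne'
  have hB : (regionDim κ B : ℂ) ≠ 0 := Nat.cast_ne_zero.2 (regionDim_pos B).ne'
  have hC : (regionDim κ C : ℂ) ≠ 0 := Nat.cast_ne_zero.2 (regionDim_pos C).ne'
  have hdim : regionDim κ (A ∪ B ∪ C) = regionDim κ A * regionDim κ B * regionDim κ C := by
    rw [regionDim_union (Finset.disjoint_union_left.2 ⟨hAC, hBC⟩), regionDim_union hAB]
  have hinter : (A ∪ B) ∩ (B ∪ C) = B := by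
    ext v
    have h1 : v ∈ A → v ∉ B := fun h h' => Finset.disjoint_left.1 hAB h h'
    have h2 : v ∈ A → v ∉ C := fun h h' => Finset.disjoint_left.1 hAC h h'
    simp only [Finset.mem_inter, Finset.mem_union]
    tauto
  have h1 := marginal_marginal (A ∪ B) (B ∪ C) ρ
  rw [hinter] at h1
  have hne : (regionDim κ (A ∪ B) : ℂ) * regionDim κ (B ∪ C) ≠ 0 :=
    mul_ne_zero (Nat.cast_ne_zero.2 (regionDim_pos _).ne') (Nat.cast_ne_zero.2 (regionDim_pos _).ne')
  apply smul_right_injective _ hne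
  simp only
  rw [h1, smul_smul, codim, hdim, regionDim_union hAB, regionDim_union hBC]
  congr 1
  push_cast
  field_simp

theorem entHam_eq (hρ : ρ.PosSemidef) (A : Finset V) :
    entHam ρ A = -cfc Real.log (marginal A ρ) := by
  rw [entHam, marginal, ← extendOp_cfc A (reducedDensity_posSemidef hρ A).isHermitian]
  exact map_neg (extendHom A) _

theorem trace_marginal_mul_log [Nonempty (∀ v, κ v)] (hρ : ρ.PosSemidef) {S T : Finset V}
    (h : S ⊆ T) :
    (marginal T ρ * cfc Real.log (marginal S ρ)).trace.re = -(codim κ T * entropy ρ S) := by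
  rw [marginal, ← marginal, marginal.eq_def S, ← extendOp_cfc S
    (reducedDensity_posSemidef hρ S).isHermitian, trace_marginal_mul_extendOp h,
    Complex.re_ofReal_mul, entropy, mul_neg, neg_neg]

/-- Strong subadditivity of the entropy. -/
theorem strongSubadditivity_aux [Nonempty (∀ v, κ v)] (hρ : ρ.PosSemidef) {A B C : Finset V}
    (hAB : Disjoint A B) (hAC : Disjoint A C) (hBC : Disjoint B C) :
    entropy ρ B + entropy ρ (A ∪ B ∪ C) ≤ entropy ρ (A ∪ B) + entropy ρ (B ∪ C) ∧
      (entropy ρ B + entropy ρ (A ∪ B ∪ C) = entropy ρ (A ∪ B) + entropy ρ (B ∪ C) →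
        (entHam ρ (A ∪ B) + entHam ρ (B ∪ C) - entHam ρ B - entHam ρ (A ∪ B ∪ C)) *
          marginal (A ∪ B ∪ C) ρ = 0) := by
  set c := codim κ (A ∪ B ∪ C) with hc_def
  have hc : 0 < c := codim_pos _
  have hc' : (c : ℂ) ≠ 0 := by exact_mod_cast hc.ne'
  -- The relative entropy of ρ_ABC with respect to 1_A ⊗ ρ_BC is S(BC) - S(ABC); restricted to AB it
  -- becomes S(B) - S(AB). The factor c⁻¹ in σ₂ makes its extension equal to the marginal on B.
  set ρ₁ := marginal (A ∪ B ∪ C) ρ with hρ₁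
  set σ₁ := marginal (B ∪ C) ρ with hσ₁
  set ρ₂ := reducedDensity ρ (A ∪ B) with hρ₂
  set σ₂ := (c⁻¹ : ℝ) • reducedDensity σ₁ (A ∪ B) with hσ₂
  have hBCs : B ∪ C ⊆ A ∪ B ∪ C :=
    Finset.union_subset_union_left Finset.subset_union_right
  have hABs : A ∪ B ⊆ A ∪ B ∪ C := Finset.subset_union_left
  have hBs : B ⊆ A ∪ B ∪ C := Finset.subset_union_right.trans hABs
  have pρ₁ : ρ₁.PosSemidef := marginal_posSemidef hρ _
  have pσ₁ : σ₁.PosSemidef := marginal_posSemidef hρ _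
  have pρ₂ : ρ₂.PosSemidef := reducedDensity_posSemidef hρ _
  have pσ₂ : σ₂.PosSemidef := (reducedDensity_posSemidef pσ₁ _).smul (inv_nonneg.2 hc.le)
  have hσ₂c : σ₂ = ((c : ℂ)⁻¹) • reducedDensity σ₁ (A ∪ B) := by
    rw [hσ₂, ← Complex.ofReal_inv, Complex.coe_smul]
  have hπσ₂ : extendOp (A ∪ B) σ₂ = marginal B ρ := by
    rw [hσ₂c, extendOp_smul, ← marginal.eq_def, hσ₁, marginal_union_marginal_union hAB hAC hBC,
      smul_smul, inv_mul_cancel₀ hc', one_smul]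
  have tρ : ∀ Y, (ρ₁ * extendHom (A ∪ B) Y).trace = (c : ℂ) * (ρ₂ * Y).trace := fun Y =>
    trace_marginal_mul_extendOp hABs Y
  have tσ : ∀ Y, (σ₁ * extendHom (A ∪ B) Y).trace = (c : ℂ) * (σ₂ * Y).trace := fun Y => by
    rw [extendHom_apply, trace_mul_extendOp, hσ₂c, Matrix.smul_mul, Matrix.trace_smul, smul_eq_mul,
      ← mul_assoc, mul_inv_cancel₀ hc', one_mul]
  have hsupp : supportProj σ₁ * ρ₁ = ρ₁ := by
    have h := map_supportProj_mul (extendHom (B ∪ C)) (c := c) pρ₁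
      (reducedDensity_posSemidef hρ (B ∪ C)) fun Y => trace_marginal_mul_extendOp hBCs Y
    rwa [extendHom_apply, supportProj, extendOp_cfc _
      (reducedDensity_posSemidef hρ (B ∪ C)).isHermitian] at h
  have hlogσ : extendOp (A ∪ B) (cfc Real.log σ₂) = cfc Real.log (marginal B ρ) := by
    rw [extendOp_cfc _ pσ₂.isHermitian, hπσ₂]
  have hlogρ : extendOp (A ∪ B) (cfc Real.log ρ₂) = cfc Real.log (marginal (A ∪ B) ρ) := by
    rw [extendOp_cfc _ pρ₂.isHermitian, marginal]
  have h1 : (ρ₁ * (cfc Real.log σ₁ - cfc Real.log ρ₁)).trace.re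
      = c * (entropy ρ (A ∪ B ∪ C) - entropy ρ (B ∪ C)) := by
    rw [Matrix.mul_sub, Matrix.trace_sub, Complex.sub_re, trace_marginal_mul_log hρ hBCs,
      trace_marginal_mul_log hρ subset_rfl]
    ring
  have h2 : c * (ρ₂ * (cfc Real.log σ₂ - cfc Real.log ρ₂)).trace.re
      = c * (entropy ρ (A ∪ B) - entropy ρ B) := by
    rw [← Complex.re_ofReal_mul, ← tρ, map_sub, extendHom_apply, extendHom_apply, hlogσ, hlogρ,
      Matrix.mul_sub, Matrix.trace_sub, Complex.sub_re, trace_marginal_mul_log hρ hBs,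
      trace_marginal_mul_log hρ hABs]
    ring
  obtain ⟨hle, heq⟩ := relativeEntropy_restrict (extendHom (A ∪ B)) hc pρ₁ pσ₁ pρ₂ pσ₂ tρ tσ hsupp
  rw [h1, h2] at hle heq
  have hle' := le_of_mul_le_mul_left hle hc
  refine ⟨by linarith only [hle'], fun h => ?_⟩
  have h3 := heq (congrArg (c * ·) (by linarith only [h]))
  rw [map_sub, extendHom_apply, extendHom_apply, hlogσ, hlogρ, ← sub_eq_zero, ← Matrix.sub_mul] at h3
  have key : ∀ a b c d : Matrix (∀ v, κ v) (∀ v, κ v) ℂ,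
      -a + -b - -c - -d = -(b - d - (c - a)) := fun a b c d => by abel
  rw [entHam_eq hρ, entHam_eq hρ, entHam_eq hρ, entHam_eq hρ, key, Matrix.neg_mul, neg_eq_zero]
  exact h3

theorem strongSubadditivity [Nonempty (∀ v, κ v)] (hρ : ρ.PosSemidef) {A B C : Finset V}
    (hAB : Disjoint A B) (hAC : Disjoint A C) (hBC : Disjoint B C) :
    entropy ρ B + entropy ρ (A ∪ B ∪ C) ≤ entropy ρ (A ∪ B) + entropy ρ (B ∪ C) :=
  (strongSubadditivity_aux hρ hAB hAC hBC).1

/-- The support of a state lies in the supports of its marginals. -/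
theorem range_le_regionSupport [Nonempty (∀ v, κ v)] (hρ : ρ.PosSemidef) (A : Finset V) :
    LinearMap.range ρ.mulVecLin ≤ regionSupport ρ A := by
  have h := map_supportProj_mul (extendHom A) (c := 1) hρ
    (reducedDensity_posSemidef hρ A) fun Y => by
      rw [extendHom_apply, trace_mul_extendOp, Complex.ofReal_one, one_mul]
  rw [(reducedDensity_posSemidef hρ A).supportProj_eq, map_mul, extendHom_apply,
    Matrix.mul_assoc] at h
  rintro _ ⟨φ, rfl⟩
  refine ⟨(extendHom A (cfc (fun x : ℝ => x⁻¹) (reducedDensity ρ A)) * ρ) *ᵥ φ, ?_⟩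
  rw [Matrix.mulVecLin_apply, Matrix.mulVec_mulVec, h, Matrix.mulVecLin_apply]

end StrongSubadditivity

/-! ### Entropy in terms of the characteristic polynomial. -/

section SpectralEntropy
variable {n m : Type*} [Fintype n] [DecidableEq n] [Fintype m] [DecidableEq m]

theorem trace_cfc_eq_sum_eigenvalues {N : Matrix n n ℂ} (hN : N.IsHermitian) (f : ℝ → ℝ) :
    (cfc f N).trace = ∑ i, (f (hN.eigenvalues i) : ℂ) := by
  rw [hN.cfc_eq, Matrix.IsHermitian.cfc, Unitary.conjStarAlgAut_apply, Matrix.trace_mul_comm,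
    ← Matrix.mul_assoc, Unitary.coe_star_mul_self, Matrix.one_mul, Matrix.trace_diagonal]
  rfl

/-- The sum of `x log x` over the eigenvalues `x` of a matrix. -/
noncomputable def sumMulLog (N : Matrix n n ℂ) : ℝ := (N.charpoly.roots.map fun z => z.re * Real.log z.re).sum

theorem trace_mul_cfc_log {N : Matrix n n ℂ} (hN : N.PosSemidef) :
    (N * cfc Real.log N).trace.re = sumMulLog N := by
  have h : N * cfc Real.log N = cfc (fun x : ℝ => x * Real.log x) N := by
    nth_rw 1 [← hN.cfc_id]
    rw [cfc_mul_cfc]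
  rw [h, trace_cfc_eq_sum_eigenvalues hN.isHermitian, sumMulLog,
    hN.isHermitian.roots_charpoly_eq_eigenvalues, Multiset.map_map, Complex.re_sum]
  simp only [Function.comp_def, Complex.ofReal_re]
  rfl

theorem sumMulLog_transpose (N : Matrix n n ℂ) : sumMulLog Nᵀ = sumMulLog N := by
  rw [sumMulLog, Matrix.charpoly_transpose, sumMulLog]

theorem sumMulLog_submatrix (N : Matrix n n ℂ) (e : m ≃ n) :
    sumMulLog (N.submatrix e e) = sumMulLog N := by
  rw [sumMulLog, sumMulLog, ← Matrix.charpoly_reindex e.symm N]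
  rfl

/-- The characteristic polynomials of MN and NM agree up to powers of the variable, and the root 0
contributes 0 log 0 = 0. -/
theorem sumMulLog_mul_comm (M : Matrix m n ℂ) (N : Matrix n m ℂ) :
    sumMulLog (M * N) = sumMulLog (N * M) := by
  have h := congrArg Polynomial.roots (Matrix.charpoly_mul_comm' M N)
  rw [Polynomial.roots_mul (mul_ne_zero (pow_ne_zero _ Polynomial.X_ne_zero)
      (Matrix.charpoly_monic _).ne_zero),
    Polynomial.roots_mul (mul_ne_zero (pow_ne_zero _ Polynomial.X_ne_zero)
      (Matrix.charpoly_monic _).ne_zero), Polynomial.roots_X_pow, Polynomial.roots_X_pow] at h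
  have h1 := congrArg (fun s : Multiset ℂ => (s.map fun z => z.re * Real.log z.re).sum) h
  simpa [sumMulLog, Multiset.map_nsmul, Multiset.sum_nsmul] using h1

end SpectralEntropy

/-! ### Purification, weak monotonicity and the Markov identity. -/

section Purification
variable {V : Type*} [Fintype V] [DecidableEq V]
  {κ : V → Type*} [∀ v, Fintype (κ v)] [∀ v, DecidableEq (κ v)]
  {ρ : Matrix (∀ v, κ v) (∀ v, κ v) ℂ}

theorem entropy_eq_sumMulLog (hρ : ρ.PosSemidef) (A : Finset V) :
    entropy ρ A = -sumMulLog (reducedDensity ρ A) := by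
  rw [entropy, trace_mul_cfc_log (reducedDensity_posSemidef hρ A)]

/-- Configurations on subtypes with equivalent predicates. -/
noncomputable def configCongr (κ : V → Type*) {p q : V → Prop} (h : ∀ v, p v ↔ q v) :
    (∀ v : {v // p v}, κ v) ≃ (∀ v : {v // q v}, κ v) where
  toFun s v := s ⟨v, (h v).2 v.2⟩
  invFun s v := s ⟨v, (h v).1 v.2⟩
  left_inv _ := rfl
  right_inv _ := rfl

theorem splitConfig_compl_symm (A : Finset V) (s : ∀ v : {v // v ∈ Aᶜ}, κ v)
    (r : ∀ v : {v // ¬ v ∈ Aᶜ}, κ v) :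
    (splitConfig κ Aᶜ).symm (s, r) = (splitConfig κ A).symm
      (configCongr κ (p := fun v => ¬ v ∈ Aᶜ) (q := fun v => v ∈ A) (fun v => by simp) r,
        configCongr κ (p := fun v => v ∈ Aᶜ) (q := fun v => ¬ v ∈ A) (fun v => by simp) s) := by
  funext v
  by_cases h : v ∈ A <;> simp [splitConfig, Equiv.piEquivPiSubtypeProd, configCongr, h]

/-- Complementary regions of a pure state have the same entropy. -/
theorem entropy_compl_of_pure (ψ : (∀ v, κ v) → ℂ) (A : Finset V) :
    entropy (Matrix.vecMulVec ψ (star ψ)) Aᶜ = entropy (Matrix.vecMulVec ψ (star ψ)) A := by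
  have hps : (Matrix.vecMulVec ψ (star ψ)).PosSemidef := Matrix.posSemidef_vecMulVec_self_star ψ
  -- The pure state read as a matrix between the two sides. Its reduced densities are M Mᴴ and, up
  -- to relabelling, the transpose of Mᴴ M, which have the same non-zero spectrum.
  set M : Matrix (∀ v : {v // v ∈ A}, κ v) (∀ v : {v // ¬ v ∈ A}, κ v) ℂ :=
    Matrix.of fun s r => ψ ((splitConfig κ A).symm (s, r)) with hM
  have h1 : reducedDensity (Matrix.vecMulVec ψ (star ψ)) A = M * Mᴴ := by
    ext s t
    simp [reducedDensity, Matrix.mul_apply, Matrix.vecMulVec_apply, hM]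
  have h2 : reducedDensity (Matrix.vecMulVec ψ (star ψ)) Aᶜ = ((Mᴴ * M)ᵀ).submatrix
      (configCongr κ (p := fun v => v ∈ Aᶜ) (q := fun v => ¬ v ∈ A) (fun v => by simp))
      (configCongr κ (p := fun v => v ∈ Aᶜ) (q := fun v => ¬ v ∈ A) (fun v => by simp)) := by
    ext s t
    simp only [reducedDensity, Matrix.of_apply, Matrix.vecMulVec_apply, splitConfig_compl_symm,
      Matrix.submatrix_apply, Matrix.transpose_apply, Matrix.mul_apply, Matrix.conjTranspose_apply,
      hM, Pi.star_apply]
    rw [(configCongr κ (p := fun v => ¬ v ∈ Aᶜ) (q := fun v => v ∈ A) (fun v => by simp)).sum_comp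
      (fun r => ψ ((splitConfig κ A).symm (r, _)) * star (ψ ((splitConfig κ A).symm (r, _))))]
    exact Finset.sum_congr rfl fun r _ => mul_comm _ _
  rw [entropy_eq_sumMulLog hps, entropy_eq_sumMulLog hps, h1, h2, sumMulLog_submatrix,
    sumMulLog_transpose, sumMulLog_mul_comm]

theorem entropy_eq_trace_mul_log (hρ : ρ.PosSemidef) (A : Finset V) :
    entropy ρ A = -(ρ * cfc Real.log (marginal A ρ)).trace.re := by
  rw [marginal, ← extendOp_cfc A (reducedDensity_posSemidef hρ A).isHermitian, trace_mul_extendOp,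
    entropy]

instance sumElimFintype : ∀ v, Fintype (Sum.elim κ κ v)
  | Sum.inl v => inferInstanceAs (Fintype (κ v))
  | Sum.inr v => inferInstanceAs (Fintype (κ v))

instance sumElimDecidableEq : ∀ v, DecidableEq (Sum.elim κ κ v)
  | Sum.inl v => inferInstanceAs (DecidableEq (κ v))
  | Sum.inr v => inferInstanceAs (DecidableEq (κ v))

/-- Configurations of two copies of the system. -/
noncomputable def doubleConfig (κ : V → Type*) : (∀ v, Sum.elim κ κ v) ≃ (∀ v, κ v) × (∀ v, κ v) :=
  Equiv.sumPiEquivProdPi (Sum.elim κ κ)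

theorem doubleConfig_fst (x : ∀ v, Sum.elim κ κ v) (v : V) :
    (doubleConfig κ x).1 v = x (Sum.inl v) := rfl

theorem doubleConfig_snd (x : ∀ v, Sum.elim κ κ v) (v : V) :
    (doubleConfig κ x).2 v = x (Sum.inr v) := rfl

/-- The canonical purification of a state, on two copies of the system. -/
noncomputable def purification (ρ : Matrix (∀ v, κ v) (∀ v, κ v) ℂ) : (∀ v, Sum.elim κ κ v) → ℂ :=
  fun x => cfc Real.sqrt ρ (doubleConfig κ x).1 (doubleConfig κ x).2

/-- Operators on the first copy. -/
noncomputable def firstCopy : Matrix (∀ v, κ v) (∀ v, κ v) ℂ →⋆ₐ[ℂ]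
    Matrix (∀ v, Sum.elim κ κ v) (∀ v, Sum.elim κ κ v) ℂ where
  toFun M := (M ⊗ₖ (1 : Matrix (∀ v, κ v) (∀ v, κ v) ℂ)).submatrix (doubleConfig κ) (doubleConfig κ)
  map_one' := by
    simp only [Matrix.one_kronecker_one, Matrix.submatrix_one_equiv]
  map_mul' M N := by
    simp only [Matrix.submatrix_mul_equiv, ← Matrix.mul_kronecker_mul, Matrix.mul_one]
  map_zero' := by
    simp only [Matrix.zero_kronecker, Matrix.submatrix_zero, Pi.zero_apply]
  map_add' M N := by
    simp only [Matrix.add_kronecker, Matrix.submatrix_add, Pi.add_apply]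
  commutes' r := by
    simp only [Algebra.algebraMap_eq_smul_one, Matrix.smul_kronecker,
      Matrix.one_kronecker_one, Matrix.submatrix_smul, Pi.smul_apply, Matrix.submatrix_one_equiv]
  map_star' M := by
    simp only [Matrix.star_eq_conjTranspose, Matrix.conjTranspose_submatrix,
      Matrix.conjTranspose_kronecker, Matrix.conjTranspose_one]

theorem firstCopy_apply (M : Matrix (∀ v, κ v) (∀ v, κ v) ℂ) (x y : ∀ v, Sum.elim κ κ v) :
    firstCopy M x y = M (doubleConfig κ x).1 (doubleConfig κ y).1 *
      if (doubleConfig κ x).2 = (doubleConfig κ y).2 then 1 else 0 := by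
  change ((M ⊗ₖ (1 : Matrix (∀ v, κ v) (∀ v, κ v) ℂ)).submatrix _ _) x y = _
  simp only [Matrix.submatrix_apply, Matrix.kroneckerMap_apply, Matrix.one_apply]

theorem firstCopy_cfc {M : Matrix (∀ v, κ v) (∀ v, κ v) ℂ} (hM : M.IsHermitian) (f : ℝ → ℝ) :
    firstCopy (cfc f M) = cfc f (firstCopy M) :=
  StarAlgHomClass.map_cfc (S := ℂ) firstCopy f M (continuousOn_spectrum M f)
    (continuous_matrix fun x y => by simp only [firstCopy_apply]; fun_prop) hM
    (IsSelfAdjoint.map (show IsSelfAdjoint M from hM) firstCopy)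

theorem sum_purification (hρ : ρ.PosSemidef) (x y : ∀ v, κ v) :
    ∑ z, cfc Real.sqrt ρ x z * star (cfc Real.sqrt ρ y z) = ρ x y := by
  conv_rhs => rw [← hρ.sqrt_mul_sqrt, Matrix.mul_apply]
  refine Finset.sum_congr rfl fun z _ => ?_
  rw [← Matrix.conjTranspose_apply, cfc_conjTranspose]

theorem trace_purification_mul_firstCopy (hρ : ρ.PosSemidef) (Y : Matrix (∀ v, κ v) (∀ v, κ v) ℂ) :
    (Matrix.vecMulVec (purification ρ) (star (purification ρ)) * firstCopy Y).trace
      = (ρ * Y).trace := by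
  simp only [Matrix.trace, Matrix.diag, Matrix.mul_apply, firstCopy_apply, Matrix.vecMulVec_apply,
    Pi.star_apply, purification]
  rw [← (doubleConfig κ).symm.sum_comp]
  simp only [Equiv.apply_symm_apply, Fintype.sum_prod_type]
  refine Finset.sum_congr rfl fun x _ => ?_
  simp only [← sum_purification hρ x, Finset.sum_mul]
  rw [Finset.sum_comm, ← (doubleConfig κ).symm.sum_comp]
  simp only [Equiv.apply_symm_apply, Fintype.sum_prod_type, mul_ite, mul_one, mul_zero,
    Finset.sum_ite_eq, Finset.mem_univ, if_true]

/-- For a region of the first copy, summing over the second copy reassembles ρ from its two square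
roots. -/
theorem averageOutside_purification (hρ : ρ.PosSemidef) (A : Finset V) :
    averageOutside (A.map Function.Embedding.inl)
      (Matrix.vecMulVec (purification ρ) (star (purification ρ)))
      = firstCopy (averageOutside A ρ) := by
  ext x y
  have hpw : ∀ x z : ∀ v, Sum.elim κ κ v, doubleConfig κ ((A.map Function.Embedding.inl).piecewise
      x z) = (A.piecewise (doubleConfig κ x).1 (doubleConfig κ z).1, (doubleConfig κ z).2) := by
    intro x z
    refine Prod.ext (funext fun v => ?_) (funext fun v => ?_)
    · by_cases h : v ∈ A <;> simp [doubleConfig_fst, Finset.piecewise, h] <;> rfl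
    · simp [doubleConfig_snd, Finset.piecewise]
      rfl
  have hcond : (∀ v, v ∉ A.map Function.Embedding.inl → x v = y v) ↔
      (∀ v, v ∉ A → (doubleConfig κ x).1 v = (doubleConfig κ y).1 v) ∧
        (doubleConfig κ x).2 = (doubleConfig κ y).2 := by
    simp [doubleConfig_fst, doubleConfig_snd, funext_iff]
  simp only [averageOutside, Matrix.of_apply, firstCopy_apply, hcond, Matrix.vecMulVec_apply,
    Pi.star_apply, purification, hpw]
  by_cases h1 : ∀ v, v ∉ A → (doubleConfig κ x).1 v = (doubleConfig κ y).1 v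
  · by_cases h2 : (doubleConfig κ x).2 = (doubleConfig κ y).2
    · rw [if_pos ⟨h1, h2⟩, if_pos h1, if_pos h2, mul_one, ← (doubleConfig κ).symm.sum_comp]
      simp only [Equiv.apply_symm_apply, Fintype.sum_prod_type, sum_purification hρ]
    · rw [if_neg fun h => h2 h.2, if_neg h2, mul_zero]
  · rw [if_neg fun h => h1 h.1, if_neg h1, zero_mul]

theorem regionDim_map_inl (A : Finset V) :
    regionDim (Sum.elim κ κ) (A.map Function.Embedding.inl) = regionDim κ A := by
  rw [regionDim, Finset.prod_map]
  rfl

theorem marginal_purification [Nonempty (∀ v, κ v)] (hρ : ρ.PosSemidef) (A : Finset V) :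
    marginal (A.map Function.Embedding.inl)
      (Matrix.vecMulVec (purification ρ) (star (purification ρ))) = firstCopy (marginal A ρ) := by
  have hA : (regionDim κ A : ℂ) ≠ 0 := Nat.cast_ne_zero.2 (regionDim_pos A).ne'
  apply smul_right_injective _ hA
  simp only
  rw [← map_smul, regionDim_smul_marginal, ← averageOutside_purification hρ,
    ← regionDim_smul_marginal, regionDim_map_inl]

theorem entropy_purification [Nonempty (∀ v, κ v)] (hρ : ρ.PosSemidef) (A : Finset V) :
    entropy (Matrix.vecMulVec (purification ρ) (star (purification ρ)))
      (A.map Function.Embedding.inl) = entropy ρ A := by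
  rw [entropy_eq_trace_mul_log (Matrix.posSemidef_vecMulVec_self_star _), marginal_purification hρ,
    ← firstCopy_cfc (marginal_posSemidef hρ A).isHermitian, trace_purification_mul_firstCopy hρ,
    entropy_eq_trace_mul_log hρ]

/-- Weak monotonicity of the entropy. -/
theorem weakMonotonicity [Nonempty (∀ v, κ v)] (hρ : ρ.PosSemidef) {C D E : Finset V}
    (hDC : Disjoint D C) (hDE : Disjoint D E) (hCE : Disjoint C E) :
    entropy ρ D + entropy ρ E ≤ entropy ρ (D ∪ C) + entropy ρ (C ∪ E) := by
  set ρ' := Matrix.vecMulVec (purification ρ) (star (purification ρ)) with hρ'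
  have hne : Nonempty (∀ v, Sum.elim κ κ v) :=
    let ⟨z⟩ := ‹Nonempty (∀ v, κ v)›
    ⟨(doubleConfig κ).symm (z, z)⟩
  set ι : V ↪ V ⊕ V := Function.Embedding.inl
  have hps : ρ'.PosSemidef := Matrix.posSemidef_vecMulVec_self_star _
  have dDC : Disjoint (D.map ι) (C.map ι) := (Finset.disjoint_map ι).2 hDC
  have dDE : Disjoint (D.map ι) (E.map ι) := (Finset.disjoint_map ι).2 hDE
  have dCE : Disjoint (C.map ι) (E.map ι) := (Finset.disjoint_map ι).2 hCE
  -- R purifies DCE, so S(CER) = S(D) and S(ER) = S(DC); strong subadditivity S(E) + S(CER) ≤ S(CE)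
  -- + S(ER) is then the claim.
  set R := (D.map ι ∪ C.map ι ∪ E.map ι)ᶜ with hR
  have dR : ∀ X, X ⊆ D.map ι ∪ C.map ι ∪ E.map ι → Disjoint X R := fun X hX =>
    disjoint_compl_right.mono_left hX
  have h := strongSubadditivity hps dCE
    (dR _ (Finset.subset_union_right.trans Finset.subset_union_left))
    (dR _ Finset.subset_union_right)
  have e1 : C.map ι ∪ E.map ι ∪ R = (D.map ι)ᶜ := by
    ext v
    have h1 : v ∈ D.map ι → v ∉ C.map ι := fun h h' => Finset.disjoint_left.1 dDC h h'
    have h2 : v ∈ D.map ι → v ∉ E.map ι := fun h h' => Finset.disjoint_left.1 dDE h h'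
    simp only [hR, Finset.mem_union, Finset.mem_compl]
    tauto
  have e2 : E.map ι ∪ R = (D.map ι ∪ C.map ι)ᶜ := by
    ext v
    have h1 : v ∈ C.map ι → v ∉ E.map ι := fun h h' => Finset.disjoint_left.1 dCE h h'
    have h2 : v ∈ D.map ι → v ∉ E.map ι := fun h h' => Finset.disjoint_left.1 dDE h h'
    simp only [hR, Finset.mem_union, Finset.mem_compl]
    tauto
  rw [e1, e2, hρ', entropy_compl_of_pure, entropy_compl_of_pure, ← Finset.map_union,
    ← Finset.map_union, entropy_purification hρ, entropy_purification hρ, entropy_purification hρ,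
    entropy_purification hρ] at h
  linarith

/-- If `S(BC) + S(CD) = S(B) + S(D)`, then for every region `A` away from `B`, `C`, `D` the state
on `ABC` is a quantum Markov chain, in the form of the identity for entanglement Hamiltonians. -/
theorem entHam_markov [Nonempty (∀ v, κ v)] (hρ : ρ.PosSemidef) {A B C D : Finset V}
    (hAB : Disjoint A B) (hAC : Disjoint A C) (hAD : Disjoint A D) (hBC : Disjoint B C)
    (hBD : Disjoint B D) (hCD : Disjoint C D)
    (h : entropy ρ (B ∪ C) + entropy ρ (C ∪ D) - entropy ρ B - entropy ρ D = 0)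
    {ψ : (∀ v, κ v) → ℂ} (hψ : ψ ∈ regionSupport ρ (A ∪ B ∪ C)) :
    entHam ρ (A ∪ B ∪ C) *ᵥ ψ + entHam ρ B *ᵥ ψ
      = entHam ρ (A ∪ B) *ᵥ ψ + entHam ρ (B ∪ C) *ᵥ ψ := by
  obtain ⟨h1, h2⟩ := strongSubadditivity_aux hρ hAB hAC hBC
  have h3 := weakMonotonicity hρ (C := C) (D := D) (E := A ∪ B) hCD.symm
    (Finset.disjoint_union_right.2 ⟨hAD.symm, hBD.symm⟩)
    (Finset.disjoint_union_right.2 ⟨hAC.symm, hBC.symm⟩)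
  rw [Finset.union_comm D C, Finset.union_comm C (A ∪ B)] at h3
  -- A1 and the weak monotonicity `h3` give the reverse of the inequality `h1`, so equality holds.
  have h4 := h2 (by linarith)
  obtain ⟨φ, rfl⟩ := hψ
  have h5 := congrArg (· *ᵥ φ) h4
  simp only [← Matrix.mulVec_mulVec, Matrix.zero_mulVec, Matrix.sub_mulVec, Matrix.add_mulVec] at h5
  rw [Matrix.mulVecLin_apply, ← marginal.eq_def]
  rw [sub_sub, sub_eq_zero] at h5
  rw [h5, add_comm]

end Purification

/-! ### Cyclic orders and intervals of a cycle. -/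

section Graphs
variable {V : Type*} {G : SimpleGraph V}

/-- A connected set of vertices is contained in every set that is closed under adjacency. -/
theorem subset_of_induce_connected {S K : Set V} (hS : (G.induce S).Connected) {u : V} (huS : u ∈ S)
    (huK : u ∈ K) (hK : ∀ a ∈ K, a ∈ S → ∀ b ∈ S, G.Adj a b → b ∈ K) : S ⊆ K := by
  intro w hw
  have h := hS.preconnected ⟨u, huS⟩ ⟨w, hw⟩
  rw [SimpleGraph.reachable_iff_reflTransGen] at h
  suffices ∀ x : S, Relation.ReflTransGen (G.induce S).Adj ⟨u, huS⟩ x → (x : V) ∈ K from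
    this _ h
  intro x hx
  induction hx with
  | refl => exact huK
  | @tail b c _ hbc ih => exact hK b ih b.2 c c.2 hbc

theorem induce_insert_connected {S : Set V} (hS : (G.induce S).Connected) {a b : V} (hb : b ∈ S)
    (hab : G.Adj a b) : (G.induce (insert a S)).Connected := by
  have h : insert a S = {a, b} ∪ S := by
    ext w
    simp only [Set.mem_insert_iff, Set.mem_union, Set.mem_singleton_iff]
    constructor
    · rintro (h | h)
      · exact Or.inl (Or.inl h)
      · exact Or.inr h
    · rintro ((h | rfl) | h)
      · exact Or.inl h
      · exact Or.inr hb
      · exact Or.inr h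
  rw [h]
  exact SimpleGraph.induce_union_connected (SimpleGraph.induce_pair_connected_of_adj hab).preconnected
    hS.preconnected ⟨b, by simp, hb⟩

theorem induce_singleton_connected (a : V) : (G.induce {a}).Connected := by
  have : Nonempty ({a} : Set V) := ⟨⟨a, rfl⟩⟩
  exact SimpleGraph.Connected.mk (fun x y => by
    obtain rfl : x = y := Subsingleton.elim _ _
    exact SimpleGraph.Reachable.refl _)

/-- `c` enumerates the vertices of the cycle `S` of `G` in cyclic order. -/
structure IsCyclicOrder (G : SimpleGraph V) (S : Finset V) (c : ℕ → V) : Prop where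
  three_le : 3 ≤ S.card
  mem_iff : ∀ u, u ∈ S ↔ ∃ i, c i = u
  eq_iff : ∀ i j, c i = c j ↔ i ≡ j [MOD S.card]
  adj_iff : ∀ i w, G.Adj (c (i + 1)) w ↔ w = c i ∨ w = c (i + 2)

/-- A connected graph with all degrees two is traversed by a single cycle. Its vertices are read
modulo the length, so that indices can be shifted freely. -/
theorem exists_isCyclicOrder [Finite V] [DecidableEq V] {S : Finset V}
    (hS : (G.induce (S : Set V)).Connected) (hmem : ∀ u w, G.Adj u w → u ∈ S)
    (htwo : ∀ u ∈ S, (G.neighborSet u).ncard = 2) : ∃ c, IsCyclicOrder G S c := by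
  have hcyc : G.IsCycles := by
    rintro u ⟨w, hw⟩
    exact htwo u (hmem u w hw)
  obtain ⟨⟨v, hv⟩⟩ := hS.nonempty
  have hne : (G.neighborSet v).Nonempty := by
    refine Set.nonempty_of_ncard_ne_zero ?_
    rw [htwo v hv]; norm_num
  obtain ⟨p, hp, hverts⟩ := hcyc.exists_cycle_toSubgraph_verts_eq_connectedComponentSupp
    (c := G.connectedComponentMk v) rfl hne
  set d := p.length with hd
  have hd3 : 3 ≤ d := hp.three_le_length
  have hsupp : ∀ u, u ∈ S ↔ u ∈ p.support := by
    intro u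
    rw [← SimpleGraph.Walk.mem_verts_toSubgraph, hverts, SimpleGraph.ConnectedComponent.mem_supp_iff,
      SimpleGraph.ConnectedComponent.eq]
    constructor
    · intro hu
      have h1 := hS.preconnected ⟨u, hu⟩ ⟨v, hv⟩
      exact h1.map (SimpleGraph.Embedding.induce (S : Set V)).toHom
    · intro hu
      rw [SimpleGraph.reachable_comm, SimpleGraph.reachable_iff_reflTransGen] at hu
      induction hu with
      | refl => exact hv
      | tail _ hbc _ => exact hmem _ _ hbc.symm
  set c : ℕ → V := fun i => p.getVert (i % d) with hc
  have hmod : ∀ i, i % d < d := fun i => Nat.mod_lt _ (by omega)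
  have hinj : ∀ i j, i < d → j < d → p.getVert i = p.getVert j → i = j := fun i j hi hj h =>
    hp.getVert_injOn' (by simp only [Set.mem_ofPred_eq]; omega)
      (by simp only [Set.mem_ofPred_eq]; omega) h
  have hmemc : ∀ u, u ∈ S ↔ ∃ i < d, p.getVert i = u := by
    intro u
    rw [hsupp, SimpleGraph.Walk.mem_support_iff_exists_getVert]
    constructor
    · rintro ⟨n, hn, hnd⟩
      rcases hnd.lt_or_eq with h | h
      · exact ⟨n, h, hn⟩
      · refine ⟨0, by omega, ?_⟩
        rw [← hn, h, SimpleGraph.Walk.getVert_length, SimpleGraph.Walk.getVert_zero]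
    · rintro ⟨n, hn, h⟩
      exact ⟨n, h, hn.le⟩
  have hcard : S.card = d := by
    have h1 : S = (Finset.range d).image p.getVert := by
      ext u
      simp only [hmemc, Finset.mem_image, Finset.mem_range]
    rw [h1, Finset.card_image_of_injOn, Finset.card_range]
    intro i hi j hj h
    exact hinj i j (Finset.mem_range.1 hi) (Finset.mem_range.1 hj) h
  have heq : ∀ i j, c i = c j ↔ i ≡ j [MOD S.card] := by
    intro i j
    rw [hcard]
    constructor
    · exact fun h => hinj _ _ (hmod i) (hmod j) h
    · intro h
      simp only [hc]
      rw [show i % d = j % d from h]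
  have hstep : ∀ i, G.Adj (c i) (c (i + 1)) := by
    intro i
    have h := p.adj_getVert_succ (hmod i)
    simp only [hc]
    by_cases h1 : i % d + 1 < d
    · rwa [show (i + 1) % d = i % d + 1 by
        rw [Nat.add_mod, Nat.mod_eq_of_lt (show 1 < d by omega), Nat.mod_eq_of_lt h1]]
    · have h2 : i % d + 1 = d := by have := hmod i; omega
      rw [show (i + 1) % d = 0 by
        rw [Nat.add_mod, Nat.mod_eq_of_lt (show 1 < d by omega), h2, Nat.mod_self]]
      rw [h2] at h
      rw [SimpleGraph.Walk.getVert_length] at h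
      rwa [SimpleGraph.Walk.getVert_zero]
  refine ⟨c, by omega, fun u => ?_, heq, fun i w => ?_⟩
  · rw [hmemc]
    constructor
    · rintro ⟨i, hi, rfl⟩
      exact ⟨i, by simp only [hc, Nat.mod_eq_of_lt hi]⟩
    · rintro ⟨i, rfl⟩
      exact ⟨i % d, hmod i, rfl⟩
  -- As the length is at least three, these are distinct and exhaust the two neighbours of c (i +
  -- 1).
  · have hne2 : c i ≠ c (i + 2) := by
      rw [Ne, heq, hcard]
      intro h
      have := (Nat.modEq_iff_dvd' (by omega)).1 h
      rw [show i + 2 - i = 2 by omega] at this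
      have := Nat.le_of_dvd (by norm_num) this
      omega
    have hsub : ({c i, c (i + 2)} : Set V) ⊆ G.neighborSet (c (i + 1)) := by
      rintro x (rfl | rfl)
      · exact (hstep i).symm
      · exact hstep (i + 1)
    have h2 := htwo (c (i + 1)) (hmem _ _ (hstep (i + 1)))
    have h3 := Set.eq_of_subset_of_ncard_le hsub (by rw [h2, Set.ncard_pair hne2])
      (Set.finite_of_ncard_ne_zero (by rw [h2]; norm_num))
    rw [← SimpleGraph.mem_neighborSet, ← h3]
    rfl

namespace IsCyclicOrder
variable [DecidableEq V] {S : Finset V} {c : ℕ → V} (h : IsCyclicOrder G S c)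
include h

theorem mem (i : ℕ) : c i ∈ S := (h.mem_iff _).2 ⟨i, rfl⟩

theorem periodic (i : ℕ) : c (i + S.card) = c i := (h.eq_iff _ _).2 (by simp [Nat.ModEq])

theorem exists_lt {u : V} (hu : u ∈ S) : ∃ i < S.card, c i = u := by
  obtain ⟨i, rfl⟩ := (h.mem_iff u).1 hu
  have := h.three_le
  exact ⟨i % S.card, Nat.mod_lt _ (by omega), (h.eq_iff _ _).2 (Nat.mod_modEq _ _)⟩

theorem inj {i j k : ℕ} (hj : j < S.card) (hk : k < S.card) (he : c (i + j) = c (i + k)) :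
    j = k := by
  have h1 := Nat.ModEq.add_left_cancel' i ((h.eq_iff _ _).1 he)
  rwa [Nat.ModEq, Nat.mod_eq_of_lt hj, Nat.mod_eq_of_lt hk] at h1

theorem adj_succ (i : ℕ) : G.Adj (c i) (c (i + 1)) := ((h.adj_iff i (c i)).2 (Or.inl rfl)).symm

theorem exists_add {u : V} (hu : u ∈ S) (i : ℕ) : ∃ j < S.card, c (i + j) = u := by
  obtain ⟨k, rfl⟩ := (h.mem_iff u).1 hu
  have h3 := h.three_le
  -- This is k - i modulo the length, with (S.card - 1) * i in the role of -i.
  refine ⟨(k + (S.card - 1) * i) % S.card, Nat.mod_lt _ (by omega), (h.eq_iff _ _).2 ?_⟩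
  calc i + (k + (S.card - 1) * i) % S.card ≡ i + (k + (S.card - 1) * i) [MOD S.card] :=
        (Nat.mod_modEq _ _).add_left i
    _ = k + S.card * i := by
        obtain ⟨m, hm⟩ : ∃ m, S.card = m + 1 := ⟨S.card - 1, by omega⟩
        rw [hm, Nat.add_sub_cancel]; ring
    _ ≡ k [MOD S.card] := by simp [Nat.ModEq]

end IsCyclicOrder

/-- The `m` consecutive entries of `c` from `c i` on. -/
def cyclicInterval [DecidableEq V] (c : ℕ → V) (i m : ℕ) : Finset V :=
  (Finset.range m).image fun j => c (i + j)

theorem mem_cyclicInterval [DecidableEq V] {c : ℕ → V} {i m : ℕ} {u : V} :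
    u ∈ cyclicInterval c i m ↔ ∃ j < m, c (i + j) = u := by
  simp [cyclicInterval]

theorem cyclicInterval_one [DecidableEq V] (c : ℕ → V) (i : ℕ) : cyclicInterval c i 1 = {c i} := by
  simp [cyclicInterval]

theorem cyclicInterval_succ [DecidableEq V] (c : ℕ → V) (i m : ℕ) :
    cyclicInterval c i (m + 1) = insert (c (i + m)) (cyclicInterval c i m) := by
  rw [cyclicInterval, Finset.range_add_one, Finset.image_insert, cyclicInterval]

theorem cyclicInterval_succ' [DecidableEq V] (c : ℕ → V) (i m : ℕ) :
    cyclicInterval c i (m + 1) = insert (c i) (cyclicInterval c (i + 1) m) := by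
  ext u
  simp only [Finset.mem_insert, mem_cyclicInterval]
  constructor
  · rintro ⟨j, hj, rfl⟩
    rcases j with _ | j
    · exact Or.inl rfl
    · exact Or.inr ⟨j, by omega, by congr 1; omega⟩
  · rintro (rfl | ⟨j, hj, rfl⟩)
    · exact ⟨0, by omega, rfl⟩
    · exact ⟨j + 1, by omega, by congr 1; omega⟩

namespace IsCyclicOrder
variable [DecidableEq V] {S : Finset V} {c : ℕ → V} (h : IsCyclicOrder G S c)
include h

theorem cyclicInterval_subset (i m : ℕ) : cyclicInterval c i m ⊆ S := by
  intro u hu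
  obtain ⟨j, -, rfl⟩ := mem_cyclicInterval.1 hu
  exact h.mem _

theorem mem_cyclicInterval_iff {i j m : ℕ} (hj : j < S.card) (hm : m ≤ S.card) :
    c (i + j) ∈ cyclicInterval c i m ↔ j < m := by
  rw [mem_cyclicInterval]
  constructor
  · rintro ⟨k, hk, he⟩
    rwa [← h.inj (by omega) hj he]
  · exact fun hj => ⟨j, hj, rfl⟩

theorem card_cyclicInterval {i m : ℕ} (hm : m ≤ S.card) : (cyclicInterval c i m).card = m := by
  rw [cyclicInterval, Finset.card_image_of_injOn, Finset.card_range]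
  intro j hj k hk he
  simp only [Finset.coe_range, Set.mem_Iio] at hj hk
  exact h.inj (by omega) (by omega) he

theorem sdiff_cyclicInterval {i m : ℕ} (hm : m ≤ S.card) :
    S \ cyclicInterval c i m = cyclicInterval c (i + m) (S.card - m) := by
  ext u
  rw [Finset.mem_sdiff]
  constructor
  · rintro ⟨hu, hn⟩
    obtain ⟨j, hj, rfl⟩ := h.exists_add hu i
    rw [h.mem_cyclicInterval_iff hj hm] at hn
    exact mem_cyclicInterval.2 ⟨j - m, by omega, by congr 1; omega⟩
  · intro hu
    obtain ⟨j, hj, rfl⟩ := mem_cyclicInterval.1 hu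
    refine ⟨h.mem _, ?_⟩
    rw [add_assoc, h.mem_cyclicInterval_iff (by omega) hm]
    omega

theorem induce_cyclicInterval_connected (i m : ℕ) :
    (G.induce (cyclicInterval c i (m + 1) : Set V)).Connected := by
  induction m with
  | zero =>
    rw [cyclicInterval_one, Finset.coe_singleton]
    exact induce_singleton_connected _
  | succ m ih =>
    rw [cyclicInterval_succ, Finset.coe_insert]
    refine induce_insert_connected ih (b := c (i + m)) ?_ ?_
    · exact Finset.mem_coe.2 (mem_cyclicInterval.2 ⟨m, by omega, rfl⟩)
    · exact (h.adj_succ (i + m)).symm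

/-- A proper connected subset of a cycle is an interval. -/
theorem exists_eq_cyclicInterval {B : Finset V} (hBS : B ⊆ S)
    (hB : (G.induce (B : Set V)).Connected) (hne : B ≠ S) :
    ∃ i < S.card, ∃ m, 1 ≤ m ∧ m < S.card ∧ B = cyclicInterval c i m := by
  have h3 := h.three_le
  obtain ⟨⟨b, hb⟩⟩ := hB.nonempty
  rw [Finset.mem_coe] at hb
  obtain ⟨x, hxS, hxB⟩ : ∃ x ∈ S, x ∉ B := by
    by_contra! hcon
    exact hne (hBS.antisymm hcon)
  -- walk from `x` to the first element of `B`
  obtain ⟨k, hk⟩ := (h.mem_iff x).1 hxS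
  have hex : ∃ j, c (k + j) ∈ B := by
    obtain ⟨j, -, hj⟩ := h.exists_add (hBS hb) k
    exact ⟨j, hj ▸ hb⟩
  classical
  set j₀ := Nat.find hex with hj₀
  have hj₀B : c (k + j₀) ∈ B := Nat.find_spec hex
  have hj₀pos : 0 < j₀ := by
    rcases Nat.eq_zero_or_pos j₀ with h0 | h0
    · rw [h0, add_zero, hk] at hj₀B; exact absurd hj₀B hxB
    · exact h0
  have hpred : c (k + j₀ - 1) ∉ B := by
    have := Nat.find_min hex (m := j₀ - 1) (by omega)
    rwa [← Nat.add_sub_assoc (by omega)] at this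
  have hex2 : ∃ m, c (k + j₀ + m) ∉ B := by
    obtain ⟨j, -, hj⟩ := h.exists_add hxS (k + j₀)
    exact ⟨j, hj ▸ hxB⟩
  set m := Nat.find hex2 with hm
  have hmB : c (k + j₀ + m) ∉ B := Nat.find_spec hex2
  have hlt : ∀ j < m, c (k + j₀ + j) ∈ B := fun j hj => not_not.1 (Nat.find_min hex2 hj)
  have hm1 : 1 ≤ m := by
    rcases Nat.eq_zero_or_pos m with h0 | h0
    · rw [h0, add_zero] at hmB; exact absurd hj₀B hmB
    · exact h0
  -- A longer run inside B would reach the predecessor of its start, which lies outside B.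
  have hmS : m < S.card := by
    by_contra hcon
    have h1 := hlt (S.card - 1) (by omega)
    have h2 : c (k + j₀ + (S.card - 1)) = c (k + j₀ - 1) := by
      rw [← h.periodic (k + j₀ - 1)]; congr 1; omega
    rw [h2] at h1
    exact hpred h1
  -- The run is closed under adjacency within B, since both exits, c (k + j₀ - 1) and c (k + j₀ +
  -- m), lie outside B; connectedness of B leaves nothing else.
  have hBeq : B = cyclicInterval c (k + j₀) m := by
    apply Finset.Subset.antisymm
    · have := subset_of_induce_connected (K := (cyclicInterval c (k + j₀) m : Set V)) hB
        (Finset.mem_coe.2 hj₀B) (Finset.mem_coe.2 (mem_cyclicInterval.2 ⟨0, by omega, rfl⟩)) ?_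
      · exact_mod_cast this
      · intro a ha _ w hw haw
        rw [Finset.mem_coe] at *
        obtain ⟨j, hj, rfl⟩ := mem_cyclicInterval.1 ha
        have h4 := (h.adj_iff (k + j₀ + j - 1) w).1
          (by rwa [show k + j₀ + j - 1 + 1 = k + j₀ + j by omega])
        rcases h4 with rfl | rfl
        · rcases Nat.eq_zero_or_pos j with rfl | hjp
          · exact absurd hw hpred
          · exact mem_cyclicInterval.2 ⟨j - 1, by omega, by congr 1; omega⟩
        · rcases Nat.lt_or_ge (j + 1) m with h5 | h5
          · exact mem_cyclicInterval.2 ⟨j + 1, h5, by congr 1; omega⟩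
          · refine absurd ?_ hmB
            rwa [show k + j₀ + m = k + j₀ + j - 1 + 2 by omega]
    · intro u hu
      obtain ⟨j, hj, rfl⟩ := mem_cyclicInterval.1 hu
      exact hlt j hj
  refine ⟨(k + j₀) % S.card, Nat.mod_lt _ (by omega), m, hm1, hmS, ?_⟩
  rw [hBeq]
  unfold cyclicInterval
  refine Finset.image_congr fun j _ => ?_
  exact (h.eq_iff _ _).2 ((Nat.mod_modEq _ _).symm.add_right j)

/-- The start of a proper interval is its only member whose predecessor is missing; the predecessor
of c i is written c (i + (S.card - 1)). -/
theorem cyclicInterval_injOn {i i' m m' : ℕ} (hi : i < S.card) (hi' : i' < S.card) (hm1 : 1 ≤ m)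
    (hm : m < S.card) (hm' : m' < S.card)
    (he : cyclicInterval c i m = cyclicInterval c i' m') : i = i' ∧ m = m' := by
  have hmm : m = m' := by
    have := congrArg Finset.card he
    rwa [h.card_cyclicInterval hm.le, h.card_cyclicInterval hm'.le] at this
  subst hmm
  refine ⟨?_, rfl⟩
  have h1 : c i ∈ cyclicInterval c i' m := he ▸ mem_cyclicInterval.2 ⟨0, by omega, rfl⟩
  obtain ⟨j, hj, hji⟩ := mem_cyclicInterval.1 h1
  rcases Nat.eq_zero_or_pos j with rfl | hjp
  · have := (h.eq_iff _ _).1 hji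
    rw [Nat.ModEq, Nat.mod_eq_of_lt hi, add_zero, Nat.mod_eq_of_lt hi'] at this
    exact this.symm
  · exfalso
    have h2 : c (i + (S.card - 1)) ∉ cyclicInterval c i m := by
      rw [h.mem_cyclicInterval_iff (by omega) hm.le]; omega
    apply h2
    rw [he]
    refine mem_cyclicInterval.2 ⟨j - 1, by omega, ?_⟩
    have h3 := ((h.eq_iff _ _).1 hji).add_right (S.card - 1)
    rw [h.eq_iff]
    refine Nat.ModEq.trans ?_ h3
    rw [show i' + j + (S.card - 1) = i' + (j - 1) + S.card by omega]
    simp [Nat.ModEq]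

end IsCyclicOrder

end Graphs

/-! ### Links, boundary edges and arcs of a triangulated surface. -/

namespace TriangulatedSurface
variable {V : Type*} [Fintype V] [DecidableEq V] (T : TriangulatedSurface V)

theorem mem_nbrs {u v : V} : u ∈ T.nbrs v ↔ T.Adj u v := by simp [nbrs]

variable {T}

theorem Adj.symm {u v : V} (h : T.Adj u v) : T.Adj v u :=
  ⟨h.1.symm, let ⟨f, hf, h1, h2⟩ := h.2; ⟨f, hf, h2, h1⟩⟩

theorem ne_of_mem_faces {a b c : V} (h : ({a, b, c} : Finset V) ∈ T.faces) : a ≠ b ∧ a ≠ c ∧ b ≠ c := by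
  have h3 := T.card_face _ h
  refine ⟨?_, ?_, ?_⟩
  · rintro rfl
    rw [Finset.insert_eq_of_mem (by simp)] at h3
    exact absurd (Finset.card_le_two (a := a) (b := c)) (by omega)
  · rintro rfl
    rw [Finset.insert_eq_of_mem (by simp)] at h3
    exact absurd (Finset.card_le_two (a := b) (b := a)) (by omega)
  · rintro rfl
    rw [Finset.pair_eq_singleton] at h3
    exact absurd (Finset.card_le_two (a := a) (b := b)) (by omega)

theorem linkAdj_iff {v a b : V} : (linkGraph T.faces v).Adj a b ↔ ({v, a, b} : Finset V) ∈ T.faces :=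
  ⟨fun h => h.2, fun h => ⟨(ne_of_mem_faces h).2.2, h⟩⟩

theorem linkAdj_rotate {v a b : V} (h : (linkGraph T.faces v).Adj a b) :
    (linkGraph T.faces a).Adj b v := by
  rw [linkAdj_iff] at h ⊢
  convert h using 1
  ext x; simp only [Finset.mem_insert, Finset.mem_singleton]; tauto

theorem adj_of_linkAdj {v a b : V} (h : (linkGraph T.faces v).Adj a b) : T.Adj a v := by
  rw [linkAdj_iff] at h
  exact ⟨(ne_of_mem_faces h).1.symm, _, h, by simp, by simp⟩

theorem adj_of_linkAdj' {v a b : V} (h : (linkGraph T.faces v).Adj a b) : T.Adj a b :=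
  (adj_of_linkAdj (linkAdj_rotate h)).symm

theorem exists_eq_of_mem_face {f : Finset V} (hf : f ∈ T.faces) {u v : V} (huv : u ≠ v) (hv : v ∈ f)
    (hu : u ∈ f) : ∃ w, f = {v, u, w} := by
  have h3 := T.card_face f hf
  have h1 : ((f.erase v).erase u).card = 1 := by
    rw [Finset.card_erase_of_mem (Finset.mem_erase.2 ⟨huv, hu⟩), Finset.card_erase_of_mem hv, h3]
  obtain ⟨w, hw⟩ := Finset.card_eq_one.1 h1
  refine ⟨w, ?_⟩
  rw [← hw, Finset.insert_erase (Finset.mem_erase.2 ⟨huv, hu⟩), Finset.insert_erase hv]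

theorem exists_linkAdj {u v : V} (h : T.Adj u v) : ∃ w, (linkGraph T.faces v).Adj u w := by
  obtain ⟨hne, f, hf, hv, hu⟩ := h
  obtain ⟨w, rfl⟩ := exists_eq_of_mem_face hf hne hv hu
  exact ⟨w, linkAdj_iff.2 hf⟩

theorem mem_nbrs_of_linkAdj {v a b : V} (h : (linkGraph T.faces v).Adj a b) : a ∈ T.nbrs v :=
  T.mem_nbrs.2 (adj_of_linkAdj h)

variable (T)

theorem induce_nbrs_connected (v : V) :
    ((linkGraph T.faces v).induce (T.nbrs v : Set V)).Connected := by
  have h := T.link_connected v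
  have : (T.nbrs v : Set V) = {u | u ≠ v ∧ ∃ f ∈ T.faces, v ∈ f ∧ u ∈ f} := by
    ext u
    rw [Finset.mem_coe, mem_nbrs]
    rfl
  rwa [this]

/-- A triangle on the edge uv is determined by its third vertex, a neighbour of u in the link of v.
Incidence of edges and triangles thus becomes a degree in a link. -/
theorem card_filter_faces {u v : V} (huv : u ≠ v) :
    (T.faces.filter fun f => {u, v} ⊆ f).card = ((linkGraph T.faces v).neighborSet u).ncard := by
  classical
  rw [← Set.ncard_coe_finset]
  symm
  refine Set.ncard_congr (fun w _ => ({v, u, w} : Finset V)) ?_ ?_ ?_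
  · intro w hw
    rw [SimpleGraph.mem_neighborSet, linkAdj_iff] at hw
    simp only [Finset.coe_filter, Set.mem_ofPred_eq, hw, true_and, Finset.insert_subset_iff,
      Finset.singleton_subset_iff]
    simp
  · intro w w' hw hw' he
    rw [SimpleGraph.mem_neighborSet, linkAdj_iff] at hw hw'
    have h1 := ne_of_mem_faces hw
    have h2 : w ∈ ({v, u, w'} : Finset V) := he ▸ (by simp)
    simp only [Finset.mem_insert, Finset.mem_singleton] at h2
    rcases h2 with h2 | h2 | h2
    · exact absurd h2.symm h1.2.1
    · exact absurd h2.symm h1.2.2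
    · exact h2
  · intro f hf
    simp only [Finset.coe_filter, Set.mem_ofPred_eq, Finset.insert_subset_iff,
      Finset.singleton_subset_iff] at hf
    obtain ⟨w, rfl⟩ := exists_eq_of_mem_face hf.1 huv hf.2.2 hf.2.1
    exact ⟨w, linkAdj_iff.2 hf.1, rfl⟩

theorem mem_edges {e : Finset V} : e ∈ T.edges ↔ ∃ u v, T.Adj u v ∧ e = {u, v} := by
  simp only [edges, Finset.mem_biUnion, Finset.mem_powersetCard]
  constructor
  · rintro ⟨f, hf, hef, he⟩
    obtain ⟨u, v, huv, rfl⟩ := Finset.card_eq_two.1 he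
    exact ⟨u, v, ⟨huv, f, hf, hef (by simp), hef (by simp)⟩, rfl⟩
  · rintro ⟨u, v, ⟨huv, f, hf, hv, hu⟩, rfl⟩
    refine ⟨f, hf, ?_, Finset.card_pair huv⟩
    intro x hx
    rcases Finset.mem_insert.1 hx with rfl | hx
    · exact hu
    · rw [Finset.mem_singleton.1 hx]; exact hv

theorem mem_boundaryEdges {u v : V} : {u, v} ∈ T.boundaryEdges ↔
    T.Adj u v ∧ ((linkGraph T.faces v).neighborSet u).ncard = 1 := by
  rw [boundaryEdges, Finset.mem_filter]
  constructor
  · rintro ⟨he, hc⟩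
    obtain ⟨a, b, hab, he'⟩ := T.mem_edges.1 he
    have huv : u ≠ v := by
      rintro rfl
      have := congrArg Finset.card he'
      rw [Finset.card_pair hab.1, Finset.pair_eq_singleton, Finset.card_singleton] at this
      omega
    refine ⟨?_, by rwa [T.card_filter_faces huv] at hc⟩
    obtain ⟨f, hf⟩ := Finset.card_eq_one.1 hc
    have hf' : f ∈ T.faces.filter fun f => {u, v} ⊆ f := by rw [hf]; simp
    rw [Finset.mem_filter] at hf'
    exact ⟨huv, f, hf'.1, hf'.2 (by simp), hf'.2 (by simp)⟩
  · rintro ⟨h, hc⟩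
    exact ⟨T.mem_edges.2 ⟨u, v, h, rfl⟩, by rwa [T.card_filter_faces h.1]⟩

theorem ncard_neighborSet {u v : V} (h : T.Adj u v) :
    ((linkGraph T.faces v).neighborSet u).ncard = 1 ∨
      ((linkGraph T.faces v).neighborSet u).ncard = 2 := by
  have h1 := T.card_faces_le_two u v h.1
  rw [T.card_filter_faces h.1] at h1
  obtain ⟨w, hw⟩ := exists_linkAdj h
  have h2 : 0 < ((linkGraph T.faces v).neighborSet u).ncard :=
    (Set.ncard_pos (Set.toFinite _)).2 ⟨w, hw⟩
  omega

theorem mem_boundaryVerts {v : V} : v ∈ T.boundaryVerts ↔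
    ∃ u, T.Adj u v ∧ ((linkGraph T.faces v).neighborSet u).ncard = 1 := by
  simp only [boundaryVerts, Finset.mem_filter, Finset.mem_univ, true_and]
  constructor
  · rintro ⟨e, he, hv⟩
    obtain ⟨a, b, hab, rfl⟩ := T.mem_edges.1 (Finset.mem_filter.1 he).1
    rcases Finset.mem_insert.1 hv with rfl | hv
    · rw [Finset.pair_comm] at he
      exact ⟨b, T.mem_boundaryEdges.1 he⟩
    · obtain rfl := Finset.mem_singleton.1 hv
      exact ⟨a, T.mem_boundaryEdges.1 he⟩
  · rintro ⟨u, hu⟩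
    exact ⟨{u, v}, T.mem_boundaryEdges.2 hu, by simp⟩

theorem mem_interiorVerts {v : V} : v ∈ T.interiorVerts ↔ v ∉ T.boundaryVerts := by
  simp [interiorVerts]

theorem mem_boundaryVerts_of_ncard {u v : V} (h : T.Adj u v)
    (hc : ((linkGraph T.faces v).neighborSet u).ncard = 1) :
    u ∈ T.boundaryVerts ∧ v ∈ T.boundaryVerts := by
  refine ⟨?_, T.mem_boundaryVerts.2 ⟨u, h, hc⟩⟩
  have h1 := T.mem_boundaryEdges.2 ⟨h, hc⟩
  rw [Finset.pair_comm] at h1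
  exact T.mem_boundaryVerts.2 ⟨v, T.mem_boundaryEdges.1 h1⟩

theorem ncard_of_interior {u v : V} (hv : v ∈ T.interiorVerts) (h : T.Adj u v) :
    ((linkGraph T.faces v).neighborSet u).ncard = 2 :=
  (T.ncard_neighborSet h).resolve_left fun h1 =>
    T.mem_interiorVerts.1 hv (T.mem_boundaryVerts_of_ncard h h1).2

/-- The link of an interior vertex is a cycle. -/
theorem exists_cyclicOrder {v : V} (hv : v ∈ T.interiorVerts) :
    ∃ c, IsCyclicOrder (linkGraph T.faces v) (T.nbrs v) c :=
  exists_isCyclicOrder (T.induce_nbrs_connected v) (fun _ _ h => mem_nbrs_of_linkAdj h)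
    fun _ hu => T.ncard_of_interior hv (T.mem_nbrs.1 hu)

theorem mem_arcs {v : V} {B : Finset V} : B ∈ T.arcs v ↔ B ⊆ T.nbrs v ∧
    ((linkGraph T.faces v).induce (B : Set V)).Connected ∧
      ((linkGraph T.faces v).induce ((T.nbrs v \ B : Finset V) : Set V)).Connected := by
  simp [arcs]

theorem subset_of_mem_arcs {v : V} {B : Finset V} (hB : B ∈ T.arcs v) : B ⊆ T.nbrs v :=
  (T.mem_arcs.1 hB).1

/-- The arcs of the link of an interior vertex are the proper intervals of the cycle. -/
theorem mem_arcs_iff_of_cyclicOrder {v : V} {c : ℕ → V}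
    (hc : IsCyclicOrder (linkGraph T.faces v) (T.nbrs v) c) {B : Finset V} :
    B ∈ T.arcs v ↔ ∃ i < T.deg v, ∃ m, 1 ≤ m ∧ m < T.deg v ∧ B = cyclicInterval c i m := by
  rw [mem_arcs]
  constructor
  · rintro ⟨hsub, h1, h2⟩
    refine hc.exists_eq_cyclicInterval hsub h1 ?_
    rintro rfl
    obtain ⟨⟨x, hx⟩⟩ := h2.nonempty
    simp at hx
  · rintro ⟨i, -, m, hm1, hm, rfl⟩
    refine ⟨hc.cyclicInterval_subset i m, ?_, ?_⟩
    · obtain ⟨k, rfl⟩ : ∃ k, m = k + 1 := ⟨m - 1, by omega⟩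
      exact hc.induce_cyclicInterval_connected i k
    · rw [hc.sdiff_cyclicInterval hm.le]
      obtain ⟨k, hk⟩ : ∃ k, (T.nbrs v).card - m = k + 1 := ⟨(T.nbrs v).card - m - 1, by
        have : m < (T.nbrs v).card := hm
        omega⟩
      rw [hk]
      exact hc.induce_cyclicInterval_connected _ k

theorem cyclicInterval_mem_arcs {v : V} {c : ℕ → V}
    (hc : IsCyclicOrder (linkGraph T.faces v) (T.nbrs v) c) (i : ℕ) {m : ℕ} (hm1 : 1 ≤ m)
    (hm : m < T.deg v) : cyclicInterval c i m ∈ T.arcs v := by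
  have h3 := hc.three_le
  refine (T.mem_arcs_iff_of_cyclicOrder hc).2 ⟨i % T.deg v, Nat.mod_lt _ (by omega), m, hm1, hm, ?_⟩
  unfold cyclicInterval
  exact Finset.image_congr fun j _ => (hc.eq_iff _ _).2 ((Nat.mod_modEq _ _).symm.add_right j)

theorem singleton_mem_arcs {v u : V} (hv : v ∈ T.interiorVerts) (hu : u ∈ T.nbrs v) :
    {u} ∈ T.arcs v := by
  obtain ⟨c, hc⟩ := T.exists_cyclicOrder hv
  obtain ⟨i, rfl⟩ := (hc.mem_iff u).1 hu
  rw [← cyclicInterval_one]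
  have h3 : 3 ≤ T.deg v := hc.three_le
  exact T.cyclicInterval_mem_arcs hc i le_rfl (by omega)

theorem pair_mem_arcs {v u w : V} (hv : v ∈ T.interiorVerts)
    (huw : (linkGraph T.faces v).Adj u w) : {u, w} ∈ T.arcs v := by
  obtain ⟨c, hc⟩ := T.exists_cyclicOrder hv
  have h3 : 3 ≤ T.deg v := hc.three_le
  have key : ∀ i, {c i, c (i + 1)} ∈ T.arcs v := fun i => by
    have h := T.cyclicInterval_mem_arcs hc i (m := 2) (by norm_num) (by omega)
    rwa [show (2 : ℕ) = 1 + 1 from rfl, cyclicInterval_succ, cyclicInterval_one,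
      Finset.pair_comm] at h
  obtain ⟨i, hi⟩ := (hc.mem_iff u).1 (mem_nbrs_of_linkAdj huw)
  have hi' : c (i + T.deg v - 1 + 1) = u := by
    rw [show i + T.deg v - 1 + 1 = i + T.deg v by omega, ← hi]; exact hc.periodic i
  rw [← hi', hc.adj_iff] at huw
  rcases huw with rfl | rfl
  · rw [← hi', Finset.pair_comm]; exact key _
  · rw [← hi']; exact key _

end TriangulatedSurface

/-! ### Splitting interior vertices off the ends of arcs. -/

namespace TriangulatedSurface
variable {V : Type*} [Fintype V] [DecidableEq V] {T : TriangulatedSurface V}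

/-- The link of `v` is the path `p₀ p₁ p₂ p₃`, whose end points are boundary vertices and whose
other two vertices are interior vertices. -/
structure IsBoundaryPath (T : TriangulatedSurface V) (v p₀ p₁ p₂ p₃ : V) : Prop where
  nbrs_eq : T.nbrs v = {p₀, p₁, p₂, p₃}
  ne₀₁ : p₀ ≠ p₁
  ne₀₂ : p₀ ≠ p₂
  ne₀₃ : p₀ ≠ p₃
  ne₁₂ : p₁ ≠ p₂
  ne₁₃ : p₁ ≠ p₃
  ne₂₃ : p₂ ≠ p₃
  adj₀ : ∀ w, (linkGraph T.faces v).Adj p₀ w ↔ w = p₁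
  adj₁ : ∀ w, (linkGraph T.faces v).Adj p₁ w ↔ w = p₀ ∨ w = p₂
  adj₂ : ∀ w, (linkGraph T.faces v).Adj p₂ w ↔ w = p₁ ∨ w = p₃
  adj₃ : ∀ w, (linkGraph T.faces v).Adj p₃ w ↔ w = p₂
  mem₀ : p₀ ∈ T.boundaryVerts
  mem₁ : p₁ ∈ T.interiorVerts
  mem₂ : p₂ ∈ T.interiorVerts
  mem₃ : p₃ ∈ T.boundaryVerts

theorem linkAdj_iff_of_two {v u a b : V} (ha : (linkGraph T.faces v).Adj u a)
    (hb : (linkGraph T.faces v).Adj u b) (hab : a ≠ b) (w : V) :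
    (linkGraph T.faces v).Adj u w ↔ w = a ∨ w = b := by
  have hsub : ({a, b} : Set V) ⊆ (linkGraph T.faces v).neighborSet u := by
    rintro x (rfl | rfl)
    · exact ha
    · exact hb
  have h2 := T.ncard_neighborSet (adj_of_linkAdj ha)
  have h3 := Set.eq_of_subset_of_ncard_le hsub (by rw [Set.ncard_pair hab]; omega) (Set.toFinite _)
  rw [← SimpleGraph.mem_neighborSet, ← h3]
  rfl

theorem nbrs_subset_of_closed {v u : V} {K : Finset V} (hu : u ∈ T.nbrs v) (huK : u ∈ K)
    (hK : ∀ a ∈ K, ∀ b, (linkGraph T.faces v).Adj a b → b ∈ K) : T.nbrs v ⊆ K := by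
  have := subset_of_induce_connected (K := (K : Set V)) (T.induce_nbrs_connected v)
    (Finset.mem_coe.2 hu) (Finset.mem_coe.2 huK) fun a ha _ b _ hab => hK a ha b hab
  exact_mod_cast this

/-- Follow the link from a vertex of link degree one. It cannot stop before the fourth vertex, since
a set closed under link adjacency contains all neighbours. Both ends have link degree one and so lie
on the boundary, which leaves the middle two as the two interior neighbours. -/
theorem exists_boundaryPath (hb : T.LatticeBoundary) {v : V} (hv : v ∈ T.boundaryVerts) :
    ∃ p₀ p₁ p₂ p₃, IsBoundaryPath T v p₀ p₁ p₂ p₃ := by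
  obtain ⟨hdeg, hint⟩ := hb.1 v hv
  rw [deg] at hdeg
  obtain ⟨p₀, h0v, h0c⟩ := T.mem_boundaryVerts.1 hv
  obtain ⟨p₁, hp₁⟩ := Set.ncard_eq_one.1 h0c
  have adj₀ : ∀ w, (linkGraph T.faces v).Adj p₀ w ↔ w = p₁ := fun w => by
    rw [← SimpleGraph.mem_neighborSet, hp₁]; rfl
  have a01 := (adj₀ p₁).2 rfl
  have p0n : p₀ ∈ T.nbrs v := T.mem_nbrs.2 h0v
  obtain ⟨p₂, a12, n02⟩ : ∃ p₂, (linkGraph T.faces v).Adj p₁ p₂ ∧ p₂ ≠ p₀ := by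
    by_contra! hcon
    have h := nbrs_subset_of_closed (K := {p₀, p₁}) p0n (by simp) (by
      intro a ha b hab
      simp only [Finset.mem_insert, Finset.mem_singleton] at ha ⊢
      rcases ha with rfl | rfl
      · exact Or.inr ((adj₀ _).1 hab)
      · exact Or.inl (hcon b hab))
    have := (Finset.card_le_card h).trans Finset.card_le_two
    omega
  have adj₁ := linkAdj_iff_of_two a01.symm a12 n02.symm
  obtain ⟨p₃, a23, n13⟩ : ∃ p₃, (linkGraph T.faces v).Adj p₂ p₃ ∧ p₃ ≠ p₁ := by
    by_contra! hcon
    have h := nbrs_subset_of_closed (K := {p₀, p₁, p₂}) p0n (by simp) (by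
      intro a ha b hab
      simp only [Finset.mem_insert, Finset.mem_singleton] at ha ⊢
      rcases ha with rfl | rfl | rfl
      · exact Or.inr (Or.inl ((adj₀ _).1 hab))
      · rcases (adj₁ _).1 hab with h | h
        · exact Or.inl h
        · exact Or.inr (Or.inr h)
      · exact Or.inr (Or.inl (hcon b hab)))
    have := (Finset.card_le_card h).trans Finset.card_le_three
    omega
  have adj₂ := linkAdj_iff_of_two a12.symm a23 n13.symm
  have n03 : p₀ ≠ p₃ := by
    rintro rfl
    exact a12.ne ((adj₀ _).1 a23.symm).symm
  have hsub : ({p₀, p₁, p₂, p₃} : Finset V) ⊆ T.nbrs v := by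
    intro x hx
    simp only [Finset.mem_insert, Finset.mem_singleton] at hx
    rcases hx with rfl | rfl | rfl | rfl
    · exact p0n
    · exact mem_nbrs_of_linkAdj a12
    · exact mem_nbrs_of_linkAdj a23
    · exact mem_nbrs_of_linkAdj a23.symm
  have hcard : ({p₀, p₁, p₂, p₃} : Finset V).card = 4 := by
    rw [Finset.card_insert_of_notMem, Finset.card_insert_of_notMem, Finset.card_pair a23.ne]
    · simp [a12.ne, n13.symm]
    · simp [a01.ne, n02.symm, n03]
  have hnbrs : T.nbrs v = {p₀, p₁, p₂, p₃} :=
    (Finset.eq_of_subset_of_card_le hsub (by rw [hcard, hdeg])).symm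
  have adj₃ : ∀ w, (linkGraph T.faces v).Adj p₃ w ↔ w = p₂ := by
    intro w
    refine ⟨fun h => ?_, fun h => h ▸ a23.symm⟩
    have hw := mem_nbrs_of_linkAdj h.symm
    rw [hnbrs] at hw
    simp only [Finset.mem_insert, Finset.mem_singleton] at hw
    rcases hw with rfl | rfl | rfl | rfl
    · exact absurd ((adj₀ _).1 h.symm) n13
    · rcases (adj₁ _).1 h.symm with h | h
      · exact absurd h.symm n03
      · exact absurd h.symm a23.ne
    · rfl
    · exact absurd rfl h.ne
  have h3c : ((linkGraph T.faces v).neighborSet p₃).ncard = 1 :=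
    Set.ncard_eq_one.2 ⟨p₂, by ext w; exact adj₃ w⟩
  have m0 := (T.mem_boundaryVerts_of_ncard h0v h0c).1
  have m3 := (T.mem_boundaryVerts_of_ncard (adj_of_linkAdj a23.symm) h3c).1
  have hsub2 : T.nbrs v ∩ T.interiorVerts ⊆ {p₁, p₂} := by
    intro x hx
    rw [Finset.mem_inter, hnbrs, mem_interiorVerts] at hx
    simp only [Finset.mem_insert, Finset.mem_singleton] at hx ⊢
    rcases hx with ⟨rfl | h | h | rfl, h'⟩
    · exact absurd m0 h'
    · exact Or.inl h
    · exact Or.inr h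
    · exact absurd m3 h'
  have heq := Finset.eq_of_subset_of_card_le hsub2 (by rw [hint]; exact Finset.card_le_two)
  have m1 : p₁ ∈ T.nbrs v ∩ T.interiorVerts := heq ▸ by simp
  have m2 : p₂ ∈ T.nbrs v ∩ T.interiorVerts := heq ▸ by simp
  exact ⟨p₀, p₁, p₂, p₃, hnbrs, a01.ne, n02.symm, n03, a12.ne, n13.symm, a23.ne, adj₀, adj₁, adj₂,
    adj₃, m0, (Finset.mem_inter.1 m1).2, (Finset.mem_inter.1 m2).2, m3⟩

/-- A boundary neighbour of an interior vertex `v` is joined to another one in the link of `v`. -/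
theorem exists_linkAdj_boundary (hb : T.LatticeBoundary) {v b : V} (hv : v ∈ T.interiorVerts)
    (hbb : b ∈ T.boundaryVerts) (hbv : T.Adj b v) :
    ∃ w ∈ T.boundaryVerts, (linkGraph T.faces v).Adj b w := by
  obtain ⟨p₀, p₁, p₂, p₃, h⟩ := exists_boundaryPath hb hbb
  have hvn : v ∈ T.nbrs b := T.mem_nbrs.2 hbv.symm
  rw [h.nbrs_eq] at hvn
  simp only [Finset.mem_insert, Finset.mem_singleton] at hvn
  rw [mem_interiorVerts] at hv
  -- An interior v is one of the two middle vertices in the link of b; the end of the path next to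
  -- it closes a triangle with b and v.
  rcases hvn with rfl | rfl | rfl | rfl
  · exact absurd h.mem₀ hv
  · exact ⟨p₀, h.mem₀, (linkAdj_rotate ((h.adj₁ p₀).2 (Or.inl rfl))).symm⟩
  · exact ⟨p₃, h.mem₃, (linkAdj_rotate ((h.adj₂ p₃).2 (Or.inr rfl))).symm⟩
  · exact absurd h.mem₃ hv

/-- The Markov identities that follow from A1 in the bulk. -/
def MarkovFamily (T : TriangulatedSurface V) (k : Finset V → ℂ) : Prop :=
  ∀ v ∈ T.interiorVerts, ∀ B ∈ T.arcs v, ∀ A, Disjoint A (T.nbrs v) → v ∉ A →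
    A ∪ B ∪ {v} ∈ occurringRegions T → k (A ∪ B ∪ {v}) + k B = k (A ∪ B) + k (B ∪ {v})

/-- An interior vertex at an end of an arc of the link of `v` can be split off. -/
def EndSplitting (T : TriangulatedSurface V) (v : V) (g : Finset V → ℂ) : Prop :=
  ∀ b b' R, b ∈ T.interiorVerts → (linkGraph T.faces v).Adj b b' → R ⊆ T.nbrs v → b ∉ R → b' ∉ R →
    (∀ u ∈ R, ¬ (linkGraph T.faces v).Adj b u) → insert b (insert b' R) ∈ T.arcs v →
    g (insert b (insert b' R)) + g {b'} = g (insert b' R) + g {b, b'}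

/-- If u in R were a neighbour of b, then b, v, u would be pairwise adjacent with b interior, so
they would span a triangle and b, u would be joined in the link of v. -/
theorem disjoint_nbrs_of_end (hT : T.NoEmptyTriangle) {v b : V} {R : Finset V}
    (hb : b ∈ T.interiorVerts) (hbv : T.Adj b v) (hR : R ⊆ T.nbrs v)
    (hadj : ∀ u ∈ R, ¬ (linkGraph T.faces v).Adj b u) : Disjoint R (T.nbrs b) := by
  rw [Finset.disjoint_left]
  intro u hu hub
  refine hadj u hu ?_
  rw [linkAdj_iff, Finset.insert_comm]
  exact hT b v u hbv (T.mem_nbrs.1 (hR hu)).symm (T.mem_nbrs.1 hub).symm hb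

/-- A1 at b with B = {b'} and A = R: the vertex b' shields b from the rest of the arc. -/
theorem MarkovFamily.endSplitting {k : Finset V → ℂ} (hk : MarkovFamily T k)
    (hT : T.NoEmptyTriangle) (v : V) : EndSplitting T v k := by
  intro b b' R hb hbb' hR hbR hb'R hadj harc
  have hbv := adj_of_linkAdj hbb'
  have h1 : R ∪ {b'} = insert b' R := by rw [Finset.union_comm]; rfl
  have h2 : R ∪ {b'} ∪ {b} = insert b (insert b' R) := by rw [h1, Finset.union_comm]; rfl
  have h := hk b hb {b'} (T.singleton_mem_arcs hb (T.mem_nbrs.2 (adj_of_linkAdj' hbb').symm)) R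
    (disjoint_nbrs_of_end hT hb hbv hR hadj) hbR
    (by rw [h2]; exact Or.inr (Or.inr (Or.inr ⟨v, _, harc, Or.inl rfl⟩)))
  rw [h2, h1] at h
  rw [h, Finset.union_comm {b'}]
  rfl

/-- With the apex v included the shield is {b', v}, an arc of two vertices in the link of b. -/
theorem MarkovFamily.endSplitting_cone {k : Finset V → ℂ} (hk : MarkovFamily T k)
    (hT : T.NoEmptyTriangle) (v : V) : EndSplitting T v fun S => k (S ∪ {v}) := by
  intro b b' R hb hbb' hR hbR hb'R hadj harc
  have hbv := adj_of_linkAdj hbb'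
  have h2 : R ∪ {b', v} ∪ {b} = insert b (insert b' R) ∪ {v} := by
    ext x; simp only [Finset.mem_union, Finset.mem_insert, Finset.mem_singleton]; tauto
  have h1 : R ∪ {b', v} = insert b' R ∪ {v} := by
    ext x; simp only [Finset.mem_union, Finset.mem_insert, Finset.mem_singleton]; tauto
  have h3 : ({b', v} : Finset V) ∪ {b} = {b, b'} ∪ {v} := by
    ext x; simp only [Finset.mem_union, Finset.mem_insert, Finset.mem_singleton]; tauto
  have h := hk b hb {b', v} (T.pair_mem_arcs hb (linkAdj_rotate hbb')) R
    (disjoint_nbrs_of_end hT hb hbv hR hadj) hbR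
    (by rw [h2]; exact Or.inr (Or.inr (Or.inr ⟨v, _, harc, Or.inr rfl⟩)))
  rw [h2, h1, h3] at h
  exact h

/-- Two boundary vertices cannot be the ends of an arc of at least three vertices in the link of
an interior vertex. -/
theorem not_boundary_ends (hb : T.LatticeBoundary) {v : V} (hv : v ∈ T.interiorVerts) {c : ℕ → V}
    (hc : IsCyclicOrder (linkGraph T.faces v) (T.nbrs v) c) {i m : ℕ} (hm : m + 3 < T.deg v)
    (h1 : c i ∈ T.boundaryVerts) (h2 : c (i + (m + 2)) ∈ T.boundaryVerts) : False := by
  rw [deg] at hm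
  -- Either w is the other end, which is too far from c i to be adjacent to it, or v has three
  -- boundary neighbours.
  obtain ⟨w, hw, hadj⟩ := exists_linkAdj_boundary hb hv h1 (T.mem_nbrs.1 (hc.mem i))
  have hx : c (i + (m + 2)) ≠ c i := fun h => by
    have := hc.inj (i := i) (j := m + 2) (k := 0) (by omega) (by omega) h
    omega
  have hcard := hb.2 v hv
  by_cases hxw : c (i + (m + 2)) = w
  · rw [← hxw] at hadj
    have h3 : c i = c (i + ((T.nbrs v).card - 1) + 1) := by
      rw [← hc.periodic i]; congr 1; omega
    rw [h3, hc.adj_iff] at hadj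
    rcases hadj with h | h
    · have := hc.inj (by omega) (by omega) h
      omega
    · rw [show i + ((T.nbrs v).card - 1) + 2 = i + 1 + (T.nbrs v).card by omega, hc.periodic] at h
      have := hc.inj (by omega) (by omega) h
      omega
  · have hsub : ({c i, w, c (i + (m + 2))} : Finset V) ⊆ T.nbrs v ∩ T.boundaryVerts := by
      intro x hx
      simp only [Finset.mem_insert, Finset.mem_singleton] at hx
      rw [Finset.mem_inter]
      rcases hx with rfl | rfl | rfl
      · exact ⟨hc.mem _, h1⟩
      · exact ⟨mem_nbrs_of_linkAdj hadj.symm, hw⟩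
      · exact ⟨hc.mem _, h2⟩
    have h4 := Finset.card_le_card hsub
    rw [Finset.card_insert_of_notMem (by simp [hadj.ne, hx.symm]),
      Finset.card_pair (Ne.symm hxw)] at h4
    omega

/-- Induction on the length, removing an interior end; by `not_boundary_ends` there is one once the
arc has three vertices. Removal at either side fits the same formula, edges minus inner vertices:
the summand j = 0 cancels the leading g {c i}. -/
theorem EndSplitting.apply_cyclicInterval {v : V} {g : Finset V → ℂ} (hg : EndSplitting T v g)
    (hb : T.LatticeBoundary) (hv : v ∈ T.interiorVerts) {c : ℕ → V}
    (hc : IsCyclicOrder (linkGraph T.faces v) (T.nbrs v) c) (m : ℕ) :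
    ∀ i, m + 1 < T.deg v → g (cyclicInterval c i (m + 1)) =
      g {c i} + ∑ j ∈ Finset.range m, (g {c (i + j), c (i + j + 1)} - g {c (i + j)}) := by
  induction m with
  | zero => intro i _; simp [cyclicInterval_one]
  | succ m ih =>
    intro i hm
    rcases m with _ | m
    · rw [zero_add, cyclicInterval_succ, cyclicInterval_one, Finset.pair_comm]
      simp
    have hm' : m + 3 < (T.nbrs v).card := hm
    have harc := T.cyclicInterval_mem_arcs hc i (m := m + 3) (by omega) hm
    by_cases hl : c (i + (m + 2)) ∈ T.interiorVerts
    · have e1 : cyclicInterval c i (m + 3) =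
          insert (c (i + (m + 2))) (insert (c (i + (m + 1))) (cyclicInterval c i (m + 1))) := by
        rw [cyclicInterval_succ, cyclicInterval_succ]
      have h := hg (c (i + (m + 2))) (c (i + (m + 1))) (cyclicInterval c i (m + 1)) hl
        (hc.adj_succ (i + (m + 1))).symm (hc.cyclicInterval_subset _ _)
        (by rw [hc.mem_cyclicInterval_iff (by omega) (by omega)]; omega)
        (by rw [hc.mem_cyclicInterval_iff (by omega) (by omega)]; omega)
        (by
          intro u hu hadj
          obtain ⟨j, hj, rfl⟩ := mem_cyclicInterval.1 hu
          rcases (hc.adj_iff (i + (m + 1)) _).1 hadj with h | h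
          · have := hc.inj (by omega) (by omega) h
            omega
          · have := hc.inj (j := j) (k := m + 3) (by omega) (by omega) h
            omega)
        (e1 ▸ harc)
      rw [← e1, ← cyclicInterval_succ, ih i (by omega)] at h
      rw [Finset.sum_range_succ]
      rw [show i + (m + 1) + 1 = i + (m + 2) by omega, Finset.pair_comm (c (i + (m + 1)))]
      linear_combination h
    · have hf : c i ∈ T.interiorVerts := by
        by_contra hf
        rw [mem_interiorVerts, not_not] at hl hf
        exact not_boundary_ends hb hv hc hm hf hl
      have e1 : cyclicInterval c i (m + 3) =
          insert (c i) (insert (c (i + 1)) (cyclicInterval c (i + 2) (m + 1))) := by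
        rw [cyclicInterval_succ', cyclicInterval_succ']
      -- `adj_iff` describes the neighbours of a successor, so c i is rewritten as one by going once
      -- around the cycle.
      have h3 : c i = c (i + ((T.nbrs v).card - 1) + 1) := by
        rw [← hc.periodic i]; congr 1; omega
      have hnot : ∀ j < m + 1, ∀ l, l < 2 ∨ m + 3 ≤ l → l < (T.nbrs v).card →
          c (i + l) ≠ c (i + 2 + j) := by
        intro j hj l hl hl' he
        rw [add_assoc] at he
        have := hc.inj hl' (by omega) he
        omega
      have h := hg (c i) (c (i + 1)) (cyclicInterval c (i + 2) (m + 1)) hf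
        (hc.adj_succ i) (hc.cyclicInterval_subset _ _)
        (by
          rw [mem_cyclicInterval]
          rintro ⟨j, hj, he⟩
          exact hnot j hj 0 (by omega) (by omega) he.symm)
        (by
          rw [mem_cyclicInterval]
          rintro ⟨j, hj, he⟩
          exact hnot j hj 1 (by omega) (by omega) he.symm)
        (by
          intro u hu hadj
          obtain ⟨j, hj, rfl⟩ := mem_cyclicInterval.1 hu
          rw [h3, hc.adj_iff] at hadj
          rcases hadj with h | h
          · exact hnot j hj _ (by omega) (by omega) h.symm
          · rw [show i + ((T.nbrs v).card - 1) + 2 = i + 1 + (T.nbrs v).card by omega,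
              hc.periodic] at h
            exact hnot j hj 1 (by omega) (by omega) h.symm)
        (e1 ▸ harc)
      rw [← e1, show i + 2 = i + 1 + 1 from rfl, ← cyclicInterval_succ', ih (i + 1) (by omega)] at h
      rw [Finset.sum_range_succ']
      have hs : ∀ j, g {c (i + (j + 1)), c (i + (j + 1) + 1)} - g {c (i + (j + 1))} =
          g {c (i + 1 + j), c (i + 1 + j + 1)} - g {c (i + 1 + j)} := fun j => by
        rw [show i + (j + 1) = i + 1 + j by omega]
      rw [Finset.sum_congr rfl fun j _ => hs j, add_zero]
      linear_combination h

end TriangulatedSurface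

/-! ### Sums over rotations and the averages at an interior vertex. -/

theorem sum_range_add_of_periodic {M : Type*} [AddCommGroup M] {d : ℕ} {f : ℕ → M}
    (hf : ∀ i, f (i + d) = f i) (s : ℕ) :
    ∑ i ∈ Finset.range d, f (i + s) = ∑ i ∈ Finset.range d, f i := by
  induction s with
  | zero => rfl
  | succ s ih =>
    have h1 := Finset.sum_range_succ (fun i => f (i + s)) d
    have h2 := Finset.sum_range_succ' (fun i => f (i + s)) d
    rw [h1, ih] at h2
    simp only [zero_add] at h2
    rw [add_comm d s, hf, add_left_inj] at h2
    rw [h2]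
    exact Finset.sum_congr rfl fun i _ => by rw [add_right_comm, add_assoc]

namespace TriangulatedSurface
variable {V : Type*} [Fintype V] [DecidableEq V] {T : TriangulatedSurface V}

/-- An interval of m vertices has m - 1 edges and m - 2 inner vertices, and rotation turns each
contribution into a full cyclic sum. For m = 1 the coefficient -(m - 2) = 1 counts the single
vertex. -/
theorem EndSplitting.sum_cyclicInterval {v : V} {g : Finset V → ℂ} (hg : EndSplitting T v g)
    (hb : T.LatticeBoundary) (hv : v ∈ T.interiorVerts) {c : ℕ → V}
    (hc : IsCyclicOrder (linkGraph T.faces v) (T.nbrs v) c) {m : ℕ} (hm1 : 1 ≤ m)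
    (hm : m < T.deg v) (s : ℕ) :
    ∑ i ∈ Finset.range (T.deg v), g (cyclicInterval c (i + s) m) =
      (m - 1) * ∑ i ∈ Finset.range (T.deg v), g {c i, c (i + 1)} -
        (m - 2) * ∑ i ∈ Finset.range (T.deg v), g {c i} := by
  obtain ⟨m, rfl⟩ := Nat.exists_eq_add_of_le' hm1
  have hp : ∀ i, c (i + T.deg v) = c i := hc.periodic
  have hx := sum_range_add_of_periodic (d := T.deg v) (f := fun i => g {c i})
    fun i => by rw [hp]
  have he := sum_range_add_of_periodic (d := T.deg v) (f := fun i => g {c i, c (i + 1)})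
    fun i => by rw [hp, add_right_comm, hp]
  have hj : ∀ j, ∑ i ∈ Finset.range (T.deg v),
      (g {c (i + s + j), c (i + s + j + 1)} - g {c (i + s + j)}) =
      ∑ i ∈ Finset.range (T.deg v), g {c i, c (i + 1)} -
        ∑ i ∈ Finset.range (T.deg v), g {c i} := fun j => by
    rw [← he (s + j), ← hx (s + j), ← Finset.sum_sub_distrib]
    exact Finset.sum_congr rfl fun i _ => by rw [add_assoc i s j]
  rw [Finset.sum_congr rfl fun i _ => hg.apply_cyclicInterval hb hv hc m (i + s) hm,
    Finset.sum_add_distrib, Finset.sum_comm, hx s, Finset.sum_congr rfl fun j _ => hj j,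
    Finset.sum_const, Finset.card_range, nsmul_eq_mul]
  push_cast
  ring

theorem bulkArcs_eq_image {v : V} {c : ℕ → V}
    (hc : IsCyclicOrder (linkGraph T.faces v) (T.nbrs v) c) :
    bulkArcs T v = (Finset.Icc 1 (T.deg v / 2) ×ˢ Finset.range (T.deg v)).image
      fun p => cyclicInterval c p.2 p.1 := by
  ext B
  have h3 : 3 ≤ T.deg v := hc.three_le
  simp only [bulkArcs, Finset.mem_filter, T.mem_arcs_iff_of_cyclicOrder hc, Finset.mem_image,
    Finset.mem_product, Finset.mem_Icc, Finset.mem_range, Prod.exists]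
  constructor
  · rintro ⟨⟨i, hi, m, hm1, hm, rfl⟩, h⟩
    rw [hc.card_cyclicInterval hm.le] at h
    exact ⟨m, i, ⟨⟨hm1, by omega⟩, hi⟩, rfl⟩
  · rintro ⟨m, i, ⟨⟨hm1, hm⟩, hi⟩, rfl⟩
    have hm' : m < T.deg v := by omega
    refine ⟨⟨i, hi, m, hm1, hm', rfl⟩, ?_⟩
    rw [hc.card_cyclicInterval hm'.le]
    omega

theorem injOn_bulkArcs {v : V} {c : ℕ → V}
    (hc : IsCyclicOrder (linkGraph T.faces v) (T.nbrs v) c) :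
    Set.InjOn (fun p : ℕ × ℕ => cyclicInterval c p.2 p.1)
      (Finset.Icc 1 (T.deg v / 2) ×ˢ Finset.range (T.deg v) : Finset (ℕ × ℕ)) := by
  rintro ⟨m, i⟩ h ⟨m', i'⟩ h' he
  have h3 : 3 ≤ T.deg v := hc.three_le
  simp only [Finset.mem_coe, Finset.mem_product, Finset.mem_Icc, Finset.mem_range] at h h'
  have h1 : m < T.deg v := by omega
  have h2 : m' < T.deg v := by omega
  obtain ⟨rfl, rfl⟩ := hc.cyclicInterval_injOn h.2 h'.2 h.1.1 h1 h2 he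
  rfl

/-- The rotation sum is the same for every size m, so averaging over the sizes has no effect. -/
theorem average_bulkArcs {v : V} {c : ℕ → V}
    (hc : IsCyclicOrder (linkGraph T.faces v) (T.nbrs v) c) {G : Finset V → ℂ} {K : ℂ}
    (hG : ∀ m, 1 ≤ m → m < T.deg v →
      ∑ i ∈ Finset.range (T.deg v), G (cyclicInterval c i m) = K) :
    1 / ((bulkArcs T v).card : ℂ) * ∑ B ∈ bulkArcs T v, G B = K / T.deg v := by
  have h3 : 3 ≤ T.deg v := hc.three_le
  rw [bulkArcs_eq_image hc, Finset.card_image_of_injOn (injOn_bulkArcs hc),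
    Finset.sum_image (injOn_bulkArcs hc), Finset.sum_product, Finset.card_product,
    Finset.sum_congr rfl fun m hm => hG m (Finset.mem_Icc.1 hm).1
      (by have := (Finset.mem_Icc.1 hm).2; omega)]
  have h4 : T.deg v / 2 ≠ 0 := by omega
  have h5 : T.deg v ≠ 0 := by omega
  simp only [Finset.sum_const, Nat.card_Icc, Nat.add_sub_cancel, Finset.card_range, nsmul_eq_mul,
    Nat.cast_mul]
  field_simp

theorem sum_nbrs_eq {v : V} {c : ℕ → V}
    (hc : IsCyclicOrder (linkGraph T.faces v) (T.nbrs v) c) (h : V → ℂ) :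
    ∑ u ∈ T.nbrs v, h u = ∑ i ∈ Finset.range (T.deg v), h (c i) := by
  symm
  refine Finset.sum_bij (fun i _ => c i) (fun i _ => hc.mem i) ?_ ?_ fun _ _ => rfl
  · intro i hi j hj he
    exact hc.inj (i := 0) (Finset.mem_range.1 hi) (Finset.mem_range.1 hj) (by simpa using he)
  · intro u hu
    obtain ⟨i, hi, h⟩ := hc.exists_lt hu
    exact ⟨i, Finset.mem_range.2 hi, h⟩

theorem sum_faces_eq {v : V} {c : ℕ → V}
    (hc : IsCyclicOrder (linkGraph T.faces v) (T.nbrs v) c) (h : Finset V → ℂ) :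
    ∑ f ∈ T.faces.filter (fun f => v ∈ f), h f =
      ∑ i ∈ Finset.range (T.deg v), h {v, c i, c (i + 1)} := by
  have h3 := hc.three_le
  symm
  refine Finset.sum_bij (fun i _ => {v, c i, c (i + 1)}) ?_ ?_ ?_ fun _ _ => rfl
  · intro i _
    exact Finset.mem_filter.2 ⟨linkAdj_iff.1 (hc.adj_succ i), by simp⟩
  · intro i hi j hj he
    rw [Finset.mem_range] at hi hj
    have hv : ∀ i, v ≠ c i := fun i => (ne_of_mem_faces (linkAdj_iff.1 (hc.adj_succ i))).1
    have hm : ∀ i j, ({v, c i, c (i + 1)} : Finset V) = {v, c j, c (j + 1)} →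
        c i = c j ∨ c i = c (j + 1) := by
      intro i j he
      have h1 : c i ∈ ({v, c j, c (j + 1)} : Finset V) := he ▸ by simp
      simpa [(hv i).symm] using h1
    have hm' : c (i + 1) = c j ∨ c (i + 1) = c (j + 1) := by
      have h1 : c (i + 1) ∈ ({v, c j, c (j + 1)} : Finset V) := he ▸ by simp
      simpa [(hv (i + 1)).symm] using h1
    -- The crossed matching of c i with c (j + 1) and of c (i + 1) with c j would make 2 divisible
    -- by the length, which is at least 3.
    have key : c i = c j := by
      rcases hm i j he with h1 | h1
      · exact h1
      rcases hm' with h2 | h2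
      · rw [hc.eq_iff] at h1 h2
        have h4 : i + 2 ≡ i [MOD (T.nbrs v).card] := (h2.add_right 1).trans h1.symm
        have h5 := Nat.ModEq.add_left_cancel' i (show i + 2 ≡ i + 0 [MOD (T.nbrs v).card] from h4)
        rw [Nat.ModEq, Nat.mod_eq_of_lt (by omega), Nat.zero_mod] at h5
        omega
      · exact absurd (h1.trans h2.symm) (hc.adj_succ i).ne
    exact hc.inj (i := 0) hi hj (by simpa using key)
  · intro f hf
    obtain ⟨hf, hvf⟩ := Finset.mem_filter.1 hf
    obtain ⟨a, ha, hav⟩ := Finset.exists_mem_ne (by rw [T.card_face f hf]; norm_num) v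
    obtain ⟨b, rfl⟩ := exists_eq_of_mem_face hf hav hvf ha
    rw [← linkAdj_iff] at hf
    obtain ⟨i, hi, rfl⟩ := hc.exists_lt (mem_nbrs_of_linkAdj hf)
    rcases Nat.eq_zero_or_pos i with rfl | hi0
    · rw [← hc.periodic 0, show 0 + (T.nbrs v).card = (T.nbrs v).card - 1 + 1 by omega,
        hc.adj_iff] at hf
      rcases hf with rfl | rfl
      · refine ⟨(T.nbrs v).card - 1, Finset.mem_range.2 (by rw [deg]; omega), ?_⟩
        rw [show (T.nbrs v).card - 1 + 1 = 0 + (T.nbrs v).card by omega, hc.periodic,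
          Finset.pair_comm]
      · refine ⟨0, Finset.mem_range.2 hi, ?_⟩
        rw [show (T.nbrs v).card - 1 + 2 = 0 + 1 + (T.nbrs v).card by omega, hc.periodic]
    · obtain ⟨i, rfl⟩ := Nat.exists_eq_add_of_le' hi0
      rcases (hc.adj_iff _ _).1 hf with rfl | rfl
      · exact ⟨i, Finset.mem_range.2 (by rw [deg]; omega), by rw [Finset.pair_comm]⟩
      · exact ⟨i + 1, Finset.mem_range.2 hi, rfl⟩

/-- The average of `Δ̂(B, v, D)` over the partitions of the link of an interior vertex. -/
theorem MarkovFamily.average_bulk {k : Finset V → ℂ} (hk : MarkovFamily T k)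
    (hT : T.NoEmptyTriangle) (hb : T.LatticeBoundary) {v : V} (hv : v ∈ T.interiorVerts) :
    1 / ((bulkArcs T v).card : ℂ) * ∑ B ∈ bulkArcs T v,
        (k (B ∪ {v}) + k ({v} ∪ (T.nbrs v \ B)) - k B - k (T.nbrs v \ B)) =
      ((T.deg v - 2) * (∑ f ∈ T.faces.filter (fun f => v ∈ f), k f -
          ∑ f ∈ T.faces.filter (fun f => v ∈ f), k (f.erase v)) -
        (T.deg v - 4) * (∑ u ∈ T.nbrs v, k {u, v} - ∑ u ∈ T.nbrs v, k {u})) / T.deg v := by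
  obtain ⟨c, hc⟩ := T.exists_cyclicOrder hv
  refine average_bulkArcs hc fun m hm1 hm => ?_
  have hne : ∀ i, v ∉ ({c i, c (i + 1)} : Finset V) := fun i => by
    have h := ne_of_mem_faces (linkAdj_iff.1 (hc.adj_succ i))
    simp [h.1, h.2.1]
  have h1 := (hk.endSplitting hT v).sum_cyclicInterval hb hv hc hm1 hm 0
  have h2 := (hk.endSplitting_cone hT v).sum_cyclicInterval hb hv hc hm1 hm 0
  -- The complementary arc starts at i + m and has d - m vertices. The size drops out of the total:
  -- (m-1) + (d-m-1) = d-2 and (m-2) + (d-m-2) = d-4.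
  have h3 := (hk.endSplitting hT v).sum_cyclicInterval hb hv hc (m := T.deg v - m)
    (by omega) (by omega) m
  have h4 := (hk.endSplitting_cone hT v).sum_cyclicInterval hb hv hc (m := T.deg v - m)
    (by omega) (by omega) m
  simp only [sum_nbrs_eq hc, sum_faces_eq hc, Finset.sum_sub_distrib, Finset.sum_add_distrib]
  simp only [Finset.erase_insert (hne _), hc.sdiff_cyclicInterval hm.le, Finset.union_comm {v},
    ← Finset.insert_eq, add_zero] at h1 h2 h3 h4 ⊢
  have hf : ∀ i, ({c i, c (i + 1)} : Finset V) ∪ {v} = {v, c i, c (i + 1)} := fun i => by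
    rw [Finset.union_comm]; rfl
  simp only [hf, show (T.nbrs v).card = T.deg v from rfl] at h2 h4 ⊢
  push_cast [hm.le] at h3 h4
  linear_combination h2 + h4 - h1 - h3

/-- Each neighbour of v lies in two of the triangles at v, whence the factors 2; each link edge lies
in one of them, and v in all. -/
theorem sum_hatGamma_eq (k : Finset V → ℂ) {v : V} (hv : v ∈ T.interiorVerts) :
    ∑ f ∈ T.faces.filter (fun f => v ∈ f),
        (∑ e ∈ f.powersetCard 2, k e - k f - ∑ u ∈ f, k {u}) =
      2 * ∑ u ∈ T.nbrs v, k {u, v} + ∑ f ∈ T.faces.filter (fun f => v ∈ f), k (f.erase v) -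
        ∑ f ∈ T.faces.filter (fun f => v ∈ f), k f - T.deg v * k {v} -
        2 * ∑ u ∈ T.nbrs v, k {u} := by
  obtain ⟨c, hc⟩ := T.exists_cyclicOrder hv
  have hp : ∀ i, c (i + T.deg v) = c i := hc.periodic
  have hx := sum_range_add_of_periodic (d := T.deg v) (f := fun i => k {c i})
    (fun i => by rw [hp]) 1
  have hy := sum_range_add_of_periodic (d := T.deg v) (f := fun i => k {c i, v})
    (fun i => by rw [hp]) 1
  have key : ∀ i, ∑ e ∈ ({v, c i, c (i + 1)} : Finset V).powersetCard 2, k e -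
      k {v, c i, c (i + 1)} - ∑ u ∈ ({v, c i, c (i + 1)} : Finset V), k {u} =
      k {c i, v} + k {c (i + 1), v} + k (({v, c i, c (i + 1)} : Finset V).erase v) -
        k {v, c i, c (i + 1)} - k {v} - k {c i} - k {c (i + 1)} := by
    intro i
    obtain ⟨h1, h2, h3⟩ := ne_of_mem_faces (linkAdj_iff.1 (hc.adj_succ i))
    have he : ({v, c i, c (i + 1)} : Finset V).powersetCard 2 =
        {{c i, v}, {c (i + 1), v}, {c i, c (i + 1)}} := by
      ext e
      rw [Finset.mem_powersetCard]
      constructor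
      · rintro ⟨hs, hc2⟩
        obtain ⟨x, y, hxy, rfl⟩ := Finset.card_eq_two.1 hc2
        simp only [Finset.insert_subset_iff, Finset.singleton_subset_iff, Finset.mem_insert,
          Finset.mem_singleton] at hs ⊢
        rcases hs with ⟨rfl | rfl | rfl, rfl | rfl | rfl⟩ <;>
          simp [Finset.pair_comm] at hxy ⊢
      · intro he
        simp only [Finset.mem_insert, Finset.mem_singleton] at he
        rcases he with rfl | rfl | rfl
        · exact ⟨by simp [Finset.insert_subset_iff], Finset.card_pair h1.symm⟩
        · exact ⟨by simp [Finset.insert_subset_iff], Finset.card_pair h2.symm⟩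
        · exact ⟨by simp, Finset.card_pair h3⟩
    have n1 : ({c i, v} : Finset V) ≠ {c (i + 1), v} := fun h => by
      have : c i ∈ ({c (i + 1), v} : Finset V) := h ▸ by simp
      simp [h1.symm, h3] at this
    have n2 : ({c i, v} : Finset V) ≠ {c i, c (i + 1)} := fun h => by
      have : v ∈ ({c i, c (i + 1)} : Finset V) := h ▸ by simp
      simp [h1, h2] at this
    have n3 : ({c (i + 1), v} : Finset V) ≠ {c i, c (i + 1)} := fun h => by
      have : v ∈ ({c i, c (i + 1)} : Finset V) := h ▸ by simp
      simp [h1, h2] at this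
    rw [he, Finset.sum_insert (by simp [n1, n2]), Finset.sum_pair n3,
      Finset.sum_insert (by simp [h1, h2]), Finset.sum_pair h3,
      Finset.erase_insert (by simp [h1, h2])]
    ring
  rw [sum_faces_eq hc, Finset.sum_congr rfl fun i _ => key i]
  simp only [sum_nbrs_eq hc, sum_faces_eq hc, Finset.sum_sub_distrib, Finset.sum_add_distrib, hx,
    hy, Finset.sum_const, Finset.card_range, nsmul_eq_mul]
  ring

end TriangulatedSurface

/-! ### Arcs and averages at a boundary vertex. -/

namespace TriangulatedSurface
variable {V : Type*} [Fintype V] [DecidableEq V] {T : TriangulatedSurface V}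
  {v p₀ p₁ p₂ p₃ : V}

namespace IsBoundaryPath

theorem reverse (h : IsBoundaryPath T v p₀ p₁ p₂ p₃) : IsBoundaryPath T v p₃ p₂ p₁ p₀ where
  nbrs_eq := by
    rw [h.nbrs_eq]; ext x; simp only [Finset.mem_insert, Finset.mem_singleton]; tauto
  ne₀₁ := h.ne₂₃.symm
  ne₀₂ := h.ne₁₃.symm
  ne₀₃ := h.ne₀₃.symm
  ne₁₂ := h.ne₁₂.symm
  ne₁₃ := h.ne₀₂.symm
  ne₂₃ := h.ne₀₁.symm
  adj₀ := h.adj₃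
  adj₁ w := (h.adj₂ w).trans or_comm
  adj₂ w := (h.adj₁ w).trans or_comm
  adj₃ := h.adj₀
  mem₀ := h.mem₃
  mem₁ := h.mem₂
  mem₂ := h.mem₁
  mem₃ := h.mem₀

/-- The only link neighbour of p₀ is p₁, so a connected set through p₀ that avoids p₁ ends there. -/
theorem eq_singleton_of_notMem (h : IsBoundaryPath T v p₀ p₁ p₂ p₃) {S : Finset V}
    (hS : ((linkGraph T.faces v).induce (S : Set V)).Connected) (h0 : p₀ ∈ S) (h1 : p₁ ∉ S) :
    p₂ ∉ S ∧ p₃ ∉ S := by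
  have h2 := subset_of_induce_connected (K := {p₀}) hS (Finset.mem_coe.2 h0) rfl (by
    rintro a rfl _ b hb hab
    rw [h.adj₀] at hab
    exact absurd (hab ▸ hb) h1)
  exact ⟨fun h3 => h.ne₀₂ (h2 h3).symm, fun h3 => h.ne₀₃ (h2 h3).symm⟩

theorem initial_connected (h : IsBoundaryPath T v p₀ p₁ p₂ p₃) :
    ((linkGraph T.faces v).induce (({p₀} : Finset V) : Set V)).Connected ∧
    ((linkGraph T.faces v).induce (({p₀, p₁} : Finset V) : Set V)).Connected ∧
    ((linkGraph T.faces v).induce (({p₀, p₁, p₂} : Finset V) : Set V)).Connected := by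
  have a01 := (h.adj₀ p₁).2 rfl
  have a12 := (h.adj₁ p₂).2 (Or.inr rfl)
  have c0 := induce_singleton_connected (G := linkGraph T.faces v) p₂
  have c1 := induce_insert_connected c0 (Set.mem_singleton p₂) a12
  refine ⟨?_, ?_, ?_⟩
  · rw [Finset.coe_singleton]
    exact induce_singleton_connected p₀
  · rw [Finset.coe_pair]
    exact induce_insert_connected (induce_singleton_connected p₁) (Set.mem_singleton p₁) a01
  · rw [Finset.coe_insert, Finset.coe_pair]
    exact induce_insert_connected c1 (Set.mem_insert p₁ _) a01

theorem sdiff_initial (h : IsBoundaryPath T v p₀ p₁ p₂ p₃) :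
    T.nbrs v \ {p₀} = {p₁, p₂, p₃} ∧ T.nbrs v \ {p₀, p₁} = {p₂, p₃} ∧
      T.nbrs v \ {p₀, p₁, p₂} = {p₃} := by
  have h01 := h.ne₀₁; have h02 := h.ne₀₂; have h03 := h.ne₀₃
  have h12 := h.ne₁₂; have h13 := h.ne₁₃; have h23 := h.ne₂₃
  rw [h.nbrs_eq]
  refine ⟨?_, ?_, ?_⟩ <;> ext x <;>
    simp only [Finset.mem_sdiff, Finset.mem_insert, Finset.mem_singleton] <;> grind

/-- `eq_singleton_of_notMem`, applied at both ends of the path to B and to its complement, excludes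
all other subsets. -/
theorem arcs_eq (h : IsBoundaryPath T v p₀ p₁ p₂ p₃) : T.arcs v =
    {{p₀}, {p₀, p₁}, {p₀, p₁, p₂}, {p₃}, {p₃, p₂}, {p₃, p₂, p₁}} := by
  have r := h.reverse
  obtain ⟨c1, c2, c3⟩ := h.initial_connected
  obtain ⟨d1, d2, d3⟩ := r.initial_connected
  obtain ⟨s1, s2, s3⟩ := h.sdiff_initial
  obtain ⟨t1, t2, t3⟩ := r.sdiff_initial
  have e3 : ({p₁, p₂, p₃} : Finset V) = {p₃, p₂, p₁} := by
    ext x; simp only [Finset.mem_insert, Finset.mem_singleton]; tauto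
  have e3' : ({p₂, p₁, p₀} : Finset V) = {p₀, p₁, p₂} := by
    ext x; simp only [Finset.mem_insert, Finset.mem_singleton]; tauto
  ext B
  rw [mem_arcs]
  simp only [Finset.mem_insert, Finset.mem_singleton]
  constructor
  · rintro ⟨hB, hB1, hB2⟩
    have hn : ∀ x ∈ T.nbrs v, (x ∈ T.nbrs v \ B ↔ x ∉ B) := fun x hx => by simp [hx]
    have i1 := h.eq_singleton_of_notMem hB1
    have i2 := r.eq_singleton_of_notMem hB1
    have i3 := h.eq_singleton_of_notMem hB2
    have i4 := r.eq_singleton_of_notMem hB2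
    obtain ⟨⟨x, hx⟩⟩ := hB1.nonempty
    obtain ⟨⟨y, hy⟩⟩ := hB2.nonempty
    have hx' := hB hx
    have hy' := (Finset.mem_sdiff.1 hy)
    rw [hn, hn, hn, hn] at i3 i4 <;> try simp [h.nbrs_eq]
    have hBf : B = (T.nbrs v).filter (· ∈ B) := by
      ext z; simpa using fun hz => hB hz
    have hx2 : x ∈ B := hx
    rw [h.nbrs_eq] at hBf hx' hy'
    simp only [Finset.mem_insert, Finset.mem_singleton] at hx' hy'
    have hxB : p₀ ∈ B ∨ p₁ ∈ B ∨ p₂ ∈ B ∨ p₃ ∈ B := by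
      rcases hx' with e | e | e | e <;> rw [e] at hx2 <;> simp [hx2]
    have hyB : p₀ ∉ B ∨ p₁ ∉ B ∨ p₂ ∉ B ∨ p₃ ∉ B := by
      have hy2 := hy'.2
      rcases hy'.1 with e | e | e | e <;> rw [e] at hy2 <;> simp [hy2]
    simp only [Finset.filter_insert, Finset.filter_singleton] at hBf
    by_cases m0 : p₀ ∈ B <;> by_cases m1 : p₁ ∈ B
    · by_cases m2 : p₂ ∈ B
      · have m3 : p₃ ∉ B := by simpa [m0, m1, m2] using hyB
        exact Or.inr (Or.inr (Or.inl (by simpa [m0, m1, m2, m3] using hBf)))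
      · have m3 : p₃ ∉ B := fun m3 => (i2 m3 m2).1 m1
        exact Or.inr (Or.inl (by simpa [m0, m1, m2, m3] using hBf))
    · obtain ⟨m2, m3⟩ := i1 m0 m1
      exact Or.inl (by simpa [m0, m1, m2, m3] using hBf)
    · obtain ⟨m2, m3⟩ := i3 m0 (not_not.2 m1)
      rw [not_not] at m2 m3
      refine Or.inr (Or.inr (Or.inr (Or.inr (Or.inr ?_))))
      rw [← e3]
      simpa [m0, m1, m2, m3] using hBf
    · by_cases m2 : p₂ ∈ B
      · have m3 : p₃ ∈ B := by
          by_contra m3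
          exact (i4 m3 (not_not.2 m2)).1 m1
        refine Or.inr (Or.inr (Or.inr (Or.inr (Or.inl ?_))))
        rw [Finset.pair_comm]
        simpa [m0, m1, m2, m3] using hBf
      · have m3 : p₃ ∈ B := by simpa [m0, m1, m2] using hxB
        exact Or.inr (Or.inr (Or.inr (Or.inl (by simpa [m0, m1, m2, m3] using hBf))))
  · rintro (rfl | rfl | rfl | rfl | rfl | rfl)
    · exact ⟨by simp [h.nbrs_eq], c1, by rw [s1, e3]; exact d3⟩
    · exact ⟨by simp [h.nbrs_eq, Finset.insert_subset_iff], c2, by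
        rw [s2, Finset.pair_comm]; exact d2⟩
    · exact ⟨by simp [h.nbrs_eq, Finset.insert_subset_iff], c3, by rw [s3]; exact d1⟩
    · exact ⟨by simp [h.nbrs_eq], d1, by rw [t1, e3']; exact c3⟩
    · exact ⟨by simp [h.nbrs_eq, Finset.insert_subset_iff], d2, by
        rw [t2, Finset.pair_comm]; exact c2⟩
    · exact ⟨by simp [h.nbrs_eq, Finset.insert_subset_iff], d3, by rw [t3]; exact c1⟩

theorem sum_arcs (h : IsBoundaryPath T v p₀ p₁ p₂ p₃) (G : Finset V → ℂ) :
    ∑ B ∈ T.arcs v, G B = G {p₀} + G {p₀, p₁} + G {p₀, p₁, p₂} + G {p₃} + G {p₃, p₂} +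
      G {p₃, p₂, p₁} := by
  have hn : ∀ {A B : Finset V} (x : V), (x ∈ A ∧ x ∉ B ∨ x ∈ B ∧ x ∉ A) → A ≠ B := by
    rintro A B x h rfl
    tauto
  have h01 := h.ne₀₁; have h02 := h.ne₀₂; have h03 := h.ne₀₃
  have h12 := h.ne₁₂; have h13 := h.ne₁₃; have h23 := h.ne₂₃
  rw [h.arcs_eq, Finset.sum_insert, Finset.sum_insert, Finset.sum_insert, Finset.sum_insert,
    Finset.sum_pair (hn p₁ (by simp [h12, h13]))]
  · ring
  all_goals simp only [Finset.mem_insert, Finset.mem_singleton, not_or]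
  · exact ⟨hn p₂ (by simp [h23]), hn p₂ (by simp [h23])⟩
  · exact ⟨hn p₀ (by simp [h03]), hn p₀ (by simp [h03, h02]), hn p₀ (by simp [h03, h02, h01])⟩
  · exact ⟨hn p₂ (by simp [h02.symm, h12.symm]), hn p₀ (by simp [h03]),
      hn p₀ (by simp [h03, h02]), hn p₀ (by simp [h03, h02, h01])⟩
  · exact ⟨hn p₁ (by simp [h01.symm]), hn p₁ (by simp [h01.symm]), hn p₀ (by simp [h03]),
      hn p₀ (by simp [h03, h02]), hn p₀ (by simp [h03, h02, h01])⟩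

theorem sum_nbrs (h : IsBoundaryPath T v p₀ p₁ p₂ p₃) (G : V → ℂ) :
    ∑ u ∈ T.nbrs v, G u = G p₀ + G p₁ + G p₂ + G p₃ := by
  rw [h.nbrs_eq, Finset.sum_insert (by simp [h.ne₀₁, h.ne₀₂, h.ne₀₃]),
    Finset.sum_insert (by simp [h.ne₁₂, h.ne₁₃]), Finset.sum_pair h.ne₂₃]
  ring

theorem filter_faces_eq (h : IsBoundaryPath T v p₀ p₁ p₂ p₃) :
    T.faces.filter (fun f => v ∈ f) = {{v, p₀, p₁}, {v, p₁, p₂}, {v, p₂, p₃}} := by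
  ext f
  simp only [Finset.mem_filter, Finset.mem_insert, Finset.mem_singleton]
  constructor
  · rintro ⟨hf, hvf⟩
    obtain ⟨a, ha, hav⟩ := Finset.exists_mem_ne (by rw [T.card_face f hf]; norm_num) v
    obtain ⟨b, rfl⟩ := exists_eq_of_mem_face hf hav hvf ha
    rw [← linkAdj_iff] at hf
    have han := mem_nbrs_of_linkAdj hf
    rw [h.nbrs_eq] at han
    simp only [Finset.mem_insert, Finset.mem_singleton] at han
    rcases han with rfl | rfl | rfl | rfl
    · rw [(h.adj₀ b).1 hf]; exact Or.inl rfl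
    · rcases (h.adj₁ b).1 hf with rfl | rfl
      · exact Or.inl (by rw [Finset.pair_comm])
      · exact Or.inr (Or.inl rfl)
    · rcases (h.adj₂ b).1 hf with rfl | rfl
      · exact Or.inr (Or.inl (by rw [Finset.pair_comm]))
      · exact Or.inr (Or.inr rfl)
    · rw [(h.adj₃ b).1 hf]; exact Or.inr (Or.inr (by rw [Finset.pair_comm]))
  · rintro (rfl | rfl | rfl)
    · exact ⟨linkAdj_iff.1 ((h.adj₀ _).2 rfl), by simp⟩
    · exact ⟨linkAdj_iff.1 ((h.adj₁ _).2 (Or.inr rfl)), by simp⟩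
    · exact ⟨linkAdj_iff.1 ((h.adj₂ _).2 (Or.inr rfl)), by simp⟩

theorem notMem_nbrs (h : IsBoundaryPath T v p₀ p₁ p₂ p₃) : v ≠ p₀ ∧ v ≠ p₁ ∧ v ≠ p₂ ∧ v ≠ p₃ := by
  have hn : ∀ u ∈ T.nbrs v, v ≠ u := fun u hu => (T.mem_nbrs.1 hu).1.symm
  rw [h.nbrs_eq] at hn
  exact ⟨hn _ (by simp), hn _ (by simp), hn _ (by simp), hn _ (by simp)⟩

theorem sum_faces (h : IsBoundaryPath T v p₀ p₁ p₂ p₃) (G : Finset V → ℂ) :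
    ∑ f ∈ T.faces.filter (fun f => v ∈ f), G f =
      G {v, p₀, p₁} + G {v, p₁, p₂} + G {v, p₂, p₃} := by
  obtain ⟨n0, n1, n2, n3⟩ := h.notMem_nbrs
  have hn : ∀ {A B : Finset V} (x : V), x ∈ A → x ∉ B → A ≠ B := by
    rintro A B x h1 h2 rfl
    exact h2 h1
  rw [h.filter_faces_eq, Finset.sum_insert, Finset.sum_pair
    (hn p₁ (by simp) (by simp [n1.symm, h.ne₁₂, h.ne₁₃]))]
  · ring
  · simp only [Finset.mem_insert, Finset.mem_singleton, not_or]
    exact ⟨hn p₀ (by simp) (by simp [n0.symm, h.ne₀₁, h.ne₀₂]),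
      hn p₀ (by simp) (by simp [n0.symm, h.ne₀₂, h.ne₀₃])⟩

end IsBoundaryPath

/-- The interior vertex p₂ is an end of the arc p₀p₁p₂ and is shielded from p₀ by p₁. Shorter arcs
need no splitting. -/
theorem EndSplitting.apply_initial {g : Finset V → ℂ} (hg : EndSplitting T v g)
    (h : IsBoundaryPath T v p₀ p₁ p₂ p₃) :
    g {p₀, p₁, p₂} = g {p₀, p₁} + g {p₁, p₂} - g {p₁} := by
  have e3 : ({p₀, p₁, p₂} : Finset V) = {p₂, p₁, p₀} := by
    ext x; simp only [Finset.mem_insert, Finset.mem_singleton]; tauto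
  have h1 := hg p₂ p₁ {p₀} h.mem₂ ((h.adj₂ _).2 (Or.inl rfl)) (by simp [h.nbrs_eq])
    (by simp [h.ne₀₂.symm]) (by simp [h.ne₀₁.symm])
    (by simp [h.adj₂, h.ne₀₁, h.ne₀₃])
    (by
      rw [← e3, h.arcs_eq]; simp)
  change g {p₂, p₁, p₀} + _ = g {p₁, p₀} + _ at h1
  rw [e3, Finset.pair_comm p₀ p₁, Finset.pair_comm p₁ p₂]
  linear_combination h1

/-- The average of `Δ̂(B, v, D)` over the partitions of the link of a boundary vertex. -/
theorem MarkovFamily.average_boundary {k : Finset V → ℂ} (hk : MarkovFamily T k)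
    (hT : T.NoEmptyTriangle) (hb : T.LatticeBoundary) {v : V} (hv : v ∈ T.boundaryVerts) :
    1 / ((T.arcs v).card : ℂ) * ∑ B ∈ T.arcs v,
        (k (B ∪ {v}) + k ({v} ∪ (T.nbrs v \ B)) - k B - k (T.nbrs v \ B)) =
      (2 * (∑ f ∈ T.faces.filter (fun f => v ∈ f), k f -
          ∑ f ∈ T.faces.filter (fun f => v ∈ f), k (f.erase v)) +
        ∑ u ∈ T.nbrs v, (if u ∈ T.boundaryVerts then 1 else -1) * (k {u, v} - k {u})) / 3 := by
  obtain ⟨p₀, p₁, p₂, p₃, h⟩ := exists_boundaryPath hb hv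
  obtain ⟨n0, n1, n2, n3⟩ := h.notMem_nbrs
  have hcard : ((T.arcs v).card : ℂ) = 6 := by
    have := h.sum_arcs fun _ => 1
    rw [Finset.sum_const, nsmul_eq_mul, mul_one] at this
    rw [this]; norm_num
  have r := h.reverse
  obtain ⟨s1, s2, s3⟩ := h.sdiff_initial
  obtain ⟨t1, t2, t3⟩ := r.sdiff_initial
  have e3 : ({p₁, p₂, p₃} : Finset V) = {p₃, p₂, p₁} := by
    ext x; simp only [Finset.mem_insert, Finset.mem_singleton]; tauto
  have e3' : ({p₂, p₁, p₀} : Finset V) = {p₀, p₁, p₂} := by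
    ext x; simp only [Finset.mem_insert, Finset.mem_singleton]; tauto
  have g1 := (hk.endSplitting hT v).apply_initial h
  have g2 := (hk.endSplitting hT v).apply_initial r
  have g3 := (hk.endSplitting_cone hT v).apply_initial h
  have g4 := (hk.endSplitting_cone hT v).apply_initial r
  have m1 := T.mem_interiorVerts.1 h.mem₁
  have m2 := T.mem_interiorVerts.1 h.mem₂
  rw [hcard, h.sum_arcs, h.sum_faces, h.sum_faces, h.sum_nbrs, s1, s2, s3, t1, t2, t3, e3, e3']
  simp only [h.mem₀, h.mem₃, m1, m2, if_true, if_false]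
  rw [Finset.erase_insert (by simp [n0, n1]), Finset.erase_insert (by simp [n1, n2]),
    Finset.erase_insert (by simp [n2, n3])]
  have f : ∀ a b : V, ({a, b} : Finset V) ∪ {v} = {v, a, b} := fun a b => by
    rw [Finset.union_comm]; rfl
  rw [Finset.pair_comm p₂ p₁] at g2 g4
  simp only [Finset.union_comm {v}, f, ← Finset.insert_eq, Finset.pair_comm p₃ p₂,
    Finset.pair_comm p₂ p₁, Finset.pair_comm p₁ p₀] at g1 g2 g3 g4 ⊢
  -- Each arc of three vertices occurs twice among the six ordered partitions, once as B and once as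
  -- D.
  linear_combination 2 / 6 * (g3 + g4 - g1 - g2)

end TriangulatedSurface

/-! ### Double counting and assembly of the Hamiltonian. -/

namespace TriangulatedSurface
variable {V : Type*} [Fintype V] [DecidableEq V] {T : TriangulatedSurface V}

/-- In the lattice situation no edge joins two boundary vertices across the interior: the boundary
neighbours of a boundary vertex are the ends of its link path, where the link degree is one. -/
theorem boundaryEdges_iff (hb : T.LatticeBoundary) {u v : V} (h : T.Adj u v) :
    {u, v} ∈ T.boundaryEdges ↔ u ∈ T.boundaryVerts ∧ v ∈ T.boundaryVerts := by
  rw [mem_boundaryEdges]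
  constructor
  · rintro ⟨h, hc⟩
    exact T.mem_boundaryVerts_of_ncard h hc
  · rintro ⟨hu, hv⟩
    refine ⟨h, Set.ncard_eq_one.2 ?_⟩
    obtain ⟨p₀, p₁, p₂, p₃, hp⟩ := exists_boundaryPath hb hv
    have hm := T.mem_nbrs.2 h
    rw [hp.nbrs_eq] at hm
    simp only [Finset.mem_insert, Finset.mem_singleton] at hm
    rcases hm with rfl | rfl | rfl | rfl
    · exact ⟨p₁, by ext w; exact hp.adj₀ w⟩
    · exact absurd hu (T.mem_interiorVerts.1 hp.mem₁)
    · exact absurd hu (T.mem_interiorVerts.1 hp.mem₂)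
    · exact ⟨p₂, by ext w; exact hp.adj₃ w⟩

theorem sum_sum_faces (h : V → Finset V → ℂ) :
    ∑ v, ∑ f ∈ T.faces.filter (fun f => v ∈ f), h v f = ∑ f ∈ T.faces, ∑ v ∈ f, h v f :=
  Finset.sum_comm' (by simp [and_comm])

theorem sum_erase_eq {f : Finset V} (hf : f.card = 3) (k : Finset V → ℂ) :
    ∑ v ∈ f, k (f.erase v) = ∑ e ∈ f.powersetCard 2, k e := by
  refine Finset.sum_bij (fun v _ => f.erase v) ?_ ?_ ?_ fun _ _ => rfl
  · intro v hv
    exact Finset.mem_powersetCard.2 ⟨Finset.erase_subset _ _, by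
      rw [Finset.card_erase_of_mem hv, hf]⟩
  · intro a ha b hb he
    exact Finset.erase_injOn f ha hb he
  · intro e he
    obtain ⟨hs, hc⟩ := Finset.mem_powersetCard.1 he
    obtain ⟨v, hv⟩ := Finset.card_eq_one.1
      (show (f \ e).card = 1 by rw [Finset.card_sdiff_of_subset hs, hf, hc])
    have hvf : v ∈ f \ e := hv ▸ Finset.mem_singleton_self v
    exact ⟨v, (Finset.mem_sdiff.1 hvf).1, by
      rw [Finset.erase_eq, ← hv, Finset.sdiff_sdiff_eq_self hs]⟩

variable (T) in
theorem sum_sum_powersetCard (k : Finset V → ℂ) :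
    ∑ f ∈ T.faces, ∑ e ∈ f.powersetCard 2, k e =
      ∑ e ∈ T.edges, (if e ∈ T.boundaryEdges then 1 else 2) * k e := by
  rw [Finset.sum_comm' (t' := T.edges) (s' := fun e => T.faces.filter fun f => e ⊆ f)]
  · refine Finset.sum_congr rfl fun e he => ?_
    rw [Finset.sum_const, nsmul_eq_mul]
    obtain ⟨u, v, h, rfl⟩ := T.mem_edges.1 he
    rw [T.card_filter_faces h.1]
    rcases T.ncard_neighborSet h with h1 | h1 <;> simp [mem_boundaryEdges, h1, h]
  · intro f e
    rw [Finset.mem_powersetCard, Finset.mem_filter]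
    constructor
    · rintro ⟨hf, he, hc⟩
      exact ⟨⟨hf, he⟩, Finset.mem_biUnion.2 ⟨f, hf, Finset.mem_powersetCard.2 ⟨he, hc⟩⟩⟩
    · rintro ⟨⟨hf, he⟩, h⟩
      obtain ⟨f', -, h'⟩ := Finset.mem_biUnion.1 h
      exact ⟨hf, he, (Finset.mem_powersetCard.1 h').2⟩

theorem sum_nbrs_edges (v : V) (h : Finset V → ℂ) :
    ∑ u ∈ T.nbrs v, h {u, v} = ∑ e ∈ T.edges.filter (fun e => v ∈ e), h e := by
  refine Finset.sum_bij (fun u _ => {u, v}) ?_ ?_ ?_ fun _ _ => rfl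
  · intro u hu
    exact Finset.mem_filter.2 ⟨T.mem_edges.2 ⟨u, v, T.mem_nbrs.1 hu, rfl⟩, by simp⟩
  · intro a ha b hb he
    have h1 : a ∈ ({b, v} : Finset V) := he ▸ by simp
    simpa [(T.mem_nbrs.1 ha).1] using h1
  · intro e he
    obtain ⟨he, hv⟩ := Finset.mem_filter.1 he
    obtain ⟨a, b, hab, rfl⟩ := T.mem_edges.1 he
    rcases Finset.mem_insert.1 hv with rfl | hv
    · exact ⟨b, T.mem_nbrs.2 hab.symm, Finset.pair_comm _ _⟩
    · obtain rfl := Finset.mem_singleton.1 hv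
      exact ⟨a, T.mem_nbrs.2 hab, rfl⟩

variable (T) in
theorem sum_sum_nbrs_edges (h : Finset V → ℂ) :
    ∑ v, ∑ u ∈ T.nbrs v, h {u, v} = 2 * ∑ e ∈ T.edges, h e := by
  rw [Finset.sum_congr rfl fun v _ => sum_nbrs_edges v h,
    Finset.sum_comm' (t' := T.edges) (s' := fun e => e) (by simp [and_comm]), Finset.mul_sum]
  refine Finset.sum_congr rfl fun e he => ?_
  obtain ⟨u, v, h, rfl⟩ := T.mem_edges.1 he
  rw [Finset.sum_const, Finset.card_pair h.1, nsmul_eq_mul]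
  norm_num

/-- `1` for two boundary vertices and `-1` otherwise. -/
noncomputable def boundarySign (T : TriangulatedSurface V) (u v : V) : ℂ :=
  if u ∈ T.boundaryVerts ∧ v ∈ T.boundaryVerts then 1 else -1

theorem sum_boundarySign_interior {u : V} (hu : u ∈ T.interiorVerts) :
    ∑ v ∈ T.nbrs u, T.boundarySign u v = -T.deg u := by
  rw [mem_interiorVerts] at hu
  simp [boundarySign, hu, deg]

/-- Two boundary and two interior neighbours cancel; this removes the vertex terms at the boundary.
-/
theorem sum_boundarySign_boundary (hb : T.LatticeBoundary) {u : V} (hu : u ∈ T.boundaryVerts) :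
    ∑ v ∈ T.nbrs u, T.boundarySign u v = 0 := by
  obtain ⟨p₀, p₁, p₂, p₃, h⟩ := exists_boundaryPath hb hu
  have m1 := T.mem_interiorVerts.1 h.mem₁
  have m2 := T.mem_interiorVerts.1 h.mem₂
  rw [h.sum_nbrs]
  simp [boundarySign, hu, h.mem₀, h.mem₃, m1, m2]

theorem sum_interior_add_sum_boundary (T : TriangulatedSurface V) (f : V → ℂ) :
    ∑ v ∈ T.interiorVerts, f v + ∑ v ∈ T.boundaryVerts, f v = ∑ v, f v :=
  Finset.sum_sdiff (Finset.subset_univ _)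

theorem sum_sum_boundarySign (hb : T.LatticeBoundary) (x : V → ℂ) :
    ∑ v, ∑ u ∈ T.nbrs v, T.boundarySign u v * x u =
      -∑ v ∈ T.interiorVerts, T.deg v * x v := by
  rw [Finset.sum_comm' (t' := Finset.univ) (s' := T.nbrs) (by
    intro v u
    simp only [Finset.mem_univ, true_and, and_true, mem_nbrs]
    exact ⟨Adj.symm, Adj.symm⟩)]
  simp only [← Finset.sum_mul]
  have h0 : ∑ u ∈ T.boundaryVerts, (∑ v ∈ T.nbrs u, T.boundarySign u v) * x u = 0 :=
    Finset.sum_eq_zero fun u hu => by rw [sum_boundarySign_boundary hb hu, zero_mul]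
  rw [← sum_interior_add_sum_boundary, h0, add_zero, ← Finset.sum_neg_distrib]
  exact Finset.sum_congr rfl fun u hu => by rw [sum_boundarySign_interior hu, neg_mul]

/-- The contribution of a vertex to the reconstructed Hamiltonian, without the term of the vertex
itself. -/
noncomputable def localTerm (T : TriangulatedSurface V) (k : Finset V → ℂ) (v : V) : ℂ :=
  1 / 3 * (∑ f ∈ T.faces.filter (fun f => v ∈ f), k f -
      ∑ f ∈ T.faces.filter (fun f => v ∈ f), k (f.erase v)) +
    1 / 6 * ∑ u ∈ T.nbrs v, T.boundarySign u v * (k {u, v} - k {u})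

/-- Each triangle is counted 3 · 1/3 times. An inner edge gets -2/3 from its two triangles and -1/3
from its two ends; a boundary edge gets -1/3 + 1/3 = 0. The terms k {u} collect deg u / 6 for
interior u and cancel for boundary u. -/
theorem sum_localTerm (hb : T.LatticeBoundary) (k : Finset V → ℂ) :
    ∑ v, T.localTerm k v = ∑ f ∈ T.faces, k f - ∑ e ∈ T.edges \ T.boundaryEdges, k e +
      1 / 6 * ∑ v ∈ T.interiorVerts, T.deg v * k {v} := by
  have h1 : ∑ v, ∑ f ∈ T.faces.filter (fun f => v ∈ f), k f = 3 * ∑ f ∈ T.faces, k f := by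
    rw [sum_sum_faces, Finset.mul_sum]
    refine Finset.sum_congr rfl fun f hf => ?_
    rw [Finset.sum_const, T.card_face f hf, nsmul_eq_mul]
    norm_num
  have h2 : ∑ v, ∑ f ∈ T.faces.filter (fun f => v ∈ f), k (f.erase v) =
      ∑ e ∈ T.edges, (if e ∈ T.boundaryEdges then 1 else 2) * k e := by
    rw [sum_sum_faces fun v f => k (f.erase v), ← sum_sum_powersetCard]
    exact Finset.sum_congr rfl fun f hf => sum_erase_eq (T.card_face f hf) k
  have h3 : ∑ v, ∑ u ∈ T.nbrs v, T.boundarySign u v * k {u, v} =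
      2 * ∑ e ∈ T.edges, (if e ∈ T.boundaryEdges then 1 else -1) * k e := by
    rw [← sum_sum_nbrs_edges]
    refine Finset.sum_congr rfl fun v _ => Finset.sum_congr rfl fun u hu => ?_
    simp only [boundarySign, boundaryEdges_iff hb (T.mem_nbrs.1 hu)]
  have h4 := sum_sum_boundarySign hb fun u => k {u}
  have h5 : ∑ e ∈ T.edges \ T.boundaryEdges, k e =
      1 / 3 * ∑ e ∈ T.edges, (if e ∈ T.boundaryEdges then 1 else 2) * k e -
        1 / 3 * ∑ e ∈ T.edges, (if e ∈ T.boundaryEdges then 1 else -1) * k e := by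
    rw [Finset.mul_sum, Finset.mul_sum, ← Finset.sum_sub_distrib, Finset.sdiff_eq_filter,
      Finset.sum_filter]
    refine Finset.sum_congr rfl fun e _ => ?_
    split_ifs <;> ring
  simp only [localTerm, mul_sub, Finset.sum_add_distrib, Finset.sum_sub_distrib,
    ← Finset.mul_sum] at h1 h2 h3 h4 h5 ⊢
  rw [h1, h2, h3, h4, h5]
  ring

/-- The weight (6-d)/6 is the one that removes the degree: (d-2)/(2d) + (6-d)/(6d) = 1/3 and
-(d-4)/(2d) - (6-d)/(3d) = -1/6. The remaining (6-d)/6 k {v} complements the d/6 of `sum_localTerm`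
to 1. -/
theorem MarkovFamily.interior_eq {k : Finset V → ℂ} (hk : MarkovFamily T k)
    (hT : T.NoEmptyTriangle) (hb : T.LatticeBoundary) {v : V} (hv : v ∈ T.interiorVerts) :
    1 / 2 * (1 / ((bulkArcs T v).card : ℂ) * ∑ B ∈ bulkArcs T v,
        (k (B ∪ {v}) + k ({v} ∪ (T.nbrs v \ B)) - k B - k (T.nbrs v \ B))) -
      (6 - T.deg v) / 6 * (1 / (T.deg v : ℂ) * ∑ f ∈ T.faces.filter (fun f => v ∈ f),
        (∑ e ∈ f.powersetCard 2, k e - k f - ∑ u ∈ f, k {u})) =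
    T.localTerm k v + (6 - T.deg v) / 6 * k {v} := by
  obtain ⟨c, hc⟩ := T.exists_cyclicOrder hv
  have h3 : 3 ≤ T.deg v := hc.three_le
  have hd : (T.deg v : ℂ) ≠ 0 := Nat.cast_ne_zero.2 (by omega)
  have hs : ∀ u, T.boundarySign u v = -1 := fun u => by
    simp [boundarySign, T.mem_interiorVerts.1 hv]
  rw [hk.average_bulk hT hb hv, sum_hatGamma_eq k hv, localTerm]
  simp only [hs, ← Finset.mul_sum, Finset.sum_sub_distrib]
  field_simp
  ring

theorem MarkovFamily.boundary_eq {k : Finset V → ℂ} (hk : MarkovFamily T k)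
    (hT : T.NoEmptyTriangle) (hb : T.LatticeBoundary) {v : V} (hv : v ∈ T.boundaryVerts) :
    1 / 2 * (1 / ((T.arcs v).card : ℂ) * ∑ B ∈ T.arcs v,
        (k (B ∪ {v}) + k ({v} ∪ (T.nbrs v \ B)) - k B - k (T.nbrs v \ B))) =
    T.localTerm k v := by
  rw [hk.average_boundary hT hb hv, localTerm]
  simp only [boundarySign, hv, and_true]
  ring

theorem MarkovFamily.reconstruction_eq {k : Finset V → ℂ} (hk : MarkovFamily T k)
    (hT : T.NoEmptyTriangle) (hb : T.LatticeBoundary) :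
    (∑ v ∈ T.interiorVerts, 1 / 2 * (1 / ((bulkArcs T v).card : ℂ) * ∑ B ∈ bulkArcs T v,
        (k (B ∪ {v}) + k ({v} ∪ (T.nbrs v \ B)) - k B - k (T.nbrs v \ B))) +
      ∑ v ∈ T.boundaryVerts, 1 / 2 * (1 / ((T.arcs v).card : ℂ) * ∑ B ∈ T.arcs v,
        (k (B ∪ {v}) + k ({v} ∪ (T.nbrs v \ B)) - k B - k (T.nbrs v \ B)))) -
      ∑ v ∈ T.interiorVerts, (6 - T.deg v) / 6 *
        (1 / (T.deg v : ℂ) * ∑ f ∈ T.faces.filter (fun f => v ∈ f),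
          (∑ e ∈ f.powersetCard 2, k e - k f - ∑ u ∈ f, k {u})) =
    ∑ f ∈ T.faces, k f - ∑ e ∈ T.edges \ T.boundaryEdges, k e + ∑ v ∈ T.interiorVerts, k {v} := by
  rw [add_sub_right_comm, ← Finset.sum_sub_distrib,
    Finset.sum_congr rfl fun v hv => hk.interior_eq hT hb hv,
    Finset.sum_congr rfl fun v hv => hk.boundary_eq hT hb hv, Finset.sum_add_distrib,
    add_right_comm, sum_interior_add_sum_boundary, sum_localTerm hb, add_assoc, add_right_inj,
    Finset.mul_sum, ← Finset.sum_add_distrib]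
  exact Finset.sum_congr rfl fun v _ => by ring

end TriangulatedSurface

section
variable {V : Type*} [Fintype V] [DecidableEq V]
  {κ : V → Type*} [∀ v, Fintype (κ v)] [∀ v, DecidableEq (κ v)]

theorem commonSupport_le_regionSupport {T : TriangulatedSurface V}
    {ρ : Matrix (∀ v, κ v) (∀ v, κ v) ℂ} {A : Finset V} (hA : A ∈ occurringRegions T) :
    commonSupport T ρ ≤ regionSupport ρ A :=
  iInf₂_le A hA

/-- A fixed vector and coordinate turn the operator identities into linear relations between
numbers. In `entHam_markov` the region D is the rest of the link, and the membership in
`occurringRegions` puts ψ into the support of ρ_ABC. -/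
theorem BulkA1.markovFamily [Nonempty (∀ v, κ v)] {T : TriangulatedSurface V}
    {ρ : Matrix (∀ v, κ v) (∀ v, κ v) ℂ} (hρ : ρ.PosSemidef) (hA1 : BulkA1 T ρ)
    {ψ : (∀ v, κ v) → ℂ} (hψ : ψ ∈ commonSupport T ρ) (x : ∀ v, κ v) :
    T.MarkovFamily fun A => (entHam ρ A *ᵥ ψ) x := by
  intro v hv B hB A hA hvA hocc
  have hBn := T.subset_of_mem_arcs hB
  have hvn : v ∉ T.nbrs v := fun h => (T.mem_nbrs.1 h).1 rfl
  have hvB : v ∉ B := fun h => hvn (hBn h)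
  have h := entHam_markov hρ (A := A) (B := B) (C := {v}) (D := T.nbrs v \ B)
    (hA.mono_right hBn) (Finset.disjoint_singleton_right.2 hvA)
    (hA.mono_right Finset.sdiff_subset) (Finset.disjoint_singleton_right.2 hvB)
    Finset.disjoint_sdiff
    (Finset.disjoint_singleton_left.2 fun h => hvn (Finset.sdiff_subset h))
    (hA1 v hv B hB) (commonSupport_le_regionSupport hocc hψ)
  exact congrFun h x

end

theorem mainTheorem6 {V : Type*} [Fintype V] [DecidableEq V] (T : TriangulatedSurface V)
    (hT : T.NoEmptyTriangle) (hbdry : T.LatticeBoundary)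
    {κ : V → Type*} [∀ v, Fintype (κ v)] [∀ v, DecidableEq (κ v)]
    (ρ : Matrix (∀ v, κ v) (∀ v, κ v) ℂ) (hρ : ρ.PosSemidef) (htr : ρ.trace = 1)
    (hA1 : BulkA1 T ρ) :
    LinearMap.range ρ.mulVecLin ≤ commonSupport T ρ ∧
    ∀ ψ ∈ commonSupport T ρ,
      (HrecDelta T ρ
        - ∑ v ∈ T.interiorVerts, (((6 : ℂ) - (T.deg v : ℂ)) / 6) • avgGamma T ρ v) *ᵥ ψ
      = HrecEuler T ρ *ᵥ ψ := by
  -- Without configurations the trace of ρ would be an empty sum, hence 0 and not 1.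
  have hne : Nonempty (∀ v, κ v) := by
    by_contra hne
    rw [not_nonempty_iff] at hne
    simp [Matrix.trace] at htr
  refine ⟨le_iInf₂ fun A _ => range_le_regionSupport hρ A, fun ψ hψ => funext fun x => ?_⟩
  have h := (hA1.markovFamily hρ hψ x).reconstruction_eq hT hbdry
  simpa only [HrecDelta, HrecEuler, avgDelta, avgDeltaBoundary, avgGamma, hatDelta, hatGamma,
    Matrix.add_mulVec, Matrix.sub_mulVec, Matrix.sum_mulVec, Matrix.smul_mulVec, Pi.add_apply,
    Pi.sub_apply, Pi.smul_apply, Finset.sum_apply, smul_eq_mul] using h
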